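/- **Conventions.** Let $k$ be a commutative ring with unit. A 3-term complex is a chain complex $(L,d)=(L_0\xleftarrow{d}L_1\xleftarrow{d}L_2)$ of $k$-modules. A degree-$r$ map $\mu:L^{\otimes n}\to L'$ (written $L^{\otimes n}\to L'[r]$) has differential $\partial\mu=d'\mu-(-1)^{r}\mu\, d_{L^{\otimes n}}$. All signs follow the Koszul rule: $\mu^\sigma(v_1,\dots,v_n)=\varepsilon(\sigma;v)\,\mu(v_{\sigma^{-1}(1)},\dots,v_{\sigma^{-1}(n)})$ with the Koszul sign $\varepsilon$, extended linearly to the group ring ($\mu^{1-(12)}=\mu-\mu^{(12)}$); $(\mu\circ_i\nu)(v_1,\dots)=(-1)^{|\nu|(|v_1|+\dots+|v_{i-1}|)}\mu(v_1,\dots,v_{i-1},\nu(v_i,\dots),\dots)$; and $\mu\circ(\nu_1,\dots,\nu_m)=\mu\,(\nu_1\otimes\dots\otimes\nu_m)$. **Weak Lie 3-algebras.** A weak Lie 3-algebra $(L,d,\lambda)$ is a 3-term complex with $k$-linear maps $\lambda_2:L^{\otimes2}\to L$, $\lambda_{2;1}:L^{\otimes2}\to L[1]$, $\lambda_{2;1,1}:L^{\otimes2}\to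 L[2]$, $\lambda_3:L^{\otimes3}\to L[1]$, $\lambda_{3;1},\lambda_{3;2}:L^{\otimes3}\to L[2]$, $\lambda_4:L^{\otimes4}\to L[2]$ such that (Leibniz 3-algebra) $$\partial\lambda_2=0,\qquad \partial\lambda_3=(\lambda_2\circ_2\lambda_2)^{1-(12)}-\lambda_2\circ_1\lambda_2,$$ $$\partial\lambda_4=\lambda_2\circ_1\lambda_3+(\lambda_2\circ_2\lambda_3)^{1-(12)+(123)}-\lambda_3\circ_1\lambda_2+(\lambda_3\circ_2\lambda_2)^{1-(12)}-(\lambda_3\circ_3\lambda_2)^{1-(23)+(132)},$$ $$\begin{aligned}0={}&\lambda_2\circ_1\lambda_4-(\lambda_2\circ_2\lambda_4)^{1-(12)+(123)-(1234)}+\lambda_3\circ_1\lambda_3+(\lambda_3\circ_2\lambda_3)^{1-(12)+(123)}\\&+(\lambda_3\circ_3\lambda_3)^{1-(23)+(132)+(234)-(1342)+(13)(24)}+\lambda_4\circ_1\lambda_2-(\lambda_4\circ_2\lambda_2)^{1-(12)}\\&+(\lambda_4\circ_3\lambda_2)^{1-(23)+(132)}-(\lambda_4\circ_4\lambda_2)^{1-(34)+(243)-(1432)},\end{aligned}$$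 and $$\partial\lambda_{2;1}=\lambda_2+\lambda_2^{(12)},\quad \partial\lambda_{2;1,1}=\lambda_{2;1}-\lambda_{2;1}^{(12)},\quad \partial\lambda_{3;1}=\lambda_3+\lambda_3^{(12)}+\lambda_2\circ_1\lambda_{2;1},$$ $$\partial\lambda_{3;2}=\lambda_3+\lambda_3^{(23)}-\lambda_2\circ_2\lambda_{2;1}+\lambda_{2;1}\circ_1\lambda_2+(\lambda_{2;1}\circ_2\lambda_2)^{(12)},$$ $$\lambda_{2;1,1}+\lambda_{2;1,1}^{(12)}=0,\qquad \lambda_{3;1}-\lambda_{3;1}^{(12)}=\lambda_2\circ_1\lambda_{2;1,1},$$ $$\lambda_{3;1}^{1+(23)+(132)}-\lambda_{3;2}^{1+(12)+(123)}=(\lambda_{2;1}\circ_2\lambda_{2;1})^{1+(12)}+\lambda_{2;1}\circ_1\lambda_{2;1}+(\lambda_{2;1,1}\circ_2\lambda_2)^{(132)},$$ $$\lambda_{3;2}-\lambda_{3;2}^{(23)}=-\lambda_2\circ_2\lambda_{2;1,1}+\lambda_{2;1,1}\circ_1\lambda_2+(\lambda_{2;1,1}\circ_2\lambda_2)^{(12)},$$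 $$\lambda_4+\lambda_4^{(12)}=\lambda_2\circ_1\lambda_{3;1}-\lambda_{3;1}\circ_3\lambda_2+(\lambda_2\circ_2\lambda_{3;1})^{(123)}+\lambda_3\circ_1\lambda_{2;1},$$ $$\lambda_4+\lambda_4^{(23)}=\lambda_2\circ_1\lambda_{3;2}-\lambda_3\circ_2\lambda_{2;1}+\lambda_2\circ_2\lambda_{3;1}-\lambda_{3;1}\circ_1\lambda_2-(\lambda_{3;1}\circ_2\lambda_2)^{(12)}-(\lambda_{3;1}\circ_3\lambda_2)^{(132)},$$ $$\begin{aligned}\lambda_4+\lambda_4^{(34)}={}&\lambda_{2;1}\circ_1\lambda_3-\lambda_{3;2}\circ_1\lambda_2+(\lambda_{3;2}\circ_2\lambda_2)^{1-(12)}+\lambda_3\circ_3\lambda_{2;1}\\&+(\lambda_{3;2}\circ_3\lambda_2)^{(23)-(132)}+(\lambda_2\circ_2\lambda_{3;2})^{1-(12)}+(\lambda_{2;1}\circ_2\lambda_3)^{(123)}.\end{aligned}$$ **Weak morphisms.** A weak morphism $f:(L,d,\lambda)\to(L',d',\lambda')$ consists of $k$-linear maps $f_1:L\to L'$, $f_2:L^{\otimes2}\to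 L'[1]$, $f_3:L^{\otimes3}\to L'[2]$, $f_{2;1}:L^{\otimes2}\to L'[2]$ with $$\partial f_1=0,\qquad \partial f_2=f_1\circ\lambda_2-\lambda_2'\circ(f_1,f_1),$$ $$\begin{aligned}\partial f_3={}&f_1\circ\lambda_3-(f_2\circ_2\lambda_2)^{1-(12)}+f_2\circ_1\lambda_2\\&-\lambda_3'\circ(f_1,f_1,f_1)-\lambda_2'\circ(f_1,f_2)^{1-(12)}+\lambda_2'\circ(f_2,f_1),\end{aligned}$$ $$\begin{aligned}f_1\circ\lambda_4-\lambda_4'\circ(f_1,f_1,f_1,f_1)={}&f_2\circ_1\lambda_3+(f_2\circ_2\lambda_3)^{1-(12)+(123)}-f_3\circ_1\lambda_2+(f_3\circ_2\lambda_2)^{1-(12)}\\&-(f_3\circ_3\lambda_2)^{1-(23)+(132)}+\lambda_2'\circ(f_3,f_1)+\lambda_2'\circ(f_1,f_3)^{1-(12)+(123)}\\&-\lambda_2'\circ(f_2,f_2)^{1-(23)+(132)}+\lambda_3'\circ(f_2,f_1,f_1)\\&-\lambda_3'\circ(f_1,f_2,f_1)^{1-(12)}+\lambda_3'\circ(f_1,f_1,f_2)^{1-(23)+(132)},\end{aligned}$$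 $$\partial f_{2;1}=-f_2-f_2^{(12)}+f_1\circ\lambda_{2;1}-\lambda_{2;1}'\circ(f_1,f_1),$$ $$f_1\circ\lambda_{2;1,1}-\lambda_{2;1,1}'\circ(f_1,f_1)=f_{2;1}-f_{2;1}^{(12)},$$ $$f_1\circ\lambda_{3;1}-\lambda_{3;1}'\circ(f_1,f_1,f_1)=f_3+f_3^{(12)}+f_2\circ_1\lambda_{2;1}+\lambda_2'\circ(f_{2;1},f_1),$$ $$\begin{aligned}f_1\circ\lambda_{3;2}-\lambda_{3;2}'\circ(f_1,f_1,f_1)={}&f_3+f_3^{(23)}-f_2\circ_2\lambda_{2;1}+f_{2;1}\circ_1\lambda_2+(f_{2;1}\circ_2\lambda_2)^{(12)}\\&-\lambda_2'\circ(f_1,f_{2;1})-\lambda_{2;1}'\circ(f_2,f_1)-\lambda_{2;1}'\circ(f_1,f_2)^{(12)}.\end{aligned}$$ **Proposition (homotopy transfer).** Let $(L,d,\lambda)$ be a weak Lie 3-algebra and let the 3-term complex $(L',d')$ be a deformation retract of $(L,d)$: there are given chain maps $p:L\to L'$, $i:L'\to L$ and a degree-$1$ map $h:L\to L$ with $\mathrm{id}_L-ip=[d,h]=dh+hd$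 and $pi=\mathrm{id}_{L'}$. Then the maps $$\lambda_2'=p\,\lambda_2(i,i),\quad \lambda_{2;1}'=p\,\lambda_{2;1}(i,i),\quad \lambda_{2;1,1}'=p\,\lambda_{2;1,1}(i,i),\quad \lambda_3'=p\,\theta_3\,(i,i,i),$$ $$\lambda_{3;1}'=p\,\big(\lambda_{3;1}-\lambda_2\circ_1(h\lambda_{2;1})\big)(i,i,i),$$ $$\lambda_{3;2}'=p\,\big(\lambda_{3;2}+\lambda_{2;1}\circ_1(h\lambda_2)+\lambda_2\circ_2(h\lambda_{2;1})+(\lambda_{2;1}\circ_2(h\lambda_2))^{(12)}\big)(i,i,i),$$ $$\lambda_4'=p\,(\lambda_4-\alpha-\beta)(i,i,i,i),$$ where $$\theta_3=\lambda_3+\lambda_2\circ_1(h\lambda_2)-(\lambda_2\circ_2(h\lambda_2))^{1-(12)},$$ $$\begin{aligned}\alpha={}&\lambda_2\circ_1(h\lambda_3)+(\lambda_2\circ_2(h\lambda_3))^{1-(12)+(123)}+\lambda_3\circ_1(h\lambda_2)\\&-(\lambda_3\circ_2(h\lambda_2))^{1-(12)}+(\lambda_3\circ_3(h\lambda_2))^{1-(23)+(132)},\end{aligned}$$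 $$\begin{aligned}\beta={}&(\lambda_2\circ_1(h\lambda_2))\circ_1(h\lambda_2)-\big((\lambda_2\circ_1(h\lambda_2))\circ_2(h\lambda_2)\big)^{1-(12)}+\lambda_2\circ(h\lambda_2,h\lambda_2)^{1-(23)+(132)}\\&+\big((\lambda_2\circ_2(h\lambda_2))\circ_2(h\lambda_2)\big)^{1-(12)+(123)}-\big((\lambda_2\circ_2(h\lambda_2))\circ_3(h\lambda_2)\big)^{1-(12)+(123)-(23)+(132)-(13)},\end{aligned}$$ make $(L',d',\lambda')$ a weak Lie 3-algebra, and $i$ extends to a weak morphism of weak Lie 3-algebras $(L',d',\lambda')\to(L,d,\lambda)$ with components $$i_1=i,\qquad i_2=-h\,\lambda_2(i,i),\qquad i_3=-h\,\theta_3\,(i,i,i),\qquad i_{2;1}=-h\,\lambda_{2;1}(i,i).$$ -/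

import Mathlib

/-- A `3`-term chain complex `L₀ ← L₁ ← L₂` of `k`-modules, written as an internally `ℤ`-graded
`k`-module `L` concentrated in degrees `0, 1, 2` with a differential of degree `-1`. -/
structure ThreeTermComplex (k : Type*) [CommRing k] (L : Type*) [AddCommGroup L] [Module k L] where
  gr : ℤ → Submodule k L
  isInternal : DirectSum.IsInternal gr
  gr_eq_bot : ∀ n : ℤ, n < 0 ∨ 2 < n → gr n = ⊥
  d : L →ₗ[k] L
  d_mem : ∀ (n : ℤ) (x : L), x ∈ gr n → d x ∈ gr (n - 1)
  d_d : ∀ x : L, d (d x) = 0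

/-- An operation `L^{⊗ n} → L'` of degree `r`, given by its values on tuples of homogeneous
elements. An argument is a pair `(a, v)`, to be read as a vector `v` of degree `a`; the degrees
are needed for the Koszul signs. Inputs are numbered `0, …, n - 1`. -/
def Op (L L' : Type*) (n : ℕ) (_r : ℤ) : Type _ := (Fin n → ℤ × L) → L'

/-- Apply a map (of degree `0`) to all arguments. -/
def mapArgs {L L' : Type*} (f : L → L') {n : ℕ} (x : Fin n → ℤ × L) : Fin n → ℤ × L' :=
  fun j => ((x j).1, f (x j).2)

/-- The total degree of a tuple of arguments. -/
def totalDeg {L : Type*} {n : ℕ} (x : Fin n → ℤ × L) : ℤ := ∑ j, (x j).1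

namespace Op

variable {L L' L'' : Type*}

section linear

variable {k : Type*} [CommRing k] [AddCommGroup L] [Module k L] [AddCommGroup L'] [Module k L']

/-- A linear map as a unary operation of degree `r`. -/
def lin1 (r : ℤ) (f : L →ₗ[k] L') : Op L L' 1 r := fun x => f (x 0).2

/-- A bilinear map as a binary operation of degree `r`. -/
def lin2 (r : ℤ) (f : L →ₗ[k] L →ₗ[k] L') : Op L L' 2 r := fun x => f (x 0).2 (x 1).2

/-- A trilinear map as a ternary operation of degree `r`. -/
def lin3 (r : ℤ) (f : L →ₗ[k] L →ₗ[k] L →ₗ[k] L') : Op L L' 3 r :=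
  fun x => f (x 0).2 (x 1).2 (x 2).2

/-- A quadrilinear map as a quaternary operation of degree `r`. -/
def lin4 (r : ℤ) (f : L →ₗ[k] L →ₗ[k] L →ₗ[k] L →ₗ[k] L') : Op L L' 4 r :=
  fun x => f (x 0).2 (x 1).2 (x 2).2 (x 3).2

end linear

variable [AddCommGroup L] [AddCommGroup L'] [AddCommGroup L'']

/-- The composite `g ∘ μ` with a map `g` of degree `s`. -/
def post {n : ℕ} {r : ℤ} (s : ℤ) (g : L' → L'') (μ : Op L L' n r) : Op L L'' n (s + r) :=
  fun x => g (μ x)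

/-- The partial composition that inserts `ν` into the `i`-th input of `μ` (counted from `0`):
`(-1)^(|ν| (|v₀| + ⋯ + |vᵢ₋₁|)) μ (v₀, …, vᵢ₋₁, ν (vᵢ, …, vᵢ₊ₙ₋₁), vᵢ₊ₙ, …)`. -/
def circ {m n : ℕ} {r s : ℤ} (μ : Op L L' m r) (i : Fin m) (ν : Op L L n s) :
    Op L L' (m + n - 1) (r + s) := fun x =>
  let inner : Fin n → ℤ × L := fun l => x ⟨i + l, by omega⟩
  (s * ∑ j : Fin i, (x ⟨j, by omega⟩).1).negOnePow •
    μ fun j =>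
      if hlt : j < i then x ⟨j, by omega⟩
      else if heq : j = i then (totalDeg inner + s, ν inner)
      else x ⟨j + n - 1, by omega⟩

/-- The full composition `μ ∘ (ν₁, ν₂)`. -/
def comp2 {a b : ℕ} {r s₁ s₂ : ℤ} (μ : Op L' L'' 2 r) (ν₁ : Op L L' a s₁) (ν₂ : Op L L' b s₂) :
    Op L L'' (a + b) (r + s₁ + s₂) := fun x =>
  let x₁ : Fin a → ℤ × L := fun l => x ⟨l, by omega⟩
  let x₂ : Fin b → ℤ × L := fun l => x ⟨a + l, by omega⟩
  (s₂ * totalDeg x₁).negOnePow •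
    μ ![(totalDeg x₁ + s₁, ν₁ x₁), (totalDeg x₂ + s₂, ν₂ x₂)]

/-- The full composition `μ ∘ (ν₁, ν₂, ν₃)`. -/
def comp3 {a b c : ℕ} {r s₁ s₂ s₃ : ℤ} (μ : Op L' L'' 3 r)
    (ν₁ : Op L L' a s₁) (ν₂ : Op L L' b s₂) (ν₃ : Op L L' c s₃) :
    Op L L'' (a + b + c) (r + s₁ + s₂ + s₃) := fun x =>
  let x₁ : Fin a → ℤ × L := fun l => x ⟨l, by omega⟩
  let x₂ : Fin b → ℤ × L := fun l => x ⟨a + l, by omega⟩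
  let x₃ : Fin c → ℤ × L := fun l => x ⟨a + b + l, by omega⟩
  (s₂ * totalDeg x₁ + s₃ * (totalDeg x₁ + totalDeg x₂)).negOnePow •
    μ ![(totalDeg x₁ + s₁, ν₁ x₁), (totalDeg x₂ + s₂, ν₂ x₂), (totalDeg x₃ + s₃, ν₃ x₃)]

/-- The right action `μ^σ (v₀, …, vₙ₋₁) = ε(σ; v) μ (v_{σ⁻¹ 0}, …, v_{σ⁻¹ (n-1)})` of the symmetric
group, where `ε` is the Koszul sign: one factor `(-1)^(|vᵢ| |vⱼ|)` for every pair that `σ`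
puts out of order. -/
def perm {n : ℕ} {r : ℤ} (μ : Op L L' n r) (σ : Equiv.Perm (Fin n)) : Op L L' n r := fun x =>
  (∏ i, ∏ j, if i < j ∧ σ j < σ i then ((x i).1 * (x j).1).negOnePow else 1) •
    μ (fun j => x (σ.symm j))

/-- The action of a single cycle: `μ.cyc [i₁, i₂, …, iₗ] = μ^(i₁ i₂ … iₗ)`, the cycle
`i₁ ↦ i₂ ↦ ⋯ ↦ iₗ ↦ i₁`, with inputs counted from `0`. -/
def cyc {n : ℕ} {r : ℤ} (μ : Op L L' n r) (c : List (Fin n)) : Op L L' n r := μ.perm c.formPerm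

end Op

namespace ThreeTermComplex

variable {k : Type*} [CommRing k] {L L' : Type*} [AddCommGroup L] [Module k L]
  [AddCommGroup L'] [Module k L']

/-- Every argument is homogeneous of the degree attached to it. -/
def Homog (C : ThreeTermComplex k L) {n : ℕ} (x : Fin n → ℤ × L) : Prop :=
  ∀ j, (x j).2 ∈ C.gr (x j).1

/-- The operation `μ` is homogeneous of degree `r`. -/
def HasDegree (C : ThreeTermComplex k L) (C' : ThreeTermComplex k L') {n : ℕ} {r : ℤ}
    (μ : Op L L' n r) : Prop :=
  ∀ x, C.Homog x → μ x ∈ C'.gr (totalDeg x + r)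

/-- The differential `∂ μ = d' ∘ μ - (-1)^|μ| μ ∘ d_{L^{⊗ n}}` of the complex of operations. -/
def bdry (C : ThreeTermComplex k L) (C' : ThreeTermComplex k L') {n : ℕ} {r : ℤ}
    (μ : Op L L' n r) : Op L L' n (r - 1) := fun x =>
  C'.d (μ x) - r.negOnePow • ∑ j : Fin n,
    (∑ l : Fin j, (x ⟨l, by omega⟩).1).negOnePow •
      μ (Function.update x j ((x j).1 - 1, C.d (x j).2))

end ThreeTermComplex

/-- The structure maps `λ₂, λ₃, λ₄` (Leibniz part) and `λ_{2;1}, λ_{2;1,1}, λ_{3;1}, λ_{3;2}`,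
without any condition. -/
structure Lie3Maps (k : Type*) [CommRing k] (L : Type*) [AddCommGroup L] [Module k L] where
  l2 : L →ₗ[k] L →ₗ[k] L
  l3 : L →ₗ[k] L →ₗ[k] L →ₗ[k] L
  l4 : L →ₗ[k] L →ₗ[k] L →ₗ[k] L →ₗ[k] L
  l21 : L →ₗ[k] L →ₗ[k] L
  l211 : L →ₗ[k] L →ₗ[k] L
  l31 : L →ₗ[k] L →ₗ[k] L →ₗ[k] L
  l32 : L →ₗ[k] L →ₗ[k] L →ₗ[k] L

namespace Lie3Maps

variable {k : Type*} [CommRing k] {L : Type*} [AddCommGroup L] [Module k L] (A : Lie3Maps k L)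

def o2 : Op L L 2 0 := Op.lin2 0 A.l2
def o3 : Op L L 3 1 := Op.lin3 1 A.l3
def o4 : Op L L 4 2 := Op.lin4 2 A.l4
def o21 : Op L L 2 1 := Op.lin2 1 A.l21
def o211 : Op L L 2 2 := Op.lin2 2 A.l211
def o31 : Op L L 3 2 := Op.lin3 2 A.l31
def o32 : Op L L 3 2 := Op.lin3 2 A.l32

/-- `(L, d, λ₂, λ₃, λ₄)` is a Leibniz `3`-algebra. -/
structure IsLeibniz3 (C : ThreeTermComplex k L) : Prop where
  deg2 : C.HasDegree C A.o2
  deg3 : C.HasDegree C A.o3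
  deg4 : C.HasDegree C A.o4
  eq2 : ∀ x, C.Homog x → C.bdry C A.o2 x = 0
  eq3 : ∀ x, C.Homog x → C.bdry C A.o3 x =
    A.o2.circ 1 A.o2 x - A.o2.circ 0 A.o2 x - (A.o2.circ 1 A.o2).cyc [0, 1] x
  eq4 : ∀ x, C.Homog x → C.bdry C A.o4 x =
    A.o2.circ 0 A.o3 x + A.o2.circ 1 A.o3 x - (A.o2.circ 1 A.o3).cyc [0, 1] x
      + (A.o2.circ 1 A.o3).cyc [0, 1, 2] x - A.o3.circ 0 A.o2 x
      + A.o3.circ 1 A.o2 x - (A.o3.circ 1 A.o2).cyc [0, 1] x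
      - A.o3.circ 2 A.o2 x + (A.o3.circ 2 A.o2).cyc [1, 2] x
      - (A.o3.circ 2 A.o2).cyc [0, 2, 1] x
  eq5 : ∀ x, C.Homog x → 0 =
    A.o2.circ 0 A.o4 x - A.o2.circ 1 A.o4 x + (A.o2.circ 1 A.o4).cyc [0, 1] x
      - (A.o2.circ 1 A.o4).cyc [0, 1, 2] x + (A.o2.circ 1 A.o4).cyc [0, 1, 2, 3] x
      + A.o3.circ 0 A.o3 x + A.o3.circ 1 A.o3 x - (A.o3.circ 1 A.o3).cyc [0, 1] x
      + (A.o3.circ 1 A.o3).cyc [0, 1, 2] x + A.o3.circ 2 A.o3 x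
      - (A.o3.circ 2 A.o3).cyc [1, 2] x + (A.o3.circ 2 A.o3).cyc [0, 2, 1] x
      + (A.o3.circ 2 A.o3).cyc [1, 2, 3] x - (A.o3.circ 2 A.o3).cyc [0, 2, 3, 1] x
      + (A.o3.circ 2 A.o3).perm (Equiv.swap 0 2 * Equiv.swap 1 3) x
      + A.o4.circ 0 A.o2 x - A.o4.circ 1 A.o2 x + (A.o4.circ 1 A.o2).cyc [0, 1] x
      + A.o4.circ 2 A.o2 x - (A.o4.circ 2 A.o2).cyc [1, 2] x
      + (A.o4.circ 2 A.o2).cyc [0, 2, 1] x - A.o4.circ 3 A.o2 x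
      + (A.o4.circ 3 A.o2).cyc [2, 3] x - (A.o4.circ 3 A.o2).cyc [1, 3, 2] x
      + (A.o4.circ 3 A.o2).cyc [0, 3, 2, 1] x

/-- `(L, d, λ)` is a weak Lie `3`-algebra. -/
structure IsWeakLie3 (C : ThreeTermComplex k L) : Prop extends A.IsLeibniz3 C where
  deg21 : C.HasDegree C A.o21
  deg211 : C.HasDegree C A.o211
  deg31 : C.HasDegree C A.o31
  deg32 : C.HasDegree C A.o32
  eq21 : ∀ x, C.Homog x → C.bdry C A.o21 x = A.o2 x + A.o2.cyc [0, 1] x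
  eq211 : ∀ x, C.Homog x → C.bdry C A.o211 x = A.o21 x - A.o21.cyc [0, 1] x
  eq31 : ∀ x, C.Homog x → C.bdry C A.o31 x =
    A.o3 x + A.o3.cyc [0, 1] x + A.o2.circ 0 A.o21 x
  eq32 : ∀ x, C.Homog x → C.bdry C A.o32 x =
    A.o3 x + A.o3.cyc [1, 2] x - A.o2.circ 1 A.o21 x
      + A.o21.circ 0 A.o2 x + (A.o21.circ 1 A.o2).cyc [0, 1] x
  eq2111 : ∀ x, C.Homog x → A.o211 x + A.o211.cyc [0, 1] x = 0
  eq311 : ∀ x, C.Homog x → A.o31 x - A.o31.cyc [0, 1] x = A.o2.circ 0 A.o211 x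
  eq312 : ∀ x, C.Homog x →
    A.o31 x - A.o32.cyc [0, 1] x + A.o31.cyc [0, 2, 1] x
      - A.o32 x + A.o31.cyc [1, 2] x - A.o32.cyc [0, 1, 2] x =
    A.o21.circ 1 A.o21 x + A.o21.circ 0 A.o21 x
      + (A.o21.circ 1 A.o21).cyc [0, 1] x + (A.o211.circ 1 A.o2).cyc [0, 2, 1] x
  eq322 : ∀ x, C.Homog x → A.o32 x - A.o32.cyc [1, 2] x =
    - A.o2.circ 1 A.o211 x + A.o211.circ 0 A.o2 x + (A.o211.circ 1 A.o2).cyc [0, 1] x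
  eq41 : ∀ x, C.Homog x → A.o4 x + A.o4.cyc [0, 1] x =
    A.o2.circ 0 A.o31 x - A.o31.circ 2 A.o2 x
      + (A.o2.circ 1 A.o31).cyc [0, 1, 2] x + A.o3.circ 0 A.o21 x
  eq42 : ∀ x, C.Homog x → A.o4 x + A.o4.cyc [1, 2] x =
    A.o2.circ 0 A.o32 x - A.o3.circ 1 A.o21 x + A.o2.circ 1 A.o31 x
      - A.o31.circ 0 A.o2 x - (A.o31.circ 1 A.o2).cyc [0, 1] x
      - (A.o31.circ 2 A.o2).cyc [0, 2, 1] x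
  eq43 : ∀ x, C.Homog x → A.o4 x + A.o4.cyc [2, 3] x =
    A.o21.circ 0 A.o3 x - A.o32.circ 0 A.o2 x
      + A.o32.circ 1 A.o2 x - (A.o32.circ 1 A.o2).cyc [0, 1] x
      + A.o3.circ 2 A.o21 x + (A.o32.circ 2 A.o2).cyc [1, 2] x
      - (A.o32.circ 2 A.o2).cyc [0, 2, 1] x
      + A.o2.circ 1 A.o32 x - (A.o2.circ 1 A.o32).cyc [0, 1] x
      + (A.o21.circ 1 A.o3).cyc [0, 1, 2] x

end Lie3Maps

/-- A weak Lie `3`-algebra structure on the complex `C`. -/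
structure WeakLie3Algebra {k : Type*} [CommRing k] {L : Type*} [AddCommGroup L] [Module k L]
    (C : ThreeTermComplex k L) extends Lie3Maps k L where
  isWeakLie3 : toLie3Maps.IsWeakLie3 C

/-- The components `f₁, f₂, f₃, f_{2;1}` of a weak morphism, without any condition. -/
structure Lie3MorMaps (k : Type*) [CommRing k] (L L' : Type*) [AddCommGroup L] [Module k L]
    [AddCommGroup L'] [Module k L'] where
  f1 : L →ₗ[k] L'
  f2 : L →ₗ[k] L →ₗ[k] L'
  f3 : L →ₗ[k] L →ₗ[k] L →ₗ[k] L'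
  f21 : L →ₗ[k] L →ₗ[k] L'

namespace Lie3MorMaps

variable {k : Type*} [CommRing k] {L L' : Type*} [AddCommGroup L] [Module k L]
  [AddCommGroup L'] [Module k L'] (f : Lie3MorMaps k L L')

def o1 : Op L L' 1 0 := Op.lin1 0 f.f1
def o2 : Op L L' 2 1 := Op.lin2 1 f.f2
def o3 : Op L L' 3 2 := Op.lin3 2 f.f3
def o21 : Op L L' 2 2 := Op.lin2 2 f.f21

/-- `(f₁, f₂, f₃)` is a weak morphism of Leibniz `3`-algebras `(L, d, λ) → (L', d', λ')`. -/
structure IsLeibniz3Mor (C : ThreeTermComplex k L) (C' : ThreeTermComplex k L')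
    (A : Lie3Maps k L) (A' : Lie3Maps k L') : Prop where
  deg1 : C.HasDegree C' f.o1
  deg2 : C.HasDegree C' f.o2
  deg3 : C.HasDegree C' f.o3
  eq1 : ∀ x, C.Homog x → C.bdry C' f.o1 x = 0
  eq2 : ∀ x, C.Homog x → C.bdry C' f.o2 x = f.f1 (A.o2 x) - A'.o2 (mapArgs f.f1 x)
  eq3 : ∀ x, C.Homog x → C.bdry C' f.o3 x =
    f.f1 (A.o3 x) - f.o2.circ 1 A.o2 x + f.o2.circ 0 A.o2 x + (f.o2.circ 1 A.o2).cyc [0, 1] x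
      - A'.o3 (mapArgs f.f1 x) - A'.o2.comp2 f.o1 f.o2 x + A'.o2.comp2 f.o2 f.o1 x
      + (A'.o2.comp2 f.o1 f.o2).cyc [0, 1] x
  eq4 : ∀ x, C.Homog x → f.f1 (A.o4 x) - A'.o4 (mapArgs f.f1 x) =
    f.o2.circ 0 A.o3 x + f.o2.circ 1 A.o3 x - (f.o2.circ 1 A.o3).cyc [0, 1] x
      + (f.o2.circ 1 A.o3).cyc [0, 1, 2] x - f.o3.circ 0 A.o2 x
      + f.o3.circ 1 A.o2 x - (f.o3.circ 1 A.o2).cyc [0, 1] x - f.o3.circ 2 A.o2 x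
      + (f.o3.circ 2 A.o2).cyc [1, 2] x - (f.o3.circ 2 A.o2).cyc [0, 2, 1] x
      + A'.o2.comp2 f.o3 f.o1 x + A'.o2.comp2 f.o1 f.o3 x
      - (A'.o2.comp2 f.o1 f.o3).cyc [0, 1] x + (A'.o2.comp2 f.o1 f.o3).cyc [0, 1, 2] x
      - A'.o2.comp2 f.o2 f.o2 x + (A'.o2.comp2 f.o2 f.o2).cyc [1, 2] x
      - (A'.o2.comp2 f.o2 f.o2).cyc [0, 2, 1] x
      + A'.o3.comp3 f.o2 f.o1 f.o1 x
      - A'.o3.comp3 f.o1 f.o2 f.o1 x + (A'.o3.comp3 f.o1 f.o2 f.o1).cyc [0, 1] x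
      + A'.o3.comp3 f.o1 f.o1 f.o2 x
      - (A'.o3.comp3 f.o1 f.o1 f.o2).cyc [1, 2] x
      + (A'.o3.comp3 f.o1 f.o1 f.o2).cyc [0, 2, 1] x

/-- `f` is a weak morphism of weak Lie `3`-algebras `(L, d, λ) → (L', d', λ')`. -/
structure IsWeakLie3Mor (C : ThreeTermComplex k L) (C' : ThreeTermComplex k L')
    (A : Lie3Maps k L) (A' : Lie3Maps k L') : Prop extends f.IsLeibniz3Mor C C' A A' where
  deg21 : C.HasDegree C' f.o21
  eq21 : ∀ x, C.Homog x → C.bdry C' f.o21 x =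
    - f.o2 x - f.o2.cyc [0, 1] x + f.f1 (A.o21 x) - A'.o21 (mapArgs f.f1 x)
  eq211 : ∀ x, C.Homog x → f.f1 (A.o211 x) - A'.o211 (mapArgs f.f1 x) =
    f.o21 x - f.o21.cyc [0, 1] x
  eq31 : ∀ x, C.Homog x → f.f1 (A.o31 x) - A'.o31 (mapArgs f.f1 x) =
    f.o3 x + f.o3.cyc [0, 1] x + f.o2.circ 0 A.o21 x + A'.o2.comp2 f.o21 f.o1 x
  eq32 : ∀ x, C.Homog x → f.f1 (A.o32 x) - A'.o32 (mapArgs f.f1 x) =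
    f.o3 x + f.o3.cyc [1, 2] x - f.o2.circ 1 A.o21 x
      + f.o21.circ 0 A.o2 x + (f.o21.circ 1 A.o2).cyc [0, 1] x
      - A'.o2.comp2 f.o1 f.o21 x - A'.o21.comp2 f.o2 f.o1 x
      - (A'.o21.comp2 f.o1 f.o2).cyc [0, 1] x

end Lie3MorMaps

/-- A weak morphism of weak Lie `3`-algebras. -/
structure WeakLie3Mor {k : Type*} [CommRing k] {L L' : Type*} [AddCommGroup L] [Module k L]
    [AddCommGroup L'] [Module k L'] {C : ThreeTermComplex k L} {C' : ThreeTermComplex k L'}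
    (A : WeakLie3Algebra C) (A' : WeakLie3Algebra C') extends Lie3MorMaps k L L' where
  isWeakLie3Mor : toLie3MorMaps.IsWeakLie3Mor C C' A.toLie3Maps A'.toLie3Maps

/-- A deformation retract of `3`-term complexes: chain maps `p : L → L'`, `i : L' → L` and a map
`h : L → L` of degree `1` with `id - i p = [d, h] = d h + h d` and `p i = id`. -/
structure DeformationRetract {k : Type*} [CommRing k] {L L' : Type*} [AddCommGroup L] [Module k L]
    [AddCommGroup L'] [Module k L'] (C : ThreeTermComplex k L) (C' : ThreeTermComplex k L') where
  p : L →ₗ[k] L'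
  i : L' →ₗ[k] L
  h : L →ₗ[k] L
  p_mem : ∀ (n : ℤ) (x : L), x ∈ C.gr n → p x ∈ C'.gr n
  i_mem : ∀ (n : ℤ) (x : L'), x ∈ C'.gr n → i x ∈ C.gr n
  h_mem : ∀ (n : ℤ) (x : L), x ∈ C.gr n → h x ∈ C.gr (n + 1)
  p_d : ∀ x : L, p (C.d x) = C'.d (p x)
  i_d : ∀ x : L', i (C'.d x) = C.d (i x)
  homotopy : ∀ x : L, x - i (p x) = C.d (h x) + h (C.d x)
  p_i : ∀ x : L', p (i x) = x

namespace DeformationRetract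

variable {k : Type*} [CommRing k] {L L' : Type*} [AddCommGroup L] [Module k L]
  [AddCommGroup L'] [Module k L'] {C : ThreeTermComplex k L} {C' : ThreeTermComplex k L'}
  (R : DeformationRetract C C') (A : Lie3Maps k L)

/-- `h ∘ λ₂`. -/
def h2 : Op L L 2 1 := A.o2.post 1 R.h
/-- `h ∘ λ₃`. -/
def h3 : Op L L 3 2 := A.o3.post 1 R.h
/-- `h ∘ λ_{2;1}`. -/
def h21 : Op L L 2 2 := A.o21.post 1 R.h

/-- `λ₃ + λ₂ ∘₁ hλ₂ - (λ₂ ∘₂ hλ₂)^(1 - (12))`. -/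
def t3 : Op L L 3 1 := fun x =>
  A.o3 x + (A.o2.circ 0 (R.h2 A) x
    - (A.o2.circ 1 (R.h2 A) x - (A.o2.circ 1 (R.h2 A)).cyc [0, 1] x))

/-- The operation on `L` from which `λ₄'` is obtained. -/
def t4 : Op L L 4 2 := fun x =>
  A.o4 x
    - (A.o2.circ 0 (R.h3 A) x
      + (A.o2.circ 1 (R.h3 A) x - (A.o2.circ 1 (R.h3 A)).cyc [0, 1] x
        + (A.o2.circ 1 (R.h3 A)).cyc [0, 1, 2] x)
      + A.o3.circ 0 (R.h2 A) x
      - (A.o3.circ 1 (R.h2 A) x - (A.o3.circ 1 (R.h2 A)).cyc [0, 1] x)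
      + (A.o3.circ 2 (R.h2 A) x - (A.o3.circ 2 (R.h2 A)).cyc [1, 2] x
        + (A.o3.circ 2 (R.h2 A)).cyc [0, 2, 1] x))
    - ((A.o2.circ 0 (R.h2 A)).circ 0 (R.h2 A) x
      - ((A.o2.circ 0 (R.h2 A)).circ 1 (R.h2 A) x
        - ((A.o2.circ 0 (R.h2 A)).circ 1 (R.h2 A)).cyc [0, 1] x)
      + (A.o2.comp2 (R.h2 A) (R.h2 A) x
        - (A.o2.comp2 (R.h2 A) (R.h2 A)).cyc [1, 2] x
        + (A.o2.comp2 (R.h2 A) (R.h2 A)).cyc [0, 2, 1] x)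
      + ((A.o2.circ 1 (R.h2 A)).circ 1 (R.h2 A) x
        - ((A.o2.circ 1 (R.h2 A)).circ 1 (R.h2 A)).cyc [0, 1] x
        + ((A.o2.circ 1 (R.h2 A)).circ 1 (R.h2 A)).cyc [0, 1, 2] x)
      - ((A.o2.circ 1 (R.h2 A)).circ 2 (R.h2 A) x
        - ((A.o2.circ 1 (R.h2 A)).circ 2 (R.h2 A)).cyc [0, 1] x
        + ((A.o2.circ 1 (R.h2 A)).circ 2 (R.h2 A)).cyc [0, 1, 2] x
        - ((A.o2.circ 1 (R.h2 A)).circ 2 (R.h2 A)).cyc [1, 2] x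
        + ((A.o2.circ 1 (R.h2 A)).circ 2 (R.h2 A)).cyc [0, 2, 1] x
        - ((A.o2.circ 1 (R.h2 A)).circ 2 (R.h2 A)).cyc [0, 2] x))

/-- `λ_{3;1} - λ₂ ∘₁ hλ_{2;1}`. -/
def t31 : Op L L 3 2 := fun x => A.o31 x - A.o2.circ 0 (R.h21 A) x

/-- `λ_{3;2} + λ_{2;1} ∘₁ hλ₂ + λ₂ ∘₂ hλ_{2;1} + (λ_{2;1} ∘₂ hλ₂)^(12)`. -/
def t32 : Op L L 3 2 := fun x =>
  A.o32 x + (A.o21.circ 0 (R.h2 A) x + A.o2.circ 1 (R.h21 A) x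
    + (A.o21.circ 1 (R.h2 A)).cyc [0, 1] x)

/-- The structure maps `A'` on `L'` are the ones transferred from `A` along `R`, that is
`λ' = p ∘ t ∘ (i, …, i)` for the operations `t` above. -/
structure IsTransferred (A' : Lie3Maps k L') : Prop where
  l2 : ∀ x, C'.Homog x → A'.o2 x = R.p (A.o2 (mapArgs R.i x))
  l3 : ∀ x, C'.Homog x → A'.o3 x = R.p (R.t3 A (mapArgs R.i x))
  l4 : ∀ x, C'.Homog x → A'.o4 x = R.p (R.t4 A (mapArgs R.i x))
  l21 : ∀ x, C'.Homog x → A'.o21 x = R.p (A.o21 (mapArgs R.i x))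
  l211 : ∀ x, C'.Homog x → A'.o211 x = R.p (A.o211 (mapArgs R.i x))
  l31 : ∀ x, C'.Homog x → A'.o31 x = R.p (R.t31 A (mapArgs R.i x))
  l32 : ∀ x, C'.Homog x → A'.o32 x = R.p (R.t32 A (mapArgs R.i x))

/-- The components `f` are the standard extension of the inclusion `i` along `R`. -/
structure IsExtendedInclusion (f : Lie3MorMaps k L' L) : Prop where
  f1 : f.f1 = R.i
  f2 : ∀ x, C'.Homog x → f.o2 x = - R.h (A.o2 (mapArgs R.i x))
  f3 : ∀ x, C'.Homog x → f.o3 x = - R.h (R.t3 A (mapArgs R.i x))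
  f21 : ∀ x, C'.Homog x → f.o21 x = - R.h (A.o21 (mapArgs R.i x))

end DeformationRetract

/-! The transferred operations are sums of trees of operations of `L` with `h` on the inner edges,
`i` on the leaves and `p` at the root. Composing two of them puts `ip = 1 - [d, h]` on the
connecting edge. In the boundary of a tree, an inner edge is either contracted (the summand `1`) or
cut (the summand `ip`), since `[d, h] = 1 - ip`. The contracted terms cancel against the defining
relations at the vertices, and the cut terms form the relation required on `L'`. No side condition
on `h` enters.

Hence every composite relation on `L'` is `p` applied to a relation on `L` in which the trees `t3`,
`t31`, `t32`, `t4` replace the original operations and the projector `P = 1 - [d, h]` stands on each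
connecting edge (`transfer_eq3_000` to `transfer_eq5`). These hold for all arguments in `L`, not
only for those in the image of `i`. For the morphism, `-h t` is the correction attached to a tree
`t`, and the terms of its boundary are those of `P t = t - d h t - h d t` (`inclusion_eq3_000` to
`inclusion_eq32`).

A three-term complex leaves few degrees in which anything can be nonzero, so the relations are split
by the degrees of their arguments. With these degrees fixed all Koszul signs are explicit, and each
relation becomes an identity between multilinear maps on three modules. It is checked by expanding
`P`, moving `d` to a normal position with the original relations, and comparing formal sums.

What remains is the passage between operations and components. `Tame.ext` and its refinements reduce
an equality of operations to the finitely many relevant degrees, and the evaluation lemmas for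
`cyc`, `perm`, `circ`, `comp2`, `comp3` and `bdry` compute the signs. `components` extracts the
degreewise relations from the axioms, and `coe_P0`, `coe_P1`, `coe_P2` identify `P` with `ip`. Since
the operations of the statement are defined on homogeneous tuples only, `perturbed` supplies
globally multilinear maps with the same homogeneous values. -/

/-! ### Degreewise relations with the projector inserted -/

/-- The homogeneous components of a weak Lie `3`-algebra with underlying complex `M0 ← M1 ← M2`,
together with a map `h` of degree `1`. The subscripts of a component are the degrees of its
arguments, and components that vanish for degree reasons are left out. The relations are oriented
so that, used as rewriting rules, they move `d` out of the operations. -/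
structure Lie3Components (k : Type*) [CommRing k] (M0 M1 M2 : Type*)
    [AddCommGroup M0] [Module k M0] [AddCommGroup M1] [Module k M1]
    [AddCommGroup M2] [Module k M2] where
  d1 : M1 →ₗ[k] M0
  d2 : M2 →ₗ[k] M1
  h0 : M0 →ₗ[k] M1
  h1 : M1 →ₗ[k] M2
  l2_00 : M0 →ₗ[k] M0 →ₗ[k] M0
  l2_01 : M0 →ₗ[k] M1 →ₗ[k] M1
  l2_02 : M0 →ₗ[k] M2 →ₗ[k] M2
  l2_10 : M1 →ₗ[k] M0 →ₗ[k] M1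
  l2_11 : M1 →ₗ[k] M1 →ₗ[k] M2
  l2_20 : M2 →ₗ[k] M0 →ₗ[k] M2
  l21_00 : M0 →ₗ[k] M0 →ₗ[k] M1
  l21_01 : M0 →ₗ[k] M1 →ₗ[k] M2
  l21_10 : M1 →ₗ[k] M0 →ₗ[k] M2
  l211 : M0 →ₗ[k] M0 →ₗ[k] M2
  l3_000 : M0 →ₗ[k] M0 →ₗ[k] M0 →ₗ[k] M1
  l3_001 : M0 →ₗ[k] M0 →ₗ[k] M1 →ₗ[k] M2
  l3_010 : M0 →ₗ[k] M1 →ₗ[k] M0 →ₗ[k] M2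
  l3_100 : M1 →ₗ[k] M0 →ₗ[k] M0 →ₗ[k] M2
  l31 : M0 →ₗ[k] M0 →ₗ[k] M0 →ₗ[k] M2
  l32 : M0 →ₗ[k] M0 →ₗ[k] M0 →ₗ[k] M2
  l4 : M0 →ₗ[k] M0 →ₗ[k] M0 →ₗ[k] M0 →ₗ[k] M2
  d_d (x : M2) : d1 (d2 x) = 0
  l2_d_01 (x : M0) (y : M1) : l2_00 x (d1 y) = d1 (l2_01 x y)
  l2_d_02 (x : M0) (y : M2) : l2_01 x (d2 y) = d2 (l2_02 x y)
  l2_d_10 (x : M1) (y : M0) : l2_00 (d1 x) y = d1 (l2_10 x y)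
  l2_d_11 (x y : M1) : l2_01 (d1 x) y = d2 (l2_11 x y) + l2_10 x (d1 y)
  l2_d_12 (x : M1) (y : M2) : l2_02 (d1 x) y = l2_11 x (d2 y)
  l2_d_20 (x : M2) (y : M0) : l2_10 (d2 x) y = d2 (l2_20 x y)
  l2_d_21 (x : M2) (y : M1) : l2_11 (d2 x) y = -l2_20 x (d1 y)
  d_l3_000 (x y z : M0) : d1 (l3_000 x y z) = l2_00 x (l2_00 y z) - l2_00 (l2_00 x y) z
    - l2_00 y (l2_00 x z)
  l3_d_001 (x y : M0) (z : M1) : l3_000 x y (d1 z) = -d2 (l3_001 x y z) + l2_01 x (l2_01 y z)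
    - l2_01 (l2_00 x y) z - l2_01 y (l2_01 x z)
  l3_d_002 (x y : M0) (z : M2) : l3_001 x y (d2 z) = l2_02 x (l2_02 y z) - l2_02 (l2_00 x y) z
    - l2_02 y (l2_02 x z)
  l3_d_010 (x : M0) (y : M1) (z : M0) : l3_000 x (d1 y) z = -d2 (l3_010 x y z)
    + l2_01 x (l2_10 y z) - l2_10 (l2_01 x y) z - l2_10 y (l2_00 x z)
  l3_d_011 (x : M0) (y z : M1) : l3_001 x (d1 y) z = l3_010 x y (d1 z) + l2_02 x (l2_11 y z)
    - l2_11 (l2_01 x y) z - l2_11 y (l2_01 x z)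
  l3_d_020 (x : M0) (y : M2) (z : M0) : l3_010 x (d2 y) z = l2_02 x (l2_20 y z)
    - l2_20 (l2_02 x y) z - l2_20 y (l2_00 x z)
  l3_d_100 (x : M1) (y z : M0) : l3_000 (d1 x) y z = -d2 (l3_100 x y z) + l2_10 x (l2_00 y z)
    - l2_10 (l2_10 x y) z - l2_01 y (l2_10 x z)
  l3_d_101 (x : M1) (y : M0) (z : M1) : l3_001 (d1 x) y z = l3_100 x y (d1 z)
    + l2_11 x (l2_01 y z) - l2_11 (l2_10 x y) z - l2_02 y (l2_11 x z)
  l3_d_110 (x y : M1) (z : M0) : l3_010 (d1 x) y z = l3_100 x (d1 y) z + l2_11 x (l2_10 y z)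
    - l2_20 (l2_11 x y) z + l2_11 y (l2_10 x z)
  l3_d_200 (x : M2) (y z : M0) : l3_100 (d2 x) y z = l2_20 x (l2_00 y z) - l2_20 (l2_20 x y) z
    - l2_02 y (l2_20 x z)
  d_l4 (x y z w : M0) : d2 (l4 x y z w) = l2_10 (l3_000 x y z) w + l2_01 x (l3_000 y z w)
    - l2_01 y (l3_000 x z w) + l2_01 z (l3_000 x y w) - l3_000 (l2_00 x y) z w
    + l3_000 x (l2_00 y z) w - l3_000 y (l2_00 x z) w - l3_000 x y (l2_00 z w)
    + l3_000 x z (l2_00 y w) - l3_000 y z (l2_00 x w)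
  l4_d_0001 (x y z : M0) (w : M1) : l4 x y z (d1 w) = -l2_11 (l3_000 x y z) w
    - l2_02 x (l3_001 y z w) + l2_02 y (l3_001 x z w) - l2_02 z (l3_001 x y w)
    + l3_001 (l2_00 x y) z w - l3_001 x (l2_00 y z) w + l3_001 y (l2_00 x z) w
    + l3_001 x y (l2_01 z w) - l3_001 x z (l2_01 y w) + l3_001 y z (l2_01 x w)
  l4_d_0010 (x y : M0) (z : M1) (w : M0) : l4 x y (d1 z) w = -l2_20 (l3_001 x y z) w
    - l2_02 x (l3_010 y z w) + l2_02 y (l3_010 x z w) + l2_11 z (l3_000 x y w)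
    + l3_010 (l2_00 x y) z w - l3_010 x (l2_01 y z) w + l3_010 y (l2_01 x z) w
    + l3_001 x y (l2_10 z w) - l3_010 x z (l2_00 y w) + l3_010 y z (l2_00 x w)
  l4_d_0100 (x : M0) (y : M1) (z w : M0) : l4 x (d1 y) z w = -l2_20 (l3_010 x y z) w
    - l2_02 x (l3_100 y z w) - l2_11 y (l3_000 x z w) - l2_02 z (l3_010 x y w)
    + l3_100 (l2_01 x y) z w - l3_010 x (l2_10 y z) w + l3_100 y (l2_00 x z) w
    + l3_010 x y (l2_00 z w) - l3_001 x z (l2_10 y w) + l3_100 y z (l2_00 x w)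
  l4_d_1000 (x : M1) (y z w : M0) : l4 (d1 x) y z w = -l2_20 (l3_100 x y z) w
    + l2_11 x (l3_000 y z w) + l2_02 y (l3_100 x z w) - l2_02 z (l3_100 x y w)
    + l3_100 (l2_10 x y) z w - l3_100 x (l2_00 y z) w + l3_010 y (l2_10 x z) w
    + l3_100 x y (l2_00 z w) - l3_100 x z (l2_00 y w) + l3_001 y z (l2_10 x w)
  d_l21_00 (x y : M0) : d1 (l21_00 x y) = l2_00 x y + l2_00 y x
  l21_d_01 (x : M0) (y : M1) : l21_00 x (d1 y) = -d2 (l21_01 x y) + l2_01 x y + l2_10 y x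
  l21_d_02 (x : M0) (y : M2) : l21_01 x (d2 y) = l2_02 x y + l2_20 y x
  l21_d_10 (x : M1) (y : M0) : l21_00 (d1 x) y = -d2 (l21_10 x y) + l2_10 x y + l2_01 y x
  l21_d_11 (x y : M1) : l21_01 (d1 x) y = l21_10 x (d1 y) + l2_11 x y - l2_11 y x
  l21_d_20 (x : M2) (y : M0) : l21_10 (d2 x) y = l2_20 x y + l2_02 y x
  d_l211 (x y : M0) : d2 (l211 x y) = l21_00 x y - l21_00 y x
  l211_d_01 (x : M0) (y : M1) : l211 x (d1 y) = -l21_01 x y + l21_10 y x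
  l211_d_10 (x : M1) (y : M0) : l211 (d1 x) y = -l21_10 x y + l21_01 y x
  d_l31 (x y z : M0) : d2 (l31 x y z) = l3_000 x y z + l3_000 y x z + l2_10 (l21_00 x y) z
  l31_d_001 (x y : M0) (z : M1) : l31 x y (d1 z) = -l3_001 x y z - l3_001 y x z
    - l2_11 (l21_00 x y) z
  l31_d_010 (x : M0) (y : M1) (z : M0) : l31 x (d1 y) z = -l3_010 x y z - l3_100 y x z
    - l2_20 (l21_01 x y) z
  l31_d_100 (x : M1) (y z : M0) : l31 (d1 x) y z = -l3_100 x y z - l3_010 y x z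
    - l2_20 (l21_10 x y) z
  d_l32 (x y z : M0) : d2 (l32 x y z) = l3_000 x y z + l3_000 x z y - l2_01 x (l21_00 y z)
    + l21_00 (l2_00 x y) z + l21_00 y (l2_00 x z)
  l32_d_001 (x y : M0) (z : M1) : l32 x y (d1 z) = -l3_001 x y z - l3_010 x z y
    + l2_02 x (l21_01 y z) - l21_01 (l2_00 x y) z - l21_01 y (l2_01 x z)
  l32_d_010 (x : M0) (y : M1) (z : M0) : l32 x (d1 y) z = -l3_010 x y z - l3_001 x z y
    + l2_02 x (l21_10 y z) - l21_10 (l2_01 x y) z - l21_10 y (l2_00 x z)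
  l32_d_100 (x : M1) (y z : M0) : l32 (d1 x) y z = -l3_100 x y z - l3_100 x z y
    - l2_11 x (l21_00 y z) - l21_10 (l2_10 x y) z - l21_01 y (l2_10 x z)
  sym_2111 (x y : M0) : l211 x y + l211 y x = 0
  sym_311 (x y z : M0) : l31 x y z - l31 y x z = l2_20 (l211 x y) z
  sym_312 (x y z : M0) : l31 x y z + l31 x z y + l31 y z x - l32 x y z - l32 y x z - l32 z x y =
    l21_01 x (l21_00 y z) + l21_01 y (l21_00 x z) + l21_10 (l21_00 x y) z + l211 y (l2_00 z x)
  sym_322 (x y z : M0) : l32 x y z - l32 x z y = -l2_02 x (l211 y z) + l211 (l2_00 x y) z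
    + l211 y (l2_00 x z)
  sym_41 (x y z w : M0) : l4 x y z w + l4 y x z w = l2_20 (l31 x y z) w - l31 x y (l2_00 z w)
    + l2_02 z (l31 x y w) + l3_100 (l21_00 x y) z w
  sym_42 (x y z w : M0) : l4 x y z w + l4 x z y w = l2_20 (l32 x y z) w - l3_010 x (l21_00 y z) w
    + l2_02 x (l31 y z w) - l31 (l2_00 x y) z w - l31 y (l2_00 x z) w - l31 y z (l2_00 x w)
  sym_43 (x y z w : M0) : l4 x y z w + l4 x y w z = l21_10 (l3_000 x y z) w - l32 (l2_00 x y) z w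
    + l32 x (l2_00 y z) w - l32 y (l2_00 x z) w + l3_001 x y (l21_00 z w) + l32 x z (l2_00 y w)
    - l32 y z (l2_00 x w) + l2_02 x (l32 y z w) - l2_02 y (l32 x z w) + l21_01 z (l3_000 x y w)
  sym_5 (x y z w v : M0) : l2_20 (l4 x y z w) v - l2_02 x (l4 y z w v) + l2_02 y (l4 x z w v)
    - l2_02 z (l4 x y w v) + l2_02 w (l4 x y z v) + l3_100 (l3_000 x y z) w v
    + l3_010 x (l3_000 y z w) v - l3_010 y (l3_000 x z w) v + l3_010 z (l3_000 x y w) v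
    + l3_001 x y (l3_000 z w v) - l3_001 x z (l3_000 y w v) + l3_001 y z (l3_000 x w v)
    + l3_001 x w (l3_000 y z v) - l3_001 y w (l3_000 x z v) + l3_001 z w (l3_000 x y v)
    + l4 (l2_00 x y) z w v - l4 x (l2_00 y z) w v + l4 y (l2_00 x z) w v + l4 x y (l2_00 z w) v
    - l4 x z (l2_00 y w) v + l4 y z (l2_00 x w) v - l4 x y z (l2_00 w v) + l4 x y w (l2_00 z v)
    - l4 x z w (l2_00 y v) + l4 y z w (l2_00 x v) = 0

namespace Lie3Components

variable {k : Type*} [CommRing k] {M0 M1 M2 : Type*} [AddCommGroup M0] [Module k M0]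
  [AddCommGroup M1] [Module k M1] [AddCommGroup M2] [Module k M2] (A : Lie3Components k M0 M1 M2)

-- These rules define a normal form. `d` is pulled out of an operation, and when two arguments have
-- positive degree it settles on the right one of them. The boundary of a positive-degree operation
-- on arguments of degree `0` is eliminated. The relations `sym_*` compare sums with permuted
-- arguments and give no such rule.
attribute [local simp] d_d l2_d_01 l2_d_02 l2_d_10 l2_d_11 l2_d_12 l2_d_20 l2_d_21 d_l3_000
  l3_d_001 l3_d_002 l3_d_010 l3_d_011 l3_d_020 l3_d_100 l3_d_101 l3_d_110 l3_d_200 d_l4 l4_d_0001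
  l4_d_0010 l4_d_0100 l4_d_1000 d_l21_00 l21_d_01 l21_d_02 l21_d_10 l21_d_11 l21_d_20 d_l211
  l211_d_01 l211_d_10 d_l31 l31_d_001 l31_d_010 l31_d_100 d_l32 l32_d_001 l32_d_010 l32_d_100

/-- The degree `0` component of `1 - [d, h]`. -/
def P0 (x : M0) : M0 := x - A.d1 (A.h0 x)
/-- The degree `1` component of `1 - [d, h]`. -/
def P1 (x : M1) : M1 := x - A.d2 (A.h1 x) - A.h0 (A.d1 x)
/-- The degree `2` component of `1 - [d, h]`. -/
def P2 (x : M2) : M2 := x - A.h1 (A.d2 x)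

/-- The component of `t3` in degrees `0, 0, 0`. -/
def t3_000 (x y z : M0) : M1 := A.l3_000 x y z + A.l2_10 (A.h0 (A.l2_00 x y)) z
  - A.l2_01 x (A.h0 (A.l2_00 y z)) + A.l2_01 y (A.h0 (A.l2_00 x z))

/-- The component of `t3` in degrees `0, 0, 1`. -/
def t3_001 (x y : M0) (z : M1) : M2 := A.l3_001 x y z + A.l2_11 (A.h0 (A.l2_00 x y)) z
  - A.l2_02 x (A.h1 (A.l2_01 y z)) + A.l2_02 y (A.h1 (A.l2_01 x z))

/-- The component of `t3` in degrees `0, 1, 0`. -/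
def t3_010 (x : M0) (y : M1) (z : M0) : M2 := A.l3_010 x y z + A.l2_20 (A.h1 (A.l2_01 x y)) z
  - A.l2_02 x (A.h1 (A.l2_10 y z)) - A.l2_11 y (A.h0 (A.l2_00 x z))

/-- The component of `t3` in degrees `1, 0, 0`. -/
def t3_100 (x : M1) (y z : M0) : M2 := A.l3_100 x y z + A.l2_20 (A.h1 (A.l2_10 x y)) z
  + A.l2_11 x (A.h0 (A.l2_00 y z)) + A.l2_02 y (A.h1 (A.l2_10 x z))

/-- The component of `t31` in degrees `0, 0, 0`. -/
def t31 (x y z : M0) : M2 := A.l31 x y z - A.l2_20 (A.h1 (A.l21_00 x y)) z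

/-- The component of `t32` in degrees `0, 0, 0`. -/
def t32 (x y z : M0) : M2 := A.l32 x y z + A.l21_10 (A.h0 (A.l2_00 x y)) z
  + A.l2_02 x (A.h1 (A.l21_00 y z)) + A.l21_01 y (A.h0 (A.l2_00 x z))

/-- The component of `t4` in degrees `0, 0, 0, 0`. -/
def t4 (x y z w : M0) : M2 := A.l4 x y z w - A.l2_20 (A.h1 (A.l3_000 x y z)) w
  - A.l2_02 x (A.h1 (A.l3_000 y z w)) + A.l2_02 y (A.h1 (A.l3_000 x z w))
  - A.l2_02 z (A.h1 (A.l3_000 x y w)) - A.l3_100 (A.h0 (A.l2_00 x y)) z w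
  + A.l3_010 x (A.h0 (A.l2_00 y z)) w - A.l3_010 y (A.h0 (A.l2_00 x z)) w
  - A.l3_001 x y (A.h0 (A.l2_00 z w)) + A.l3_001 x z (A.h0 (A.l2_00 y w))
  - A.l3_001 y z (A.h0 (A.l2_00 x w)) - A.l2_20 (A.h1 (A.l2_10 (A.h0 (A.l2_00 x y)) z)) w
  + A.l2_20 (A.h1 (A.l2_01 x (A.h0 (A.l2_00 y z)))) w
  - A.l2_20 (A.h1 (A.l2_01 y (A.h0 (A.l2_00 x z)))) w
  - A.l2_11 (A.h0 (A.l2_00 x y)) (A.h0 (A.l2_00 z w))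
  + A.l2_11 (A.h0 (A.l2_00 x z)) (A.h0 (A.l2_00 y w))
  - A.l2_11 (A.h0 (A.l2_00 y z)) (A.h0 (A.l2_00 x w))
  - A.l2_02 x (A.h1 (A.l2_10 (A.h0 (A.l2_00 y z)) w))
  + A.l2_02 y (A.h1 (A.l2_10 (A.h0 (A.l2_00 x z)) w))
  - A.l2_02 z (A.h1 (A.l2_10 (A.h0 (A.l2_00 x y)) w))
  + A.l2_02 x (A.h1 (A.l2_01 y (A.h0 (A.l2_00 z w))))
  - A.l2_02 y (A.h1 (A.l2_01 x (A.h0 (A.l2_00 z w))))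
  + A.l2_02 z (A.h1 (A.l2_01 x (A.h0 (A.l2_00 y w))))
  - A.l2_02 x (A.h1 (A.l2_01 z (A.h0 (A.l2_00 y w))))
  + A.l2_02 y (A.h1 (A.l2_01 z (A.h0 (A.l2_00 x w))))
  - A.l2_02 z (A.h1 (A.l2_01 y (A.h0 (A.l2_00 x w))))

/-- Writing `P = 1 - [d, h]`, the summand `1` reproduces the relation for `d l3`, and the summand
`[d, h]` reproduces the boundary of the trees with one inner edge. The other degrees of this
relation, and the relations for `t4`, `t31` and `t32`, follow the same pattern. -/
theorem transfer_eq3_000 (x y z : M0) : A.d1 (A.t3_000 x y z) = A.l2_00 x (A.P0 (A.l2_00 y z))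
    - A.l2_00 (A.P0 (A.l2_00 x y)) z - A.l2_00 y (A.P0 (A.l2_00 x z)) := by
  simp [t3_000, P0]
  abel

theorem transfer_eq3_001 (x y : M0) (z : M1) : A.d2 (A.t3_001 x y z) + A.t3_000 x y (A.d1 z) =
    A.l2_01 x (A.P1 (A.l2_01 y z)) - A.l2_01 (A.P0 (A.l2_00 x y)) z
    - A.l2_01 y (A.P1 (A.l2_01 x z)) := by
  simp [t3_000, t3_001, P0, P1]
  abel

theorem transfer_eq3_002 (x y : M0) (z : M2) : A.t3_001 x y (A.d2 z) =
    A.l2_02 x (A.P2 (A.l2_02 y z)) - A.l2_02 (A.P0 (A.l2_00 x y)) z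
    - A.l2_02 y (A.P2 (A.l2_02 x z)) := by
  simp [t3_001, P0, P2]
  abel

theorem transfer_eq3_010 (x : M0) (y : M1) (z : M0) : A.d2 (A.t3_010 x y z)
    + A.t3_000 x (A.d1 y) z = A.l2_01 x (A.P1 (A.l2_10 y z)) - A.l2_10 (A.P1 (A.l2_01 x y)) z
    - A.l2_10 y (A.P0 (A.l2_00 x z)) := by
  simp [t3_000, t3_010, P0, P1]
  abel

theorem transfer_eq3_011 (x : M0) (y z : M1) : A.t3_001 x (A.d1 y) z - A.t3_010 x y (A.d1 z) =
    A.l2_02 x (A.P2 (A.l2_11 y z)) - A.l2_11 (A.P1 (A.l2_01 x y)) z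
    - A.l2_11 y (A.P1 (A.l2_01 x z)) := by
  simp [t3_001, t3_010, P1, P2]
  abel

theorem transfer_eq3_020 (x : M0) (y : M2) (z : M0) : A.t3_010 x (A.d2 y) z =
    A.l2_02 x (A.P2 (A.l2_20 y z)) - A.l2_20 (A.P2 (A.l2_02 x y)) z
    - A.l2_20 y (A.P0 (A.l2_00 x z)) := by
  simp [t3_010, P0, P2]
  abel

theorem transfer_eq3_100 (x : M1) (y z : M0) : A.d2 (A.t3_100 x y z) + A.t3_000 (A.d1 x) y z =
    A.l2_10 x (A.P0 (A.l2_00 y z)) - A.l2_10 (A.P1 (A.l2_10 x y)) z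
    - A.l2_01 y (A.P1 (A.l2_10 x z)) := by
  simp [t3_000, t3_100, P0, P1]
  abel

theorem transfer_eq3_101 (x : M1) (y : M0) (z : M1) : A.t3_001 (A.d1 x) y z
    - A.t3_100 x y (A.d1 z) = A.l2_11 x (A.P1 (A.l2_01 y z)) - A.l2_11 (A.P1 (A.l2_10 x y)) z
    - A.l2_02 y (A.P2 (A.l2_11 x z)) := by
  simp [t3_001, t3_100, P1, P2]
  abel

theorem transfer_eq3_110 (x y : M1) (z : M0) : A.t3_010 (A.d1 x) y z - A.t3_100 x (A.d1 y) z =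
    A.l2_11 x (A.P1 (A.l2_10 y z)) - A.l2_20 (A.P2 (A.l2_11 x y)) z
    + A.l2_11 y (A.P1 (A.l2_10 x z)) := by
  simp [t3_010, t3_100, P1, P2]
  abel

theorem transfer_eq3_200 (x : M2) (y z : M0) : A.t3_100 (A.d2 x) y z =
    A.l2_20 x (A.P0 (A.l2_00 y z)) - A.l2_20 (A.P2 (A.l2_20 x y)) z
    - A.l2_02 y (A.P2 (A.l2_20 x z)) := by
  simp [t3_100, P0, P2]
  abel

/-- Trees with two inner edges enter here. Cutting one edge leaves a tree with a single `h` on one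
side, which is why `t3`, and not `l3` alone, appears on the right. -/
theorem transfer_eq4_0000 (x y z w : M0) : A.d2 (A.t4 x y z w) =
    A.l2_10 (A.P1 (A.t3_000 x y z)) w + A.l2_01 x (A.P1 (A.t3_000 y z w))
    - A.l2_01 y (A.P1 (A.t3_000 x z w)) + A.l2_01 z (A.P1 (A.t3_000 x y w))
    - A.t3_000 (A.P0 (A.l2_00 x y)) z w + A.t3_000 x (A.P0 (A.l2_00 y z)) w
    - A.t3_000 y (A.P0 (A.l2_00 x z)) w - A.t3_000 x y (A.P0 (A.l2_00 z w))
    + A.t3_000 x z (A.P0 (A.l2_00 y w)) - A.t3_000 y z (A.P0 (A.l2_00 x w)) := by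
  simp [t3_000, t4, P0, P1]
  abel

/-- With one argument of degree `1` the value of `t4` would have degree `3`, so only `t4 ∘ d`
survives from the boundary. It carries a minus sign because `t4` has even degree. -/
theorem transfer_eq4_0001 (x y z : M0) (w : M1) : -A.t4 x y z (A.d1 w) =
    A.l2_11 (A.P1 (A.t3_000 x y z)) w + A.l2_02 x (A.P2 (A.t3_001 y z w))
    - A.l2_02 y (A.P2 (A.t3_001 x z w)) + A.l2_02 z (A.P2 (A.t3_001 x y w))
    - A.t3_001 (A.P0 (A.l2_00 x y)) z w + A.t3_001 x (A.P0 (A.l2_00 y z)) w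
    - A.t3_001 y (A.P0 (A.l2_00 x z)) w - A.t3_001 x y (A.P1 (A.l2_01 z w))
    + A.t3_001 x z (A.P1 (A.l2_01 y w)) - A.t3_001 y z (A.P1 (A.l2_01 x w)) := by
  simp [t3_000, t3_001, t4, P0, P1, P2]
  abel

theorem transfer_eq4_0010 (x y : M0) (z : M1) (w : M0) : -A.t4 x y (A.d1 z) w =
    A.l2_20 (A.P2 (A.t3_001 x y z)) w + A.l2_02 x (A.P2 (A.t3_010 y z w))
    - A.l2_02 y (A.P2 (A.t3_010 x z w)) - A.l2_11 z (A.P1 (A.t3_000 x y w))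
    - A.t3_010 (A.P0 (A.l2_00 x y)) z w + A.t3_010 x (A.P1 (A.l2_01 y z)) w
    - A.t3_010 y (A.P1 (A.l2_01 x z)) w - A.t3_001 x y (A.P1 (A.l2_10 z w))
    + A.t3_010 x z (A.P0 (A.l2_00 y w)) - A.t3_010 y z (A.P0 (A.l2_00 x w)) := by
  simp [t3_000, t3_001, t3_010, t4, P0, P1, P2]
  abel

theorem transfer_eq4_0100 (x : M0) (y : M1) (z w : M0) : -A.t4 x (A.d1 y) z w =
    A.l2_20 (A.P2 (A.t3_010 x y z)) w + A.l2_02 x (A.P2 (A.t3_100 y z w))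
    + A.l2_11 y (A.P1 (A.t3_000 x z w)) + A.l2_02 z (A.P2 (A.t3_010 x y w))
    - A.t3_100 (A.P1 (A.l2_01 x y)) z w + A.t3_010 x (A.P1 (A.l2_10 y z)) w
    - A.t3_100 y (A.P0 (A.l2_00 x z)) w - A.t3_010 x y (A.P0 (A.l2_00 z w))
    + A.t3_001 x z (A.P1 (A.l2_10 y w)) - A.t3_100 y z (A.P0 (A.l2_00 x w)) := by
  simp [t3_000, t3_001, t3_010, t3_100, t4, P0, P1, P2]
  abel

theorem transfer_eq4_1000 (x : M1) (y z w : M0) : -A.t4 (A.d1 x) y z w =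
    A.l2_20 (A.P2 (A.t3_100 x y z)) w - A.l2_11 x (A.P1 (A.t3_000 y z w))
    - A.l2_02 y (A.P2 (A.t3_100 x z w)) + A.l2_02 z (A.P2 (A.t3_100 x y w))
    - A.t3_100 (A.P1 (A.l2_10 x y)) z w + A.t3_100 x (A.P0 (A.l2_00 y z)) w
    - A.t3_010 y (A.P1 (A.l2_10 x z)) w - A.t3_100 x y (A.P0 (A.l2_00 z w))
    + A.t3_100 x z (A.P0 (A.l2_00 y w)) - A.t3_001 y z (A.P1 (A.l2_10 x w)) := by
  simp [t3_000, t3_001, t3_010, t3_100, t4, P0, P1, P2]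
  abel

theorem transfer_eq31_000 (x y z : M0) : A.d2 (A.t31 x y z) = A.t3_000 x y z + A.t3_000 y x z
    + A.l2_10 (A.P1 (A.l21_00 x y)) z := by
  simp [t3_000, t31, P1]
  abel

theorem transfer_eq31_001 (x y : M0) (z : M1) : -A.t31 x y (A.d1 z) = A.t3_001 x y z
    + A.t3_001 y x z + A.l2_11 (A.P1 (A.l21_00 x y)) z := by
  simp [t3_001, t31, P1]
  abel

theorem transfer_eq31_010 (x : M0) (y : M1) (z : M0) : -A.t31 x (A.d1 y) z = A.t3_010 x y z
    + A.t3_100 y x z + A.l2_20 (A.P2 (A.l21_01 x y)) z := by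
  simp [t3_010, t3_100, t31, P2]
  abel

theorem transfer_eq31_100 (x : M1) (y z : M0) : -A.t31 (A.d1 x) y z = A.t3_100 x y z
    + A.t3_010 y x z + A.l2_20 (A.P2 (A.l21_10 x y)) z := by
  simp [t3_010, t3_100, t31, P2]
  abel

theorem transfer_eq32_000 (x y z : M0) : A.d2 (A.t32 x y z) = A.t3_000 x y z + A.t3_000 x z y
    - A.l2_01 x (A.P1 (A.l21_00 y z)) + A.l21_00 (A.P0 (A.l2_00 x y)) z
    + A.l21_00 y (A.P0 (A.l2_00 x z)) := by
  simp [t3_000, t32, P0, P1]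
  abel

theorem transfer_eq32_001 (x y : M0) (z : M1) : -A.t32 x y (A.d1 z) = A.t3_001 x y z
    + A.t3_010 x z y - A.l2_02 x (A.P2 (A.l21_01 y z)) + A.l21_01 (A.P0 (A.l2_00 x y)) z
    + A.l21_01 y (A.P1 (A.l2_01 x z)) := by
  simp [t3_001, t3_010, t32, P0, P1, P2]
  abel

theorem transfer_eq32_010 (x : M0) (y : M1) (z : M0) : -A.t32 x (A.d1 y) z = A.t3_010 x y z
    + A.t3_001 x z y - A.l2_02 x (A.P2 (A.l21_10 y z)) + A.l21_10 (A.P1 (A.l2_01 x y)) z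
    + A.l21_10 y (A.P0 (A.l2_00 x z)) := by
  simp [t3_001, t3_010, t32, P0, P1, P2]
  abel

theorem transfer_eq32_100 (x : M1) (y z : M0) : -A.t32 (A.d1 x) y z = A.t3_100 x y z
    + A.t3_100 x z y + A.l2_11 x (A.P1 (A.l21_00 y z)) + A.l21_10 (A.P1 (A.l2_10 x y)) z
    + A.l21_01 y (A.P1 (A.l2_10 x z)) := by
  simp [t3_100, t32, P1]
  abel

theorem transfer_eq311 (x y z : M0) : A.t31 x y z - A.t31 y x z =
    A.l2_20 (A.P2 (A.l211 x y)) z := by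
  have e := A.sym_311 x y z
  -- The original relation serves as an equation between defects: left minus right for the
  -- transferred operations is shown to equal left minus right for the original ones, which is zero.
  rw [← sub_eq_zero] at e ⊢
  rw [← e]
  simp [t31, P2]
  abel

theorem transfer_eq312 (x y z : M0) : A.t31 x y z + A.t31 x z y + A.t31 y z x - A.t32 x y z
    - A.t32 y x z - A.t32 z x y = A.l21_01 x (A.P1 (A.l21_00 y z))
    + A.l21_01 y (A.P1 (A.l21_00 x z)) + A.l21_10 (A.P1 (A.l21_00 x y)) z
    + A.l211 y (A.P0 (A.l2_00 z x)) := by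
  have e := A.sym_312 x y z
  rw [← sub_eq_zero] at e ⊢
  rw [← e]
  simp [t31, t32, P0, P1]
  abel

theorem transfer_eq322 (x y z : M0) : A.t32 x y z - A.t32 x z y = -A.l2_02 x (A.P2 (A.l211 y z))
    + A.l211 (A.P0 (A.l2_00 x y)) z + A.l211 y (A.P0 (A.l2_00 x z)) := by
  have e := A.sym_322 x y z
  rw [← sub_eq_zero] at e ⊢
  rw [← e]
  simp [t32, P0, P2]
  abel

theorem transfer_eq41 (x y z w : M0) : A.t4 x y z w + A.t4 y x z w =
    A.l2_20 (A.P2 (A.t31 x y z)) w - A.t31 x y (A.P0 (A.l2_00 z w))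
    + A.l2_02 z (A.P2 (A.t31 x y w)) + A.t3_100 (A.P1 (A.l21_00 x y)) z w := by
  have e := A.sym_41 x y z w
  rw [← sub_eq_zero] at e ⊢
  rw [← e]
  simp [t3_100, t31, t4, P0, P1, P2]
  abel

theorem transfer_eq42 (x y z w : M0) : A.t4 x y z w + A.t4 x z y w =
    A.l2_20 (A.P2 (A.t32 x y z)) w - A.t3_010 x (A.P1 (A.l21_00 y z)) w
    + A.l2_02 x (A.P2 (A.t31 y z w)) - A.t31 (A.P0 (A.l2_00 x y)) z w
    - A.t31 y (A.P0 (A.l2_00 x z)) w - A.t31 y z (A.P0 (A.l2_00 x w)) := by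
  have e := A.sym_42 x y z w
  rw [← sub_eq_zero] at e ⊢
  rw [← e]
  simp [t3_010, t31, t32, t4, P0, P1, P2]
  abel

theorem transfer_eq43 (x y z w : M0) : A.t4 x y z w + A.t4 x y w z =
    A.l21_10 (A.P1 (A.t3_000 x y z)) w - A.t32 (A.P0 (A.l2_00 x y)) z w
    + A.t32 x (A.P0 (A.l2_00 y z)) w - A.t32 y (A.P0 (A.l2_00 x z)) w
    + A.t3_001 x y (A.P1 (A.l21_00 z w)) + A.t32 x z (A.P0 (A.l2_00 y w))
    - A.t32 y z (A.P0 (A.l2_00 x w)) + A.l2_02 x (A.P2 (A.t32 y z w))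
    - A.l2_02 y (A.P2 (A.t32 x z w)) + A.l21_01 z (A.P1 (A.t3_000 x y w)) := by
  have e := A.sym_43 x y z w
  rw [← sub_eq_zero] at e ⊢
  rw [← e]
  simp [t3_000, t3_001, t32, t4, P0, P1, P2]
  abel

-- The obstruction to this relation would be the boundary of a sum of trees with five inputs. That
-- sum has degree `3` and vanishes in a three-term complex, so all terms containing `h` cancel and
-- the original expression is left.
set_option maxHeartbeats 4000000 in
theorem transfer_eq5 (x y z w v : M0) : A.l2_20 (A.P2 (A.t4 x y z w)) v
    - A.l2_02 x (A.P2 (A.t4 y z w v)) + A.l2_02 y (A.P2 (A.t4 x z w v))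
    - A.l2_02 z (A.P2 (A.t4 x y w v)) + A.l2_02 w (A.P2 (A.t4 x y z v))
    + A.t3_100 (A.P1 (A.t3_000 x y z)) w v + A.t3_010 x (A.P1 (A.t3_000 y z w)) v
    - A.t3_010 y (A.P1 (A.t3_000 x z w)) v + A.t3_010 z (A.P1 (A.t3_000 x y w)) v
    + A.t3_001 x y (A.P1 (A.t3_000 z w v)) - A.t3_001 x z (A.P1 (A.t3_000 y w v))
    + A.t3_001 y z (A.P1 (A.t3_000 x w v)) + A.t3_001 x w (A.P1 (A.t3_000 y z v))
    - A.t3_001 y w (A.P1 (A.t3_000 x z v)) + A.t3_001 z w (A.P1 (A.t3_000 x y v))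
    + A.t4 (A.P0 (A.l2_00 x y)) z w v - A.t4 x (A.P0 (A.l2_00 y z)) w v
    + A.t4 y (A.P0 (A.l2_00 x z)) w v + A.t4 x y (A.P0 (A.l2_00 z w)) v
    - A.t4 x z (A.P0 (A.l2_00 y w)) v + A.t4 y z (A.P0 (A.l2_00 x w)) v
    - A.t4 x y z (A.P0 (A.l2_00 w v)) + A.t4 x y w (A.P0 (A.l2_00 z v))
    - A.t4 x z w (A.P0 (A.l2_00 y v)) + A.t4 y z w (A.P0 (A.l2_00 x v)) = 0 := by
  refine Eq.trans ?_ (A.sym_5 x y z w v)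
  simp only [t3_000, t3_001, t3_010, t3_100, t4, P0, P1, P2, map_add, map_sub, map_neg,
    LinearMap.add_apply, LinearMap.sub_apply, LinearMap.neg_apply, l2_d_01, l2_d_02, l2_d_10,
    l2_d_11, l2_d_12, l2_d_20, l2_d_21, d_l3_000, l3_d_001, l3_d_002, l3_d_010, l3_d_011,
    l3_d_020, l3_d_100, l3_d_101, l3_d_110, l3_d_200, d_l4, l4_d_0001, l4_d_0010, l4_d_0100,
    l4_d_1000]
  abel

/-! ### Degreewise relations for the extension of the inclusion -/

/-- This is `-d h t = P t + h d t - t` for `t = t3`, with `d t` replaced by its value from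
`transfer_eq3_000`. The terms of `-t` are the original operations evaluated on `i` and `i₂ = -h l2`,
since a tree without `h` at its root is an operation applied to trees with `h` at theirs. -/
theorem inclusion_eq3_000 (x y z : M0) : -A.d2 (A.h1 (A.t3_000 x y z)) = A.P1 (A.t3_000 x y z)
    + A.h0 (A.l2_00 x (A.P0 (A.l2_00 y z))) - A.h0 (A.l2_00 y (A.P0 (A.l2_00 x z)))
    - A.h0 (A.l2_00 (A.P0 (A.l2_00 x y)) z) - A.l3_000 x y z + A.l2_01 x (A.h0 (A.l2_00 y z))
    - A.l2_01 y (A.h0 (A.l2_00 x z)) - A.l2_10 (A.h0 (A.l2_00 x y)) z := by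
  simp [t3_000, P0, P1]
  abel

theorem inclusion_eq3_001 (x y : M0) (z : M1) : A.h1 (A.t3_000 x y (A.d1 z)) =
    A.P2 (A.t3_001 x y z) + A.h1 (A.l2_01 x (A.P1 (A.l2_01 y z)))
    - A.h1 (A.l2_01 y (A.P1 (A.l2_01 x z))) - A.h1 (A.l2_01 (A.P0 (A.l2_00 x y)) z)
    - A.l3_001 x y z + A.l2_02 x (A.h1 (A.l2_01 y z)) - A.l2_02 y (A.h1 (A.l2_01 x z))
    - A.l2_11 (A.h0 (A.l2_00 x y)) z := by
  simp [t3_000, t3_001, P0, P1, P2]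
  abel

theorem inclusion_eq3_010 (x : M0) (y : M1) (z : M0) : A.h1 (A.t3_000 x (A.d1 y) z) =
    A.P2 (A.t3_010 x y z) + A.h1 (A.l2_01 x (A.P1 (A.l2_10 y z)))
    - A.h1 (A.l2_10 y (A.P0 (A.l2_00 x z))) - A.h1 (A.l2_10 (A.P1 (A.l2_01 x y)) z)
    - A.l3_010 x y z + A.l2_02 x (A.h1 (A.l2_10 y z)) + A.l2_11 y (A.h0 (A.l2_00 x z))
    - A.l2_20 (A.h1 (A.l2_01 x y)) z := by
  simp [t3_000, t3_010, P0, P1, P2]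
  abel

theorem inclusion_eq3_100 (x : M1) (y z : M0) : A.h1 (A.t3_000 (A.d1 x) y z) =
    A.P2 (A.t3_100 x y z) + A.h1 (A.l2_10 x (A.P0 (A.l2_00 y z)))
    - A.h1 (A.l2_01 y (A.P1 (A.l2_10 x z))) - A.h1 (A.l2_10 (A.P1 (A.l2_10 x y)) z)
    - A.l3_100 x y z - A.l2_11 x (A.h0 (A.l2_00 y z)) - A.l2_02 y (A.h1 (A.l2_10 x z))
    - A.l2_20 (A.h1 (A.l2_10 x y)) z := by
  simp [t3_000, t3_100, P0, P1, P2]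
  abel

/-- Here `h t4` would have degree `3`, so `P t4 = t4 - h d t4`. The terms with outermost `h` come
from `h d t4`. The others express `t4 - l4` through the operation at the root, with `-h l2` and `-h
t3` inserted into its inputs. -/
theorem inclusion_eq4 (x y z w : M0) : A.P2 (A.t4 x y z w) - A.l4 x y z w =
    -A.h1 (A.l2_10 (A.P1 (A.t3_000 x y z)) w) - A.h1 (A.l2_01 x (A.P1 (A.t3_000 y z w)))
    + A.h1 (A.l2_01 y (A.P1 (A.t3_000 x z w))) - A.h1 (A.l2_01 z (A.P1 (A.t3_000 x y w)))
    + A.h1 (A.t3_000 (A.P0 (A.l2_00 x y)) z w) - A.h1 (A.t3_000 x (A.P0 (A.l2_00 y z)) w)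
    + A.h1 (A.t3_000 y (A.P0 (A.l2_00 x z)) w) + A.h1 (A.t3_000 x y (A.P0 (A.l2_00 z w)))
    - A.h1 (A.t3_000 x z (A.P0 (A.l2_00 y w))) + A.h1 (A.t3_000 y z (A.P0 (A.l2_00 x w)))
    - A.l2_20 (A.h1 (A.t3_000 x y z)) w - A.l2_02 x (A.h1 (A.t3_000 y z w))
    + A.l2_02 y (A.h1 (A.t3_000 x z w)) - A.l2_02 z (A.h1 (A.t3_000 x y w))
    - A.l2_11 (A.h0 (A.l2_00 x y)) (A.h0 (A.l2_00 z w))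
    + A.l2_11 (A.h0 (A.l2_00 x z)) (A.h0 (A.l2_00 y w))
    - A.l2_11 (A.h0 (A.l2_00 y z)) (A.h0 (A.l2_00 x w)) - A.l3_100 (A.h0 (A.l2_00 x y)) z w
    + A.l3_010 x (A.h0 (A.l2_00 y z)) w - A.l3_010 y (A.h0 (A.l2_00 x z)) w
    - A.l3_001 x y (A.h0 (A.l2_00 z w)) + A.l3_001 x z (A.h0 (A.l2_00 y w))
    - A.l3_001 y z (A.h0 (A.l2_00 x w)) := by
  simp [t3_000, t4, P0, P1, P2]
  abel

theorem inclusion_eq211 (x y : M0) : A.P2 (A.l211 x y) - A.l211 x y = -A.h1 (A.l21_00 x y)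
    + A.h1 (A.l21_00 y x) := by
  simp [P2]
  abel

theorem inclusion_eq31 (x y z : M0) : A.P2 (A.t31 x y z) - A.l31 x y z = -A.h1 (A.t3_000 x y z)
    - A.h1 (A.t3_000 y x z) - A.h1 (A.l2_10 (A.P1 (A.l21_00 x y)) z)
    - A.l2_20 (A.h1 (A.l21_00 x y)) z := by
  simp [t3_000, t31, P1, P2]
  abel

theorem inclusion_eq32 (x y z : M0) : A.P2 (A.t32 x y z) - A.l32 x y z = -A.h1 (A.t3_000 x y z)
    - A.h1 (A.t3_000 x z y) + A.h1 (A.l2_01 x (A.P1 (A.l21_00 y z)))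
    - A.h1 (A.l21_00 (A.P0 (A.l2_00 x y)) z) - A.h1 (A.l21_00 y (A.P0 (A.l2_00 x z)))
    + A.l2_02 x (A.h1 (A.l21_00 y z)) + A.l21_10 (A.h0 (A.l2_00 x y)) z
    + A.l21_01 y (A.h0 (A.l2_00 x z)) := by
  simp [t3_000, t32, P0, P1, P2]
  abel

end Lie3Components

/-! ### Tame operations and their closure properties -/

namespace ThreeTermComplex

variable {k : Type*} [CommRing k] {L L' L'' : Type*} [AddCommGroup L] [Module k L]
  [AddCommGroup L'] [Module k L'] [AddCommGroup L''] [Module k L'']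

theorem eq_zero_of_mem (C : ThreeTermComplex k L) {n : ℤ} {x : L} (hx : x ∈ C.gr n)
    (hn : n < 0 ∨ 2 < n) : x = 0 := by
  simpa [C.gr_eq_bot n hn] using hx

/-- An operation of degree `r` that vanishes as soon as one of its arguments does. -/
structure Tame (C : ThreeTermComplex k L) (C' : ThreeTermComplex k L') {n : ℕ} {r : ℤ}
    (μ : Op L L' n r) : Prop where
  mem : C.HasDegree C' μ
  zero : ∀ x j, (x j).2 = 0 → μ x = 0

theorem units_smul_mem (C : ThreeTermComplex k L) {n : ℤ} {x : L} (u : ℤˣ) (hx : x ∈ C.gr n) :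
    u • x ∈ C.gr n := by
  rcases Int.units_eq_one_or u with rfl | rfl
  · simpa using hx
  · simpa [Units.smul_def] using hx

end ThreeTermComplex

theorem units_smul_eq_zero {M : Type*} [AddCommGroup M] (u : ℤˣ) {x : M} (h : x = 0) :
    u • x = 0 := by
  rw [h, smul_zero]

/-- The `m` slots are cut into the `i` slots before the insertion, the slot `i` itself, and the `q`
slots after it; correspondingly `m + n - 1 = i + n + q`. Truncated subtraction is harmless, as `m ≥
1` and the last branch only occurs for `j > i`. -/
theorem Op.sum_circ_args {G : Type*} [AddCommMonoid G] {m n i : ℕ} (hi : i < m) (x : ℕ → G)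
    (g : G) :
    ∑ j ∈ Finset.range m, (if j < i then x j else if j = i then
        (∑ l ∈ Finset.range n, x (i + l)) + g else x (j + n - 1)) =
      ∑ j ∈ Finset.range (m + n - 1), x j + g := by
  obtain ⟨q, rfl⟩ := Nat.exists_eq_add_of_lt hi
  have e : i + q + 1 + n - 1 = i + n + q := by omega
  rw [e, show i + q + 1 = i + 1 + q by omega, Finset.sum_range_add, Finset.sum_range_succ,
    Finset.sum_range_add _ (i + n), Finset.sum_range_add _ i]
  have h1 : ∑ j ∈ Finset.range i, (if j < i then x j else if j = i then
      (∑ l ∈ Finset.range n, x (i + l)) + g else x (j + n - 1)) = ∑ j ∈ Finset.range i, x j :=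
    Finset.sum_congr rfl fun j hj => by simp [Finset.mem_range.1 hj]
  have h2 : ∑ j ∈ Finset.range q, (if i + 1 + j < i then x (i + 1 + j) else if i + 1 + j = i then
      (∑ l ∈ Finset.range n, x (i + l)) + g else x (i + 1 + j + n - 1)) =
      ∑ j ∈ Finset.range q, x (i + n + j) :=
    Finset.sum_congr rfl fun j _ => by
      rw [if_neg (by omega), if_neg (by omega)]; congr 1; omega
  rw [h1, h2]
  simp only [lt_irrefl, if_true, if_false]
  abel

theorem totalDeg_circ_args {L : Type*} {m n : ℕ} (i : Fin m) (x : Fin (m + n - 1) → ℤ × L)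
    (s : ℤ) (v : L) :
    totalDeg (fun j : Fin m => if _ : j < i then x ⟨j, by omega⟩
      else if _ : j = i then (totalDeg (fun l : Fin n => x ⟨i + l, by omega⟩) + s, v)
      else x ⟨j + n - 1, by omega⟩) = totalDeg x + s := by
  -- The degrees are extended by zero to all natural numbers, so that sums over `Fin` become sums
  -- over ranges that can be split.
  let X : ℕ → ℤ := fun j => if h : j < m + n - 1 then (x ⟨j, h⟩).1 else 0
  have hX : ∀ j (h : j < m + n - 1), (x ⟨j, h⟩).1 = X j := fun j h => by simp [X, h]
  have h0 : totalDeg (fun l : Fin n => x ⟨i + l, by omega⟩) =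
      ∑ l ∈ Finset.range n, X (i + l) := by
    rw [totalDeg, Finset.sum_range]
    exact Finset.sum_congr rfl fun l _ => hX _ _
  have h1 : totalDeg x = ∑ j ∈ Finset.range (m + n - 1), X j := by
    rw [totalDeg, Finset.sum_range]
    exact Finset.sum_congr rfl fun l _ => hX _ l.2
  rw [h1, ← Op.sum_circ_args i.2, Finset.sum_range, totalDeg]
  refine Finset.sum_congr rfl fun j _ => ?_
  by_cases hlt : j < i
  · simp [hlt, hX]
  · by_cases heq : j = i
    · subst heq; simp [h0]
    · have : ¬ (j : ℕ) = i := fun h => heq (Fin.ext h)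
      have h' : ¬ (j : ℕ) < i := hlt
      simp [hlt, heq, this, h', hX]

theorem totalDeg_append {L : Type*} {a b : ℕ} (x : Fin (a + b) → ℤ × L) :
    totalDeg (fun l : Fin a => x ⟨l, by omega⟩) + totalDeg (fun l : Fin b => x ⟨a + l, by omega⟩) =
      totalDeg x :=
  (Fin.sum_univ_add fun j => (x j).1).symm

namespace ThreeTermComplex

variable {k : Type*} [CommRing k] {L L' L'' : Type*} [AddCommGroup L] [Module k L]
  [AddCommGroup L'] [Module k L'] [AddCommGroup L''] [Module k L'']
  {C : ThreeTermComplex k L} {C' : ThreeTermComplex k L'} {C'' : ThreeTermComplex k L''}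

theorem Tame.circ {m n : ℕ} {r s : ℤ} {μ : Op L L' m r} {ν : Op L L n s} (hμ : C.Tame C' μ)
    (hν : C.Tame C ν) (i : Fin m) : C.Tame C' (μ.circ i ν) where
  mem x hx := by
    refine C'.units_smul_mem _ ?_
    have := hμ.mem (fun j : Fin m => if _ : j < i then x ⟨j, by omega⟩
      else if _ : j = i then (totalDeg (fun l : Fin n => x ⟨i + l, by omega⟩) + s,
        ν fun l : Fin n => x ⟨i + l, by omega⟩)
      else x ⟨j + n - 1, by omega⟩) fun j => by
        by_cases hlt : j < i
        · simpa [hlt] using hx _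
        · by_cases heq : j = i
          · simpa [heq] using hν.mem _ fun l => hx _
          · simpa [hlt, heq] using hx _
    have e := totalDeg_circ_args i x s (ν fun l : Fin n => x ⟨i + l, by omega⟩)
    convert this using 2
    rw [e]
    ring
  zero x j hj := by
    by_cases h1 : (j : ℕ) < i
    · refine units_smul_eq_zero _ (hμ.zero _ ⟨j, by omega⟩ ?_)
      have : (⟨j, by omega⟩ : Fin m) < i := h1
      simpa [this] using hj
    by_cases h2 : (j : ℕ) < i + n
    · refine units_smul_eq_zero _ (hμ.zero _ i ?_)
      have : ν (fun l : Fin n => x ⟨i + l, by omega⟩) = 0 :=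
        hν.zero _ ⟨j - i, by omega⟩ (by
          convert hj using 3
          exact Fin.ext (by dsimp only; omega))
      simpa using this
    -- An argument behind the inserted block is read by the slot `j'` of `μ` with `j' + n - 1 = j`.
    · have hn : (j : ℕ) + 1 - n < m := by have := j.2; omega
      refine units_smul_eq_zero _ (hμ.zero _ ⟨j + 1 - n, hn⟩ ?_)
      have h3 : ¬ (⟨j + 1 - n, hn⟩ : Fin m) < i := by
        simp only [Fin.lt_def]; omega
      have h4 : ¬ (⟨j + 1 - n, hn⟩ : Fin m) = i := by
        simp only [Fin.ext_iff]; omega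
      simp only [h3, h4, dite_false]
      convert hj using 3
      exact Fin.ext (by dsimp only; omega)

theorem Tame.perm {n : ℕ} {r : ℤ} {μ : Op L L' n r} (hμ : C.Tame C' μ)
    (σ : Equiv.Perm (Fin n)) : C.Tame C' (μ.perm σ) where
  mem x hx := by
    refine C'.units_smul_mem _ ?_
    have := hμ.mem (fun j => x (σ.symm j)) fun j => hx _
    rwa [show totalDeg (fun j => x (σ.symm j)) = totalDeg x from
      Equiv.sum_comp σ.symm fun j => (x j).1] at this
  zero x j hj := units_smul_eq_zero _ (hμ.zero _ (σ j) (by simpa using hj))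

theorem Tame.cyc {n : ℕ} {r : ℤ} {μ : Op L L' n r} (hμ : C.Tame C' μ)
    (c : List (Fin n)) : C.Tame C' (μ.cyc c) :=
  hμ.perm _

theorem Tame.post {n : ℕ} {r s : ℤ} {μ : Op L L' n r} (hμ : C.Tame C' μ) {g : L' → L''}
    (hg : ∀ n x, x ∈ C'.gr n → g x ∈ C''.gr (n + s)) (hg0 : g 0 = 0) :
    C.Tame C'' (μ.post s g) where
  mem x hx := by
    have := hg _ _ (hμ.mem x hx)
    rwa [add_assoc, add_comm r s] at this
  zero x j hj := (congrArg g (hμ.zero x j hj)).trans hg0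

theorem Tame.comp2 {a b : ℕ} {r s₁ s₂ : ℤ} {μ : Op L' L'' 2 r} {ν₁ : Op L L' a s₁}
    {ν₂ : Op L L' b s₂} (hμ : C'.Tame C'' μ) (h₁ : C.Tame C' ν₁) (h₂ : C.Tame C' ν₂) :
    C.Tame C'' (μ.comp2 ν₁ ν₂) where
  mem x hx := by
    refine C''.units_smul_mem _ ?_
    have := hμ.mem ![(totalDeg (fun l : Fin a => x ⟨l, by omega⟩) + s₁, ν₁ _),
      (totalDeg (fun l : Fin b => x ⟨a + l, by omega⟩) + s₂, ν₂ _)] fun j => by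
        fin_cases j
        · exact h₁.mem _ fun l => hx _
        · exact h₂.mem _ fun l => hx _
    convert this using 2
    rw [← totalDeg_append x]
    simp only [totalDeg, Fin.sum_univ_two, Matrix.cons_val_zero, Matrix.cons_val_one]
    ring
  zero x j hj := by
    refine units_smul_eq_zero _ ?_
    by_cases h : (j : ℕ) < a
    · exact hμ.zero _ 0 (h₁.zero _ ⟨j, h⟩ hj)
    · refine hμ.zero _ 1 (h₂.zero _ ⟨j - a, by omega⟩ ?_)
      convert hj using 3
      exact Fin.ext (by dsimp only; omega)

theorem Tame.comp3 {a b c : ℕ} {r s₁ s₂ s₃ : ℤ} {μ : Op L' L'' 3 r} {ν₁ : Op L L' a s₁}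
    {ν₂ : Op L L' b s₂} {ν₃ : Op L L' c s₃} (hμ : C'.Tame C'' μ) (h₁ : C.Tame C' ν₁)
    (h₂ : C.Tame C' ν₂) (h₃ : C.Tame C' ν₃) : C.Tame C'' (μ.comp3 ν₁ ν₂ ν₃) where
  mem x hx := by
    refine C''.units_smul_mem _ ?_
    have := hμ.mem ![(totalDeg (fun l : Fin a => x ⟨l, by omega⟩) + s₁, ν₁ _),
      (totalDeg (fun l : Fin b => x ⟨a + l, by omega⟩) + s₂, ν₂ _),
      (totalDeg (fun l : Fin c => x ⟨a + b + l, by omega⟩) + s₃, ν₃ _)] fun j => by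
        fin_cases j
        · exact h₁.mem _ fun l => hx _
        · exact h₂.mem _ fun l => hx _
        · exact h₃.mem _ fun l => hx _
    convert this using 2
    rw [← totalDeg_append x, ← totalDeg_append fun l : Fin (a + b) => x ⟨l, by omega⟩]
    simp only [totalDeg, Fin.sum_univ_three, Matrix.cons_val_zero, Matrix.cons_val_one,
      Matrix.cons_val]
    ring
  zero x j hj := by
    refine units_smul_eq_zero _ ?_
    by_cases h : (j : ℕ) < a
    · exact hμ.zero _ 0 (h₁.zero _ ⟨j, h⟩ hj)
    by_cases h' : (j : ℕ) < a + b
    · refine hμ.zero _ 1 (h₂.zero _ ⟨j - a, by omega⟩ ?_)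
      convert hj using 3
      exact Fin.ext (by dsimp only; omega)
    · refine hμ.zero _ 2 (h₃.zero _ ⟨j - (a + b), by omega⟩ ?_)
      convert hj using 3
      exact Fin.ext (by dsimp only; omega)

theorem Tame.bdry {n : ℕ} {r : ℤ} {μ : Op L L' n r} (hμ : C.Tame C' μ) :
    C.Tame C' (C.bdry C' μ) where
  mem x hx := by
    refine Submodule.sub_mem _ ?_ (C'.units_smul_mem _ (Submodule.sum_mem _ fun j _ =>
      C'.units_smul_mem _ ?_))
    · rw [← add_sub_assoc]
      exact C'.d_mem _ _ (hμ.mem x hx)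
    · have := hμ.mem (Function.update x j ((x j).1 - 1, C.d (x j).2)) fun l => by
        by_cases h : l = j
        · subst h; simpa using C.d_mem _ _ (hx l)
        · simpa [h] using hx l
      convert this using 2
      rw [add_comm, sub_add_eq_add_sub, add_comm r, add_sub_right_comm]
      congr 1
      simp only [totalDeg]
      -- Only the degree at position `j` changes, by `-1`; it is split off from both sums.
      rw [← Finset.add_sum_erase _ _ (Finset.mem_univ j),
        ← Finset.add_sum_erase Finset.univ (fun l => (Function.update x j _ l).1)
          (Finset.mem_univ j), Function.update_self, add_sub_right_comm]
      congr 1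
      exact Finset.sum_congr rfl fun l hl => by
        rw [Function.update_of_ne (Finset.ne_of_mem_erase hl)]
  zero x j hj := by
    -- Replacing an argument by its differential keeps the vanishing argument zero, also at its own
    -- position, because `d 0 = 0`.
    have h : ∀ l, μ (Function.update x l ((x l).1 - 1, C.d (x l).2)) = 0 := fun l =>
      hμ.zero _ j (by
        by_cases h : j = l
        · subst h; simp [hj]
        · simpa [h] using hj)
    simp only [ThreeTermComplex.bdry]
    simp [h, hμ.zero x j hj]

theorem Tame.add {n : ℕ} {r : ℤ} {μ ν : Op L L' n r} (hμ : C.Tame C' μ) (hν : C.Tame C' ν) :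
    C.Tame C' (r := r) fun x => μ x + ν x where
  mem x hx := Submodule.add_mem _ (hμ.mem x hx) (hν.mem x hx)
  zero x j hj := by simp [hμ.zero x j hj, hν.zero x j hj]

theorem Tame.sub {n : ℕ} {r : ℤ} {μ ν : Op L L' n r} (hμ : C.Tame C' μ) (hν : C.Tame C' ν) :
    C.Tame C' (r := r) fun x => μ x - ν x where
  mem x hx := Submodule.sub_mem _ (hμ.mem x hx) (hν.mem x hx)
  zero x j hj := by simp [hμ.zero x j hj, hν.zero x j hj]

theorem Tame.neg {n : ℕ} {r : ℤ} {μ : Op L L' n r} (hμ : C.Tame C' μ) :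
    C.Tame C' (r := r) fun x => -μ x where
  mem x hx := Submodule.neg_mem _ (hμ.mem x hx)
  zero x j hj := by simp [hμ.zero x j hj]

theorem Tame.of_zero {n : ℕ} {r : ℤ} : C.Tame C' (r := r) (n := n) fun _ => 0 :=
  ⟨fun _ _ => zero_mem _, fun _ _ _ => rfl⟩

theorem Tame.eq_zero {n : ℕ} {r : ℤ} {μ : Op L L' n r} (hμ : C.Tame C' μ) {x : Fin n → ℤ × L}
    (hx : C.Homog x) (h : 2 < totalDeg x + r) : μ x = 0 :=
  C'.eq_zero_of_mem (hμ.mem x hx) (.inr h)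

/-- Two operations agree on homogeneous arguments if they do so in the range of degrees in which
they can be nonzero. -/
theorem Tame.ext {n : ℕ} {r : ℤ} {μ ν : Op L L' n r} (hμ : C.Tame C' μ) (hν : C.Tame C' ν)
    (h : ∀ (δ : Fin n → ℕ) (v : ∀ j, C.gr (δ j)), ((∑ j, δ j : ℕ) : ℤ) + r ≤ 2 →
      μ (fun j => ((δ j : ℤ), (v j : L))) = ν (fun j => ((δ j : ℤ), (v j : L)))) :
    ∀ x, C.Homog x → μ x = ν x := by
  intro x hx
  -- A vector of negative degree is zero. Operations are plain functions on labelled tuples, so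
  -- their vanishing there is exactly the second condition of `Tame`.
  by_cases hneg : ∃ j, (x j).1 < 0
  · obtain ⟨j, hj⟩ := hneg
    have := C.eq_zero_of_mem (hx j) (.inl hj)
    rw [hμ.zero x j this, hν.zero x j this]
  push Not at hneg
  -- Above total degree `2` the values themselves lie in a zero module.
  by_cases htop : 2 < totalDeg x + r
  · rw [hμ.eq_zero hx htop, hν.eq_zero hx htop]
  have e : ∀ j, (((x j).1.toNat : ℕ) : ℤ) = (x j).1 := fun j => Int.toNat_of_nonneg (hneg j)
  have := h (fun j => (x j).1.toNat) (fun j => ⟨(x j).2, by rw [e]; exact hx j⟩) (by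
    push_cast
    simp only [totalDeg] at htop
    simp only [Int.toNat_of_nonneg (hneg _)]
    omega)
  simpa only [e] using this

end ThreeTermComplex

/-! ### Reduction to explicit lists of degrees -/

namespace ThreeTermComplex

variable {k : Type*} [CommRing k] {L L' : Type*} [AddCommGroup L] [Module k L]
  [AddCommGroup L'] [Module k L'] {C : ThreeTermComplex k L} {C' : ThreeTermComplex k L'}

theorem homog_two {a b : ℤ} (x : C.gr a) (y : C.gr b) : C.Homog ![(a, x.1), (b, y.1)] := by
  intro j; fin_cases j <;> simp

theorem homog_three {a b c : ℤ} (x : C.gr a) (y : C.gr b) (z : C.gr c) :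
    C.Homog ![(a, x.1), (b, y.1), (c, z.1)] := by
  intro j; fin_cases j <;> simp

theorem homog_four {a b c e : ℤ} (x : C.gr a) (y : C.gr b) (z : C.gr c) (w : C.gr e) :
    C.Homog ![(a, x.1), (b, y.1), (c, z.1), (e, w.1)] := by
  intro j; fin_cases j <;> simp

theorem homog_five {a b c e f : ℤ} (x : C.gr a) (y : C.gr b) (z : C.gr c) (w : C.gr e)
    (v : C.gr f) : C.Homog ![(a, x.1), (b, y.1), (c, z.1), (e, w.1), (f, v.1)] := by
  intro j; fin_cases j <;> simp

variable {r : ℤ}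

theorem Tame.ext_two {μ ν : Op L L' 2 r} (hμ : C.Tame C' μ) (hν : C.Tame C' ν)
    (h : ∀ (a b : ℕ) (x y : L), x ∈ C.gr a → y ∈ C.gr b → ((a + b : ℕ) : ℤ) + r ≤ 2 →
      μ ![((a : ℤ), x), ((b : ℤ), y)] = ν ![((a : ℤ), x), ((b : ℤ), y)]) :
    ∀ x, C.Homog x → μ x = ν x :=
  hμ.ext hν fun δ v hle => by
    have := h (δ 0) (δ 1) (v 0) (v 1) (v 0).2 (v 1).2 (by simpa [Fin.sum_univ_two] using hle)
    convert this using 2 <;> (funext j; fin_cases j <;> rfl)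

theorem Tame.ext_three {μ ν : Op L L' 3 r} (hμ : C.Tame C' μ) (hν : C.Tame C' ν)
    (h : ∀ (a b c : ℕ) (x y z : L), x ∈ C.gr a → y ∈ C.gr b → z ∈ C.gr c →
      ((a + b + c : ℕ) : ℤ) + r ≤ 2 →
      μ ![((a : ℤ), x), ((b : ℤ), y), ((c : ℤ), z)] =
        ν ![((a : ℤ), x), ((b : ℤ), y), ((c : ℤ), z)]) :
    ∀ x, C.Homog x → μ x = ν x :=
  hμ.ext hν fun δ v hle => by
    have := h (δ 0) (δ 1) (δ 2) (v 0) (v 1) (v 2) (v 0).2 (v 1).2 (v 2).2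
      (by simpa [Fin.sum_univ_three] using hle)
    convert this using 2 <;> (funext j; fin_cases j <;> rfl)

theorem Tame.ext_four {μ ν : Op L L' 4 r} (hμ : C.Tame C' μ) (hν : C.Tame C' ν)
    (h : ∀ (a b c e : ℕ) (x y z w : L), x ∈ C.gr a → y ∈ C.gr b → z ∈ C.gr c → w ∈ C.gr e →
      ((a + b + c + e : ℕ) : ℤ) + r ≤ 2 →
      μ ![((a : ℤ), x), ((b : ℤ), y), ((c : ℤ), z), ((e : ℤ), w)] =
        ν ![((a : ℤ), x), ((b : ℤ), y), ((c : ℤ), z), ((e : ℤ), w)]) :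
    ∀ x, C.Homog x → μ x = ν x :=
  hμ.ext hν fun δ v hle => by
    have := h (δ 0) (δ 1) (δ 2) (δ 3) (v 0) (v 1) (v 2) (v 3) (v 0).2 (v 1).2 (v 2).2 (v 3).2
      (by simpa [Fin.sum_univ_four] using hle)
    convert this using 2 <;> (funext j; fin_cases j <;> rfl)

theorem Tame.ext_five {μ ν : Op L L' 5 r} (hμ : C.Tame C' μ) (hν : C.Tame C' ν)
    (h : ∀ (a b c e f : ℕ) (x y z w v : L), x ∈ C.gr a → y ∈ C.gr b → z ∈ C.gr c → w ∈ C.gr e →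
      v ∈ C.gr f → ((a + b + c + e + f : ℕ) : ℤ) + r ≤ 2 →
      μ ![((a : ℤ), x), ((b : ℤ), y), ((c : ℤ), z), ((e : ℤ), w), ((f : ℤ), v)] =
        ν ![((a : ℤ), x), ((b : ℤ), y), ((c : ℤ), z), ((e : ℤ), w), ((f : ℤ), v)]) :
    ∀ x, C.Homog x → μ x = ν x :=
  hμ.ext hν fun δ v hle => by
    have := h (δ 0) (δ 1) (δ 2) (δ 3) (δ 4) (v 0) (v 1) (v 2) (v 3) (v 4) (v 0).2 (v 1).2 (v 2).2
      (v 3).2 (v 4).2 (by simpa [Fin.sum_univ_five] using hle)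
    convert this using 2 <;> (funext j; fin_cases j <;> rfl)

/-- An operation of degree `2` can be nonzero only if all arguments have degree `0`, where every
Koszul sign is trivial. All relations without a boundary are of this kind. -/
theorem Tame.ext_two_of_degree_two {μ ν : Op L L' 2 2} (hμ : C.Tame C' μ) (hν : C.Tame C' ν)
    (h : ∀ x y : C.gr 0, μ ![(0, x.1), (0, y.1)] = ν ![(0, x.1), (0, y.1)]) :
    ∀ x, C.Homog x → μ x = ν x :=
  hμ.ext_two hν fun a b x y hx hy hle => by
    obtain ⟨rfl, rfl⟩ : a = 0 ∧ b = 0 := by omega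
    exact h ⟨x, hx⟩ ⟨y, hy⟩

theorem Tame.ext_three_of_degree_two {μ ν : Op L L' 3 2} (hμ : C.Tame C' μ) (hν : C.Tame C' ν)
    (h : ∀ x y z : C.gr 0, μ ![(0, x.1), (0, y.1), (0, z.1)] = ν ![(0, x.1), (0, y.1), (0, z.1)]) :
    ∀ x, C.Homog x → μ x = ν x :=
  hμ.ext_three hν fun a b c x y z hx hy hz hle => by
    obtain ⟨rfl, rfl, rfl⟩ : a = 0 ∧ b = 0 ∧ c = 0 := by omega
    exact h ⟨x, hx⟩ ⟨y, hy⟩ ⟨z, hz⟩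

theorem Tame.ext_four_of_degree_two {μ ν : Op L L' 4 2} (hμ : C.Tame C' μ) (hν : C.Tame C' ν)
    (h : ∀ x y z w : C.gr 0, μ ![(0, x.1), (0, y.1), (0, z.1), (0, w.1)] =
      ν ![(0, x.1), (0, y.1), (0, z.1), (0, w.1)]) :
    ∀ x, C.Homog x → μ x = ν x :=
  hμ.ext_four hν fun a b c e x y z w hx hy hz hw hle => by
    obtain ⟨rfl, rfl, rfl, rfl⟩ : a = 0 ∧ b = 0 ∧ c = 0 ∧ e = 0 := by omega
    exact h ⟨x, hx⟩ ⟨y, hy⟩ ⟨z, hz⟩ ⟨w, hw⟩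

theorem Tame.ext_five_of_degree_two {μ ν : Op L L' 5 2} (hμ : C.Tame C' μ) (hν : C.Tame C' ν)
    (h : ∀ x y z w v : C.gr 0, μ ![(0, x.1), (0, y.1), (0, z.1), (0, w.1), (0, v.1)] =
      ν ![(0, x.1), (0, y.1), (0, z.1), (0, w.1), (0, v.1)]) :
    ∀ x, C.Homog x → μ x = ν x :=
  hμ.ext_five hν fun a b c e f x y z w v hx hy hz hw hv hle => by
    obtain ⟨rfl, rfl, rfl, rfl, rfl⟩ : a = 0 ∧ b = 0 ∧ c = 0 ∧ e = 0 ∧ f = 0 := by omega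
    exact h ⟨x, hx⟩ ⟨y, hy⟩ ⟨z, hz⟩ ⟨w, hw⟩ ⟨v, hv⟩

/-- Two ternary operations agree on arguments of degrees `a`, `b`, `c`. -/
def EqOnThree (C : ThreeTermComplex k L) (μ ν : Op L L' 3 r) (a b c : ℤ) : Prop :=
  ∀ (x : C.gr a) (y : C.gr b) (z : C.gr c),
    μ ![(a, x.1), (b, y.1), (c, z.1)] = ν ![(a, x.1), (b, y.1), (c, z.1)]

/-- Two quaternary operations agree on arguments of degrees `a`, `b`, `c`, `e`. -/
def EqOnFour (C : ThreeTermComplex k L) (μ ν : Op L L' 4 r) (a b c e : ℤ) : Prop :=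
  ∀ (x : C.gr a) (y : C.gr b) (z : C.gr c) (w : C.gr e),
    μ ![(a, x.1), (b, y.1), (c, z.1), (e, w.1)] = ν ![(a, x.1), (b, y.1), (c, z.1), (e, w.1)]

/-- At most one argument has positive degree, and then this degree is `1`. -/
theorem Tame.ext_three_of_degree_one {μ ν : Op L L' 3 1} (hμ : C.Tame C' μ) (hν : C.Tame C' ν)
    (h000 : C.EqOnThree μ ν 0 0 0) (h001 : C.EqOnThree μ ν 0 0 1) (h010 : C.EqOnThree μ ν 0 1 0)
    (h100 : C.EqOnThree μ ν 1 0 0) :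
    ∀ x, C.Homog x → μ x = ν x :=
  hμ.ext_three hν fun a b c x y z hx hy hz hle => by
    obtain ⟨rfl, rfl, rfl⟩ | ⟨rfl, rfl, rfl⟩ | ⟨rfl, rfl, rfl⟩ | ⟨rfl, rfl, rfl⟩ :
      (a = 0 ∧ b = 0 ∧ c = 0) ∨ (a = 0 ∧ b = 0 ∧ c = 1) ∨ (a = 0 ∧ b = 1 ∧ c = 0) ∨
        (a = 1 ∧ b = 0 ∧ c = 0) := by omega
    exacts [h000 ⟨x, hx⟩ ⟨y, hy⟩ ⟨z, hz⟩, h001 ⟨x, hx⟩ ⟨y, hy⟩ ⟨z, hz⟩,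
      h010 ⟨x, hx⟩ ⟨y, hy⟩ ⟨z, hz⟩, h100 ⟨x, hx⟩ ⟨y, hy⟩ ⟨z, hz⟩]

theorem Tame.ext_four_of_degree_one {μ ν : Op L L' 4 1} (hμ : C.Tame C' μ) (hν : C.Tame C' ν)
    (h0000 : C.EqOnFour μ ν 0 0 0 0) (h0001 : C.EqOnFour μ ν 0 0 0 1)
    (h0010 : C.EqOnFour μ ν 0 0 1 0) (h0100 : C.EqOnFour μ ν 0 1 0 0)
    (h1000 : C.EqOnFour μ ν 1 0 0 0) :
    ∀ x, C.Homog x → μ x = ν x :=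
  hμ.ext_four hν fun a b c e x y z w hx hy hz hw hle => by
    obtain ⟨rfl, rfl, rfl, rfl⟩ | ⟨rfl, rfl, rfl, rfl⟩ | ⟨rfl, rfl, rfl, rfl⟩ |
        ⟨rfl, rfl, rfl, rfl⟩ | ⟨rfl, rfl, rfl, rfl⟩ :
      (a = 0 ∧ b = 0 ∧ c = 0 ∧ e = 0) ∨ (a = 0 ∧ b = 0 ∧ c = 0 ∧ e = 1) ∨
        (a = 0 ∧ b = 0 ∧ c = 1 ∧ e = 0) ∨ (a = 0 ∧ b = 1 ∧ c = 0 ∧ e = 0) ∨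
        (a = 1 ∧ b = 0 ∧ c = 0 ∧ e = 0) := by omega
    exacts [h0000 ⟨x, hx⟩ ⟨y, hy⟩ ⟨z, hz⟩ ⟨w, hw⟩, h0001 ⟨x, hx⟩ ⟨y, hy⟩ ⟨z, hz⟩ ⟨w, hw⟩,
      h0010 ⟨x, hx⟩ ⟨y, hy⟩ ⟨z, hz⟩ ⟨w, hw⟩, h0100 ⟨x, hx⟩ ⟨y, hy⟩ ⟨z, hz⟩ ⟨w, hw⟩,
      h1000 ⟨x, hx⟩ ⟨y, hy⟩ ⟨z, hz⟩ ⟨w, hw⟩]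

/-- The ten cases are the triples of natural numbers with sum at most `2`. They are needed only for
the relation on `∂λ₃`. -/
theorem Tame.ext_three_of_degree_zero {μ ν : Op L L' 3 0} (hμ : C.Tame C' μ) (hν : C.Tame C' ν)
    (h000 : C.EqOnThree μ ν 0 0 0) (h001 : C.EqOnThree μ ν 0 0 1) (h010 : C.EqOnThree μ ν 0 1 0)
    (h100 : C.EqOnThree μ ν 1 0 0) (h002 : C.EqOnThree μ ν 0 0 2) (h020 : C.EqOnThree μ ν 0 2 0)
    (h200 : C.EqOnThree μ ν 2 0 0) (h011 : C.EqOnThree μ ν 0 1 1) (h101 : C.EqOnThree μ ν 1 0 1)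
    (h110 : C.EqOnThree μ ν 1 1 0) :
    ∀ x, C.Homog x → μ x = ν x :=
  hμ.ext_three hν fun a b c x y z hx hy hz hle => by
    obtain ⟨rfl, rfl, rfl⟩ | ⟨rfl, rfl, rfl⟩ | ⟨rfl, rfl, rfl⟩ | ⟨rfl, rfl, rfl⟩ |
        ⟨rfl, rfl, rfl⟩ | ⟨rfl, rfl, rfl⟩ | ⟨rfl, rfl, rfl⟩ | ⟨rfl, rfl, rfl⟩ |
        ⟨rfl, rfl, rfl⟩ | ⟨rfl, rfl, rfl⟩ :
      (a = 0 ∧ b = 0 ∧ c = 0) ∨ (a = 0 ∧ b = 0 ∧ c = 1) ∨ (a = 0 ∧ b = 1 ∧ c = 0) ∨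
        (a = 1 ∧ b = 0 ∧ c = 0) ∨ (a = 0 ∧ b = 0 ∧ c = 2) ∨ (a = 0 ∧ b = 2 ∧ c = 0) ∨
        (a = 2 ∧ b = 0 ∧ c = 0) ∨ (a = 0 ∧ b = 1 ∧ c = 1) ∨ (a = 1 ∧ b = 0 ∧ c = 1) ∨
        (a = 1 ∧ b = 1 ∧ c = 0) := by omega
    exacts [h000 ⟨x, hx⟩ ⟨y, hy⟩ ⟨z, hz⟩, h001 ⟨x, hx⟩ ⟨y, hy⟩ ⟨z, hz⟩,
      h010 ⟨x, hx⟩ ⟨y, hy⟩ ⟨z, hz⟩, h100 ⟨x, hx⟩ ⟨y, hy⟩ ⟨z, hz⟩,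
      h002 ⟨x, hx⟩ ⟨y, hy⟩ ⟨z, hz⟩, h020 ⟨x, hx⟩ ⟨y, hy⟩ ⟨z, hz⟩,
      h200 ⟨x, hx⟩ ⟨y, hy⟩ ⟨z, hz⟩, h011 ⟨x, hx⟩ ⟨y, hy⟩ ⟨z, hz⟩,
      h101 ⟨x, hx⟩ ⟨y, hy⟩ ⟨z, hz⟩, h110 ⟨x, hx⟩ ⟨y, hy⟩ ⟨z, hz⟩]

end ThreeTermComplex

/-! ### Evaluation of permutations, compositions and boundaries on explicit tuples -/

@[simp] theorem Int.negOnePow_two : Int.negOnePow 2 = 1 := rfl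

section totalDeg

variable {L : Type*}

@[simp] theorem totalDeg_vecCons {n : ℕ} (x : ℤ × L) (v : Fin n → ℤ × L) :
    totalDeg (Matrix.vecCons x v) = x.1 + totalDeg v := by
  simp [totalDeg, Fin.sum_univ_succ]

@[simp] theorem totalDeg_empty : totalDeg (![] : Fin 0 → ℤ × L) = 0 := rfl

end totalDeg

namespace Op

variable {L L' L'' : Type*} {r s s₁ s₂ s₃ : ℤ}

section perm

variable [AddCommGroup L'] {n : ℕ} (μ : Op L L' n r)

/-- For a concrete cycle the inversions are decided by computation. The product of signs then
collapses to one power of `-1` whose exponent is still symbolic in the degrees. -/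
theorem cyc_apply (c : List (Fin n)) {x y : Fin n → ℤ × L} {t : ℤ}
    (ht : (∏ i, ∏ j, if i < j ∧ c.formPerm j < c.formPerm i then ((x i).1 * (x j).1).negOnePow
      else 1) = t.negOnePow) (hy : ∀ j, x (c.formPerm.symm j) = y j) :
    μ.cyc c x = t.negOnePow • μ y :=
  congrArg₂ (fun (u : ℤˣ) v => u • μ v) ht (funext hy)

/-- Each factor of the Koszul sign is `(-1)^0`. This suffices for five inputs, since the five-input
relation has degree `2`. -/
theorem perm_of_degree_zero (σ : Equiv.Perm (Fin n)) {x y : Fin n → L}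
    (hy : ∀ j, x (σ.symm j) = y j) : μ.perm σ (fun j => (0, x j)) = μ fun j => (0, y j) := by
  simp [perm, hy]

end perm

section cyc

variable [AddCommGroup L'] (x0 x1 x2 x3 : ℤ × L)

@[simp] theorem cyc_two_zero_one (μ : Op L L' 2 r) : μ.cyc [0, 1] ![x0, x1] =
    (x0.1 * x1.1).negOnePow • μ ![x1, x0] :=
  cyc_apply μ _ (by simp +decide [Fin.prod_univ_two]) (by intro j; fin_cases j <;> rfl)

@[simp] theorem cyc_three_zero_one (μ : Op L L' 3 r) : μ.cyc [0, 1] ![x0, x1, x2] =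
    (x0.1 * x1.1).negOnePow • μ ![x1, x0, x2] :=
  cyc_apply μ _ (by simp +decide [Fin.prod_univ_three]) (by intro j; fin_cases j <;> rfl)

@[simp] theorem cyc_three_one_two (μ : Op L L' 3 r) : μ.cyc [1, 2] ![x0, x1, x2] =
    (x1.1 * x2.1).negOnePow • μ ![x0, x2, x1] :=
  cyc_apply μ _ (by simp +decide [Fin.prod_univ_three]) (by intro j; fin_cases j <;> rfl)

@[simp] theorem cyc_three_zero_one_two (μ : Op L L' 3 r) : μ.cyc [0, 1, 2] ![x0, x1, x2] =
    (x0.1 * x2.1 + x1.1 * x2.1).negOnePow • μ ![x2, x0, x1] :=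
  cyc_apply μ _ (by simp +decide [Fin.prod_univ_three, Int.negOnePow_add])
    (by intro j; fin_cases j <;> rfl)

@[simp] theorem cyc_three_zero_two_one (μ : Op L L' 3 r) : μ.cyc [0, 2, 1] ![x0, x1, x2] =
    (x0.1 * x1.1 + x0.1 * x2.1).negOnePow • μ ![x1, x2, x0] :=
  cyc_apply μ _ (by simp +decide [Fin.prod_univ_three, Int.negOnePow_add])
    (by intro j; fin_cases j <;> rfl)

@[simp] theorem cyc_four_zero_one (μ : Op L L' 4 r) : μ.cyc [0, 1] ![x0, x1, x2, x3] =
    (x0.1 * x1.1).negOnePow • μ ![x1, x0, x2, x3] :=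
  cyc_apply μ _ (by simp +decide [Fin.prod_univ_four]) (by intro j; fin_cases j <;> rfl)

@[simp] theorem cyc_four_one_two (μ : Op L L' 4 r) : μ.cyc [1, 2] ![x0, x1, x2, x3] =
    (x1.1 * x2.1).negOnePow • μ ![x0, x2, x1, x3] :=
  cyc_apply μ _ (by simp +decide [Fin.prod_univ_four]) (by intro j; fin_cases j <;> rfl)

@[simp] theorem cyc_four_two_three (μ : Op L L' 4 r) : μ.cyc [2, 3] ![x0, x1, x2, x3] =
    (x2.1 * x3.1).negOnePow • μ ![x0, x1, x3, x2] :=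
  cyc_apply μ _ (by simp +decide [Fin.prod_univ_four]) (by intro j; fin_cases j <;> rfl)

@[simp] theorem cyc_four_zero_one_two (μ : Op L L' 4 r) : μ.cyc [0, 1, 2] ![x0, x1, x2, x3] =
    (x0.1 * x2.1 + x1.1 * x2.1).negOnePow • μ ![x2, x0, x1, x3] :=
  cyc_apply μ _ (by simp +decide [Fin.prod_univ_four, Int.negOnePow_add])
    (by intro j; fin_cases j <;> rfl)

@[simp] theorem cyc_four_zero_two_one (μ : Op L L' 4 r) : μ.cyc [0, 2, 1] ![x0, x1, x2, x3] =
    (x0.1 * x1.1 + x0.1 * x2.1).negOnePow • μ ![x1, x2, x0, x3] :=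
  cyc_apply μ _ (by simp +decide [Fin.prod_univ_four, Int.negOnePow_add])
    (by intro j; fin_cases j <;> rfl)

@[simp] theorem cyc_four_zero_two (μ : Op L L' 4 r) : μ.cyc [0, 2] ![x0, x1, x2, x3] =
    (x0.1 * x1.1 + x0.1 * x2.1 + x1.1 * x2.1).negOnePow • μ ![x2, x1, x0, x3] :=
  cyc_apply μ _ (by simp +decide [Fin.prod_univ_four, Int.negOnePow_add, mul_assoc])
    (by intro j; fin_cases j <;> rfl)

end cyc

section degree_zero

variable [AddCommGroup L'] (μ : Op L L' 5 r) (x0 x1 x2 x3 x4 : L)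

theorem perm_five_apply (σ : Equiv.Perm (Fin 5)) {y0 y1 y2 y3 y4 : L}
    (h : ∀ j, ![x0, x1, x2, x3, x4] (σ.symm j) = ![y0, y1, y2, y3, y4] j) :
    μ.perm σ ![(0, x0), (0, x1), (0, x2), (0, x3), (0, x4)] =
      μ ![(0, y0), (0, y1), (0, y2), (0, y3), (0, y4)] := by
  convert μ.perm_of_degree_zero σ h using 2 <;> (funext j; fin_cases j <;> rfl)

@[simp] theorem cyc_five_zero_one :
    μ.cyc [0, 1] ![(0, x0), (0, x1), (0, x2), (0, x3), (0, x4)] =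
      μ ![(0, x1), (0, x0), (0, x2), (0, x3), (0, x4)] :=
  perm_five_apply μ _ _ _ _ _ _ (by intro j; fin_cases j <;> rfl)

@[simp] theorem cyc_five_zero_one_two :
    μ.cyc [0, 1, 2] ![(0, x0), (0, x1), (0, x2), (0, x3), (0, x4)] =
      μ ![(0, x2), (0, x0), (0, x1), (0, x3), (0, x4)] :=
  perm_five_apply μ _ _ _ _ _ _ (by intro j; fin_cases j <;> rfl)

@[simp] theorem cyc_five_zero_one_two_three :
    μ.cyc [0, 1, 2, 3] ![(0, x0), (0, x1), (0, x2), (0, x3), (0, x4)] =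
      μ ![(0, x3), (0, x0), (0, x1), (0, x2), (0, x4)] :=
  perm_five_apply μ _ _ _ _ _ _ (by intro j; fin_cases j <;> rfl)

@[simp] theorem cyc_five_one_two :
    μ.cyc [1, 2] ![(0, x0), (0, x1), (0, x2), (0, x3), (0, x4)] =
      μ ![(0, x0), (0, x2), (0, x1), (0, x3), (0, x4)] :=
  perm_five_apply μ _ _ _ _ _ _ (by intro j; fin_cases j <;> rfl)

@[simp] theorem cyc_five_zero_two_one :
    μ.cyc [0, 2, 1] ![(0, x0), (0, x1), (0, x2), (0, x3), (0, x4)] =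
      μ ![(0, x1), (0, x2), (0, x0), (0, x3), (0, x4)] :=
  perm_five_apply μ _ _ _ _ _ _ (by intro j; fin_cases j <;> rfl)

@[simp] theorem cyc_five_one_two_three :
    μ.cyc [1, 2, 3] ![(0, x0), (0, x1), (0, x2), (0, x3), (0, x4)] =
      μ ![(0, x0), (0, x3), (0, x1), (0, x2), (0, x4)] :=
  perm_five_apply μ _ _ _ _ _ _ (by intro j; fin_cases j <;> rfl)

@[simp] theorem cyc_five_zero_two_three_one :
    μ.cyc [0, 2, 3, 1] ![(0, x0), (0, x1), (0, x2), (0, x3), (0, x4)] =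
      μ ![(0, x1), (0, x3), (0, x0), (0, x2), (0, x4)] :=
  perm_five_apply μ _ _ _ _ _ _ (by intro j; fin_cases j <;> rfl)

@[simp] theorem cyc_five_two_three :
    μ.cyc [2, 3] ![(0, x0), (0, x1), (0, x2), (0, x3), (0, x4)] =
      μ ![(0, x0), (0, x1), (0, x3), (0, x2), (0, x4)] :=
  perm_five_apply μ _ _ _ _ _ _ (by intro j; fin_cases j <;> rfl)

@[simp] theorem cyc_five_one_three_two :
    μ.cyc [1, 3, 2] ![(0, x0), (0, x1), (0, x2), (0, x3), (0, x4)] =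
      μ ![(0, x0), (0, x2), (0, x3), (0, x1), (0, x4)] :=
  perm_five_apply μ _ _ _ _ _ _ (by intro j; fin_cases j <;> rfl)

@[simp] theorem cyc_five_zero_three_two_one :
    μ.cyc [0, 3, 2, 1] ![(0, x0), (0, x1), (0, x2), (0, x3), (0, x4)] =
      μ ![(0, x1), (0, x2), (0, x3), (0, x0), (0, x4)] :=
  perm_five_apply μ _ _ _ _ _ _ (by intro j; fin_cases j <;> rfl)

@[simp] theorem perm_five_swap_mul_swap :
    μ.perm (Equiv.swap 0 2 * Equiv.swap 1 3) ![(0, x0), (0, x1), (0, x2), (0, x3), (0, x4)] =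
      μ ![(0, x2), (0, x3), (0, x0), (0, x1), (0, x4)] :=
  perm_five_apply μ _ _ _ _ _ _ (by intro j; fin_cases j <;> rfl)

end degree_zero

section circ

variable [AddCommGroup L']

/-- The tuples before, inside and around the inserted operation are supplied as data. For literal
vectors the side conditions then hold by `rfl` at each index, and no index arithmetic is left in the
result. -/
theorem circ_apply {m n : ℕ} (μ : Op L L' m r) (i : Fin m) (ν : Op L L n s)
    {x : Fin (m + n - 1) → ℤ × L} (w : Fin i → ℤ × L) (y : Fin n → ℤ × L) {z : Fin m → ℤ × L}
    (h : (∀ j : Fin i, x ⟨j, by omega⟩ = w j) ∧ (∀ l : Fin n, x ⟨i + l, by omega⟩ = y l) ∧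
      ∀ j : Fin m, (if _ : j < i then x ⟨j, by omega⟩ else
        if _ : j = i then (totalDeg y + s, ν y) else x ⟨j + n - 1, by omega⟩) = z j) :
    μ.circ i ν x = (s * totalDeg w).negOnePow • μ z := by
  obtain ⟨hw, hy, hz⟩ := h
  obtain rfl := funext hw
  obtain rfl := funext hy
  obtain rfl := funext hz
  rfl

/-- Insertion into the first slot moves the inner operation past no argument, so there is no sign.
-/
theorem circ_zero_apply {m n : ℕ} [NeZero m] (μ : Op L L' m r) (ν : Op L L n s)
    {x : Fin (m + n - 1) → ℤ × L} (y : Fin n → ℤ × L) {z : Fin m → ℤ × L}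
    (h : (∀ l : Fin n, x ⟨l, by have := NeZero.pos m; omega⟩ = y l) ∧
      ∀ j : Fin m, (if _ : j = 0 then (totalDeg y + s, ν y) else x ⟨j + n - 1, by omega⟩) = z j) :
    μ.circ 0 ν x = μ z := by
  obtain ⟨hy, hz⟩ := h
  refine (circ_apply μ 0 ν (fun j => x ⟨j, by omega⟩) y (z := z) ⟨fun _ => rfl, fun l => ?_,
    fun j => ?_⟩).trans ?_
  · simp [← hy]
  · simp [← hz]
  · have : IsEmpty (Fin ((0 : Fin m) : ℕ)) := ⟨fun j => by simpa using j.2⟩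
    rw [totalDeg, Fintype.sum_empty, mul_zero, Int.negOnePow_zero, one_smul]

variable (x0 x1 x2 x3 x4 : ℤ × L)

@[simp] theorem circ_two_zero_two (μ : Op L L' 2 r) (ν : Op L L 2 s) :
    μ.circ 0 ν ![x0, x1, x2] =
      μ ![(totalDeg ![x0, x1] + s, ν ![x0, x1]), x2] :=
  circ_zero_apply μ ν ![x0, x1] (by refine ⟨?_, ?_⟩ <;> (intro j; fin_cases j <;> rfl))

@[simp] theorem circ_two_one_two (μ : Op L L' 2 r) (ν : Op L L 2 s) :
    μ.circ 1 ν ![x0, x1, x2] =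
      (s * totalDeg ![x0]).negOnePow • μ ![x0, (totalDeg ![x1, x2] + s, ν ![x1, x2])] :=
  circ_apply μ 1 ν ![x0] ![x1, x2]
    (by refine ⟨?_, ?_, ?_⟩ <;> (intro j; fin_cases j <;> rfl))

@[simp] theorem circ_two_zero_three (μ : Op L L' 2 r) (ν : Op L L 3 s) :
    μ.circ 0 ν ![x0, x1, x2, x3] =
      μ ![(totalDeg ![x0, x1, x2] + s, ν ![x0, x1, x2]), x3] :=
  circ_zero_apply μ ν ![x0, x1, x2] (by refine ⟨?_, ?_⟩ <;> (intro j; fin_cases j <;> rfl))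

@[simp] theorem circ_two_one_three (μ : Op L L' 2 r) (ν : Op L L 3 s) :
    μ.circ 1 ν ![x0, x1, x2, x3] =
      (s * totalDeg ![x0]).negOnePow • μ ![x0, (totalDeg ![x1, x2, x3] + s, ν ![x1, x2, x3])] :=
  circ_apply μ 1 ν ![x0] ![x1, x2, x3]
    (by refine ⟨?_, ?_, ?_⟩ <;> (intro j; fin_cases j <;> rfl))

@[simp] theorem circ_three_zero_two (μ : Op L L' 3 r) (ν : Op L L 2 s) :
    μ.circ 0 ν ![x0, x1, x2, x3] =
      μ ![(totalDeg ![x0, x1] + s, ν ![x0, x1]), x2, x3] :=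
  circ_zero_apply μ ν ![x0, x1] (by refine ⟨?_, ?_⟩ <;> (intro j; fin_cases j <;> rfl))

@[simp] theorem circ_three_one_two (μ : Op L L' 3 r) (ν : Op L L 2 s) :
    μ.circ 1 ν ![x0, x1, x2, x3] =
      (s * totalDeg ![x0]).negOnePow • μ ![x0, (totalDeg ![x1, x2] + s, ν ![x1, x2]), x3] :=
  circ_apply μ 1 ν ![x0] ![x1, x2]
    (by refine ⟨?_, ?_, ?_⟩ <;> (intro j; fin_cases j <;> rfl))

@[simp] theorem circ_three_two_two (μ : Op L L' 3 r) (ν : Op L L 2 s) :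
    μ.circ 2 ν ![x0, x1, x2, x3] =
      (s * totalDeg ![x0, x1]).negOnePow • μ ![x0, x1, (totalDeg ![x2, x3] + s, ν ![x2, x3])] :=
  circ_apply μ 2 ν ![x0, x1] ![x2, x3]
    (by refine ⟨?_, ?_, ?_⟩ <;> (intro j; fin_cases j <;> rfl))

@[simp] theorem circ_two_zero_four (μ : Op L L' 2 r) (ν : Op L L 4 s) :
    μ.circ 0 ν ![x0, x1, x2, x3, x4] =
      μ ![(totalDeg ![x0, x1, x2, x3] + s, ν ![x0, x1, x2, x3]), x4] :=
  circ_zero_apply μ ν ![x0, x1, x2, x3] (by refine ⟨?_, ?_⟩ <;> (intro j; fin_cases j <;> rfl))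

@[simp] theorem circ_two_one_four (μ : Op L L' 2 r) (ν : Op L L 4 s) :
    μ.circ 1 ν ![x0, x1, x2, x3, x4] =
      (s * totalDeg ![x0]).negOnePow •
        μ ![x0, (totalDeg ![x1, x2, x3, x4] + s, ν ![x1, x2, x3, x4])] :=
  circ_apply μ 1 ν ![x0] ![x1, x2, x3, x4]
    (by refine ⟨?_, ?_, ?_⟩ <;> (intro j; fin_cases j <;> rfl))

@[simp] theorem circ_three_zero_three (μ : Op L L' 3 r) (ν : Op L L 3 s) :
    μ.circ 0 ν ![x0, x1, x2, x3, x4] =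
      μ ![(totalDeg ![x0, x1, x2] + s, ν ![x0, x1, x2]), x3, x4] :=
  circ_zero_apply μ ν ![x0, x1, x2] (by refine ⟨?_, ?_⟩ <;> (intro j; fin_cases j <;> rfl))

@[simp] theorem circ_three_one_three (μ : Op L L' 3 r) (ν : Op L L 3 s) :
    μ.circ 1 ν ![x0, x1, x2, x3, x4] =
      (s * totalDeg ![x0]).negOnePow • μ ![x0, (totalDeg ![x1, x2, x3] + s, ν ![x1, x2, x3]), x4] :=
  circ_apply μ 1 ν ![x0] ![x1, x2, x3]
    (by refine ⟨?_, ?_, ?_⟩ <;> (intro j; fin_cases j <;> rfl))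

@[simp] theorem circ_three_two_three (μ : Op L L' 3 r) (ν : Op L L 3 s) :
    μ.circ 2 ν ![x0, x1, x2, x3, x4] =
      (s * totalDeg ![x0, x1]).negOnePow •
        μ ![x0, x1, (totalDeg ![x2, x3, x4] + s, ν ![x2, x3, x4])] :=
  circ_apply μ 2 ν ![x0, x1] ![x2, x3, x4]
    (by refine ⟨?_, ?_, ?_⟩ <;> (intro j; fin_cases j <;> rfl))

@[simp] theorem circ_four_zero_two (μ : Op L L' 4 r) (ν : Op L L 2 s) :
    μ.circ 0 ν ![x0, x1, x2, x3, x4] =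
      μ ![(totalDeg ![x0, x1] + s, ν ![x0, x1]), x2, x3, x4] :=
  circ_zero_apply μ ν ![x0, x1] (by refine ⟨?_, ?_⟩ <;> (intro j; fin_cases j <;> rfl))

@[simp] theorem circ_four_one_two (μ : Op L L' 4 r) (ν : Op L L 2 s) :
    μ.circ 1 ν ![x0, x1, x2, x3, x4] =
      (s * totalDeg ![x0]).negOnePow • μ ![x0, (totalDeg ![x1, x2] + s, ν ![x1, x2]), x3, x4] :=
  circ_apply μ 1 ν ![x0] ![x1, x2]
    (by refine ⟨?_, ?_, ?_⟩ <;> (intro j; fin_cases j <;> rfl))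

@[simp] theorem circ_four_two_two (μ : Op L L' 4 r) (ν : Op L L 2 s) :
    μ.circ 2 ν ![x0, x1, x2, x3, x4] =
      (s * totalDeg ![x0, x1]).negOnePow • μ ![x0, x1, (totalDeg ![x2, x3] + s, ν ![x2, x3]), x4] :=
  circ_apply μ 2 ν ![x0, x1] ![x2, x3]
    (by refine ⟨?_, ?_, ?_⟩ <;> (intro j; fin_cases j <;> rfl))

@[simp] theorem circ_four_three_two (μ : Op L L' 4 r) (ν : Op L L 2 s) :
    μ.circ 3 ν ![x0, x1, x2, x3, x4] =
      (s * totalDeg ![x0, x1, x2]).negOnePow •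
        μ ![x0, x1, x2, (totalDeg ![x3, x4] + s, ν ![x3, x4])] :=
  circ_apply μ 3 ν ![x0, x1, x2] ![x3, x4]
    (by refine ⟨?_, ?_, ?_⟩ <;> (intro j; fin_cases j <;> rfl))

end circ

section comp

variable [AddCommGroup L'']

theorem comp2_apply {a b : ℕ} (μ : Op L' L'' 2 r) (ν₁ : Op L L' a s₁) (ν₂ : Op L L' b s₂)
    {x : Fin (a + b) → ℤ × L} {y₁ : Fin a → ℤ × L} {y₂ : Fin b → ℤ × L}
    (h : (∀ l : Fin a, x ⟨l, by omega⟩ = y₁ l) ∧ ∀ l : Fin b, x ⟨a + l, by omega⟩ = y₂ l) :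
    μ.comp2 ν₁ ν₂ x = (s₂ * totalDeg y₁).negOnePow •
      μ ![(totalDeg y₁ + s₁, ν₁ y₁), (totalDeg y₂ + s₂, ν₂ y₂)] := by
  obtain rfl := funext h.1
  obtain rfl := funext h.2
  rfl

theorem comp3_apply {a b c : ℕ} (μ : Op L' L'' 3 r) (ν₁ : Op L L' a s₁) (ν₂ : Op L L' b s₂)
    (ν₃ : Op L L' c s₃) {x : Fin (a + b + c) → ℤ × L} {y₁ : Fin a → ℤ × L} {y₂ : Fin b → ℤ × L}
    {y₃ : Fin c → ℤ × L} (h : (∀ l : Fin a, x ⟨l, by omega⟩ = y₁ l) ∧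
      (∀ l : Fin b, x ⟨a + l, by omega⟩ = y₂ l) ∧ ∀ l : Fin c, x ⟨a + b + l, by omega⟩ = y₃ l) :
    μ.comp3 ν₁ ν₂ ν₃ x = (s₂ * totalDeg y₁ + s₃ * (totalDeg y₁ + totalDeg y₂)).negOnePow •
      μ ![(totalDeg y₁ + s₁, ν₁ y₁), (totalDeg y₂ + s₂, ν₂ y₂), (totalDeg y₃ + s₃, ν₃ y₃)] := by
  obtain rfl := funext h.1
  obtain rfl := funext h.2.1
  obtain rfl := funext h.2.2
  rfl

variable (x0 x1 x2 x3 : ℤ × L)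

@[simp] theorem comp_one_two (μ : Op L' L'' 2 r) (ν₁ : Op L L' 1 s₁) (ν₂ : Op L L' 2 s₂) :
    μ.comp2 ν₁ ν₂ ![x0, x1, x2] =
      (s₂ * totalDeg ![x0]).negOnePow •
        μ ![(totalDeg ![x0] + s₁, ν₁ ![x0]), (totalDeg ![x1, x2] + s₂, ν₂ ![x1, x2])] :=
  comp2_apply μ ν₁ ν₂ (by refine ⟨?_, ?_⟩ <;> (intro j; fin_cases j <;> rfl))

@[simp] theorem comp_two_one (μ : Op L' L'' 2 r) (ν₁ : Op L L' 2 s₁) (ν₂ : Op L L' 1 s₂) :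
    μ.comp2 ν₁ ν₂ ![x0, x1, x2] =
      (s₂ * totalDeg ![x0, x1]).negOnePow •
        μ ![(totalDeg ![x0, x1] + s₁, ν₁ ![x0, x1]), (totalDeg ![x2] + s₂, ν₂ ![x2])] :=
  comp2_apply μ ν₁ ν₂ (by refine ⟨?_, ?_⟩ <;> (intro j; fin_cases j <;> rfl))

@[simp] theorem comp_three_one (μ : Op L' L'' 2 r) (ν₁ : Op L L' 3 s₁) (ν₂ : Op L L' 1 s₂) :
    μ.comp2 ν₁ ν₂ ![x0, x1, x2, x3] =
      (s₂ * totalDeg ![x0, x1, x2]).negOnePow •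
        μ ![(totalDeg ![x0, x1, x2] + s₁, ν₁ ![x0, x1, x2]), (totalDeg ![x3] + s₂, ν₂ ![x3])] :=
  comp2_apply μ ν₁ ν₂ (by refine ⟨?_, ?_⟩ <;> (intro j; fin_cases j <;> rfl))

@[simp] theorem comp_one_three (μ : Op L' L'' 2 r) (ν₁ : Op L L' 1 s₁) (ν₂ : Op L L' 3 s₂) :
    μ.comp2 ν₁ ν₂ ![x0, x1, x2, x3] =
      (s₂ * totalDeg ![x0]).negOnePow •
        μ ![(totalDeg ![x0] + s₁, ν₁ ![x0]), (totalDeg ![x1, x2, x3] + s₂, ν₂ ![x1, x2, x3])] :=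
  comp2_apply μ ν₁ ν₂ (by refine ⟨?_, ?_⟩ <;> (intro j; fin_cases j <;> rfl))

@[simp] theorem comp_two_two (μ : Op L' L'' 2 r) (ν₁ : Op L L' 2 s₁) (ν₂ : Op L L' 2 s₂) :
    μ.comp2 ν₁ ν₂ ![x0, x1, x2, x3] =
      (s₂ * totalDeg ![x0, x1]).negOnePow •
        μ ![(totalDeg ![x0, x1] + s₁, ν₁ ![x0, x1]), (totalDeg ![x2, x3] + s₂, ν₂ ![x2, x3])] :=
  comp2_apply μ ν₁ ν₂ (by refine ⟨?_, ?_⟩ <;> (intro j; fin_cases j <;> rfl))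

@[simp] theorem comp_two_one_one (μ : Op L' L'' 3 r) (ν₁ : Op L L' 2 s₁) (ν₂ : Op L L' 1 s₂)
    (ν₃ : Op L L' 1 s₃) :
    μ.comp3 ν₁ ν₂ ν₃ ![x0, x1, x2, x3] =
      (s₂ * totalDeg ![x0, x1] + s₃ * (totalDeg ![x0, x1] + totalDeg ![x2])).negOnePow •
        μ ![(totalDeg ![x0, x1] + s₁, ν₁ ![x0, x1]), (totalDeg ![x2] + s₂, ν₂ ![x2]),
        (totalDeg ![x3] + s₃, ν₃ ![x3])] :=
  comp3_apply μ ν₁ ν₂ ν₃ (by refine ⟨?_, ?_, ?_⟩ <;> (intro j; fin_cases j <;> rfl))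

@[simp] theorem comp_one_two_one (μ : Op L' L'' 3 r) (ν₁ : Op L L' 1 s₁) (ν₂ : Op L L' 2 s₂)
    (ν₃ : Op L L' 1 s₃) :
    μ.comp3 ν₁ ν₂ ν₃ ![x0, x1, x2, x3] =
      (s₂ * totalDeg ![x0] + s₃ * (totalDeg ![x0] + totalDeg ![x1, x2])).negOnePow •
        μ ![(totalDeg ![x0] + s₁, ν₁ ![x0]), (totalDeg ![x1, x2] + s₂, ν₂ ![x1, x2]),
        (totalDeg ![x3] + s₃, ν₃ ![x3])] :=
  comp3_apply μ ν₁ ν₂ ν₃ (by refine ⟨?_, ?_, ?_⟩ <;> (intro j; fin_cases j <;> rfl))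

@[simp] theorem comp_one_one_two (μ : Op L' L'' 3 r) (ν₁ : Op L L' 1 s₁) (ν₂ : Op L L' 1 s₂)
    (ν₃ : Op L L' 2 s₃) :
    μ.comp3 ν₁ ν₂ ν₃ ![x0, x1, x2, x3] =
      (s₂ * totalDeg ![x0] + s₃ * (totalDeg ![x0] + totalDeg ![x1])).negOnePow •
        μ ![(totalDeg ![x0] + s₁, ν₁ ![x0]), (totalDeg ![x1] + s₂, ν₂ ![x1]),
        (totalDeg ![x2, x3] + s₃, ν₃ ![x2, x3])] :=
  comp3_apply μ ν₁ ν₂ ν₃ (by refine ⟨?_, ?_, ?_⟩ <;> (intro j; fin_cases j <;> rfl))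

end comp

end Op

section update

variable {α : Type*} {n : ℕ} (x y : α) (v : Fin n → α)

theorem update_vecCons_zero : Function.update (Matrix.vecCons x v) 0 y = Matrix.vecCons y v :=
  Fin.update_cons_zero (α := fun _ => α) x v y

theorem update_vecCons_succ (j : Fin n) : Function.update (Matrix.vecCons x v) j.succ y =
    Matrix.vecCons x (Function.update v j y) :=
  (Fin.cons_update (α := fun _ => α) x v j y).symm

end update

namespace ThreeTermComplex

variable {k : Type*} [CommRing k] {L L' : Type*} [AddCommGroup L] [Module k L]
  [AddCommGroup L'] [Module k L'] (C : ThreeTermComplex k L) (C' : ThreeTermComplex k L') {r : ℤ}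
  (x0 x1 x2 x3 : ℤ × L)

@[simp] theorem bdry_two (μ : Op L L' 2 r) :
    C.bdry C' μ ![x0, x1] = C'.d (μ ![x0, x1]) -
      r.negOnePow • (μ ![(x0.1 - 1, C.d x0.2), x1] +
        x0.1.negOnePow • μ ![x0, (x1.1 - 1, C.d x1.2)]) := by
  simp [bdry, Fin.sum_univ_succ, update_vecCons_zero, update_vecCons_succ]

@[simp] theorem bdry_three (μ : Op L L' 3 r) :
    C.bdry C' μ ![x0, x1, x2] = C'.d (μ ![x0, x1, x2]) -
      r.negOnePow • (μ ![(x0.1 - 1, C.d x0.2), x1, x2] +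
        x0.1.negOnePow • μ ![x0, (x1.1 - 1, C.d x1.2), x2] +
        (x0.1 + x1.1).negOnePow • μ ![x0, x1, (x2.1 - 1, C.d x2.2)]) := by
  simp [bdry, Fin.sum_univ_succ, update_vecCons_zero, update_vecCons_succ, add_assoc]

@[simp] theorem bdry_four (μ : Op L L' 4 r) :
    C.bdry C' μ ![x0, x1, x2, x3] = C'.d (μ ![x0, x1, x2, x3]) -
      r.negOnePow • (μ ![(x0.1 - 1, C.d x0.2), x1, x2, x3] +
        x0.1.negOnePow • μ ![x0, (x1.1 - 1, C.d x1.2), x2, x3] +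
        (x0.1 + x1.1).negOnePow • μ ![x0, x1, (x2.1 - 1, C.d x2.2), x3] +
        (x0.1 + x1.1 + x2.1).negOnePow • μ ![x0, x1, x2, (x3.1 - 1, C.d x3.2)]) := by
  simp [bdry, Fin.sum_univ_succ, update_vecCons_zero, update_vecCons_succ, add_assoc]

end ThreeTermComplex

/-! ### From a weak Lie 3-algebra to its homogeneous components -/

/-- A known relation and the desired one usually differ by a rearrangement of terms. Comparing the
two defects leaves a goal in which no relation has to be applied, only terms collected. -/
theorem eq_of_sub_eq_sub {G : Type*} [AddCommGroup G] {a b c d : G} (h : c = d)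
    (e : a - b = c - d) : a = b :=
  sub_eq_zero.1 (e.trans (sub_eq_zero.2 h))

section restrict

variable {k : Type*} [CommRing k] {M : Type*} [AddCommGroup M] [Module k M]
  {p q r s t : Submodule k M}

/-- The restriction of a bilinear map to submodules. -/
def LinearMap.restrictTwo (f : M →ₗ[k] M →ₗ[k] M)
    (hf : ∀ (x : p) (y : q), f x y ∈ r) : p →ₗ[k] q →ₗ[k] r :=
  LinearMap.mk₂ k (fun x y => ⟨f x y, hf x y⟩) (fun _ _ _ => Subtype.ext (by simp))
    (fun _ _ _ => Subtype.ext (by simp)) (fun _ _ _ => Subtype.ext (by simp))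
    (fun _ _ _ => Subtype.ext (by simp))

@[simp]
theorem LinearMap.coe_restrictTwo (f : M →ₗ[k] M →ₗ[k] M) (hf : ∀ (x : p) (y : q), f x y ∈ r)
    (x : p) (y : q) : (f.restrictTwo hf x y : M) = f x y :=
  rfl

/-- The restriction of a trilinear map to submodules. -/
def LinearMap.restrictThree (f : M →ₗ[k] M →ₗ[k] M →ₗ[k] M)
    (hf : ∀ (x : p) (y : q) (z : r), f x y z ∈ s) : p →ₗ[k] q →ₗ[k] r →ₗ[k] s where
  toFun x := (f x).restrictTwo (hf x)
  map_add' _ _ := by ext; simp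
  map_smul' _ _ := by ext; simp

@[simp]
theorem LinearMap.coe_restrictThree (f : M →ₗ[k] M →ₗ[k] M →ₗ[k] M)
    (hf : ∀ (x : p) (y : q) (z : r), f x y z ∈ s) (x : p) (y : q) (z : r) :
    (f.restrictThree hf x y z : M) = f x y z :=
  rfl

/-- The restriction of a quadrilinear map to submodules. -/
def LinearMap.restrictFour (f : M →ₗ[k] M →ₗ[k] M →ₗ[k] M →ₗ[k] M)
    (hf : ∀ (x : p) (y : q) (z : r) (w : s), f x y z w ∈ t) :
    p →ₗ[k] q →ₗ[k] r →ₗ[k] s →ₗ[k] t where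
  toFun x := (f x).restrictThree (hf x)
  map_add' _ _ := by ext; simp
  map_smul' _ _ := by ext; simp

@[simp]
theorem LinearMap.coe_restrictFour (f : M →ₗ[k] M →ₗ[k] M →ₗ[k] M →ₗ[k] M)
    (hf : ∀ (x : p) (y : q) (z : r) (w : s), f x y z w ∈ t) (x : p) (y : q) (z : r) (w : s) :
    (f.restrictFour hf x y z w : M) = f x y z w :=
  rfl

end restrict

namespace Op

variable {k : Type*} [CommRing k] {L L' : Type*} [AddCommGroup L] [Module k L] [AddCommGroup L']
  [Module k L'] {C : ThreeTermComplex k L} {C' : ThreeTermComplex k L'} {r : ℤ}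

theorem tame_lin1 {f : L →ₗ[k] L'} (hf : C.HasDegree C' (lin1 r f)) : C.Tame C' (lin1 r f) :=
  ⟨hf, fun x j hj => by fin_cases j; simp_all [lin1]⟩

theorem tame_lin2 {f : L →ₗ[k] L →ₗ[k] L'} (hf : C.HasDegree C' (lin2 r f)) :
    C.Tame C' (lin2 r f) :=
  ⟨hf, fun x j hj => by fin_cases j <;> simp_all [lin2]⟩

theorem tame_lin3 {f : L →ₗ[k] L →ₗ[k] L →ₗ[k] L'} (hf : C.HasDegree C' (lin3 r f)) :
    C.Tame C' (lin3 r f) :=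
  ⟨hf, fun x j hj => by fin_cases j <;> simp_all [lin3]⟩

theorem tame_lin4 {f : L →ₗ[k] L →ₗ[k] L →ₗ[k] L →ₗ[k] L'} (hf : C.HasDegree C' (lin4 r f)) :
    C.Tame C' (lin4 r f) :=
  ⟨hf, fun x j hj => by fin_cases j <;> simp_all [lin4]⟩

theorem lin2_mem {f : L →ₗ[k] L →ₗ[k] L'} (hf : C.HasDegree C' (lin2 r f)) {a b c : ℤ}
    (h : a + b + r = c) (x : C.gr a) (y : C.gr b) : f x y ∈ C'.gr c := by
  simpa [← h, lin2, totalDeg] using hf _ (C.homog_two x y)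

theorem lin3_mem {f : L →ₗ[k] L →ₗ[k] L →ₗ[k] L'} (hf : C.HasDegree C' (lin3 r f))
    {a b c e : ℤ} (h : a + b + c + r = e) (x : C.gr a) (y : C.gr b) (z : C.gr c) :
    f x y z ∈ C'.gr e := by
  simpa [← h, lin3, totalDeg, Fin.sum_univ_three] using hf _ (C.homog_three x y z)

theorem lin4_mem {f : L →ₗ[k] L →ₗ[k] L →ₗ[k] L →ₗ[k] L'} (hf : C.HasDegree C' (lin4 r f))
    {a b c e g : ℤ} (h : a + b + c + e + r = g) (x : C.gr a) (y : C.gr b) (z : C.gr c)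
    (w : C.gr e) : f x y z w ∈ C'.gr g := by
  simpa [← h, lin4, totalDeg, Fin.sum_univ_four] using hf _ (C.homog_four x y z w)

theorem lin2_eq_zero {f : L →ₗ[k] L →ₗ[k] L'} (hf : C.HasDegree C' (lin2 r f)) {a b : ℤ}
    (x : C.gr a) (y : C.gr b) (h : 2 < a + b + r) : f x y = 0 :=
  C'.eq_zero_of_mem (lin2_mem hf rfl x y) (.inr h)

theorem lin3_eq_zero {f : L →ₗ[k] L →ₗ[k] L →ₗ[k] L'} (hf : C.HasDegree C' (lin3 r f))
    {a b c : ℤ} (x : C.gr a) (y : C.gr b) (z : C.gr c) (h : 2 < a + b + c + r) : f x y z = 0 :=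
  C'.eq_zero_of_mem (lin3_mem hf rfl x y z) (.inr h)

theorem lin4_eq_zero {f : L →ₗ[k] L →ₗ[k] L →ₗ[k] L →ₗ[k] L'} (hf : C.HasDegree C' (lin4 r f))
    {a b c e : ℤ} (x : C.gr a) (y : C.gr b) (z : C.gr c) (w : C.gr e)
    (h : 2 < a + b + c + e + r) : f x y z w = 0 :=
  C'.eq_zero_of_mem (lin4_mem hf rfl x y z w) (.inr h)

end Op

namespace Lie3Maps

variable {k : Type*} [CommRing k] {L : Type*} [AddCommGroup L] [Module k L] (A : Lie3Maps k L)

@[simp] theorem o2_apply (x y : ℤ × L) : A.o2 ![x, y] = A.l2 x.2 y.2 := rfl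
@[simp] theorem o21_apply (x y : ℤ × L) : A.o21 ![x, y] = A.l21 x.2 y.2 := rfl
@[simp] theorem o211_apply (x y : ℤ × L) : A.o211 ![x, y] = A.l211 x.2 y.2 := rfl
@[simp] theorem o3_apply (x y z : ℤ × L) : A.o3 ![x, y, z] = A.l3 x.2 y.2 z.2 := rfl
@[simp] theorem o31_apply (x y z : ℤ × L) : A.o31 ![x, y, z] = A.l31 x.2 y.2 z.2 := rfl
@[simp] theorem o32_apply (x y z : ℤ × L) : A.o32 ![x, y, z] = A.l32 x.2 y.2 z.2 := rfl
@[simp] theorem o4_apply (x y z w : ℤ × L) : A.o4 ![x, y, z, w] = A.l4 x.2 y.2 z.2 w.2 := rfl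

end Lie3Maps

namespace ThreeTermComplex

variable {k : Type*} [CommRing k] {L : Type*} [AddCommGroup L] [Module k L]
  (C : ThreeTermComplex k L)

variable {C} in
theorem ext_of_eq {n : ℤ} {u v : C.gr n} {c d : L} (h : c = d) (e : (u : L) - v = c - d) : u = v :=
  Subtype.ext (eq_of_sub_eq_sub h e)

@[simp] theorem d_eq_zero (x : C.gr 0) : C.d x = 0 :=
  C.eq_zero_of_mem (C.d_mem 0 x x.2) (by norm_num)

end ThreeTermComplex

namespace DeformationRetract

open Op ThreeTermComplex

variable {k : Type*} [CommRing k] {L L' : Type*} [AddCommGroup L] [Module k L]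
  [AddCommGroup L'] [Module k L'] {C : ThreeTermComplex k L} {C' : ThreeTermComplex k L'}
  (R : DeformationRetract C C') {A : Lie3Maps k L}

set_option maxHeartbeats 1000000 in
/-- The homogeneous components of a weak Lie `3`-algebra and of the homotopy of a deformation
retract of the underlying complex. -/
def components (hA : A.IsWeakLie3 C) : Lie3Components k (C.gr 0) (C.gr 1) (C.gr 2) where
  d1 := C.d.restrict fun x hx => by simpa using C.d_mem 1 x hx
  d2 := C.d.restrict fun x hx => by simpa using C.d_mem 2 x hx
  h0 := R.h.restrict fun x hx => by simpa using R.h_mem 0 x hx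
  h1 := R.h.restrict fun x hx => by simpa using R.h_mem 1 x hx
  l2_00 := A.l2.restrictTwo (lin2_mem hA.deg2 (by norm_num))
  l2_01 := A.l2.restrictTwo (lin2_mem hA.deg2 (by norm_num))
  l2_02 := A.l2.restrictTwo (lin2_mem hA.deg2 (by norm_num))
  l2_10 := A.l2.restrictTwo (lin2_mem hA.deg2 (by norm_num))
  l2_11 := A.l2.restrictTwo (lin2_mem hA.deg2 (by norm_num))
  l2_20 := A.l2.restrictTwo (lin2_mem hA.deg2 (by norm_num))
  l21_00 := A.l21.restrictTwo (lin2_mem hA.deg21 (by norm_num))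
  l21_01 := A.l21.restrictTwo (lin2_mem hA.deg21 (by norm_num))
  l21_10 := A.l21.restrictTwo (lin2_mem hA.deg21 (by norm_num))
  l211 := A.l211.restrictTwo (lin2_mem hA.deg211 (by norm_num))
  l3_000 := A.l3.restrictThree (lin3_mem hA.deg3 (by norm_num))
  l3_001 := A.l3.restrictThree (lin3_mem hA.deg3 (by norm_num))
  l3_010 := A.l3.restrictThree (lin3_mem hA.deg3 (by norm_num))
  l3_100 := A.l3.restrictThree (lin3_mem hA.deg3 (by norm_num))
  l31 := A.l31.restrictThree (lin3_mem hA.deg31 (by norm_num))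
  l32 := A.l32.restrictThree (lin3_mem hA.deg32 (by norm_num))
  l4 := A.l4.restrictFour (lin4_mem hA.deg4 (by norm_num))
  d_d x := Subtype.ext (C.d_d x)
  -- In `∂μ = d ∘ μ - (-1)^|μ| μ ∘ d` an operation of even degree contributes `μ ∘ d` with a minus
  -- sign, so rules solving for `μ ∘ d` take the axiom reversed. For odd degree they take it as it
  -- stands. The facts `lin2_eq_zero`, `lin3_eq_zero` and `lin4_eq_zero` remove values above degree
  -- `2`.
  l2_d_01 x y := ext_of_eq (hA.eq2 _ (homog_two x y)).symm (by simp)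
  l2_d_02 x y := ext_of_eq (hA.eq2 _ (homog_two x y)).symm (by simp)
  l2_d_10 x y := ext_of_eq (hA.eq2 _ (homog_two x y)).symm (by simp)
  l2_d_11 x y := ext_of_eq (hA.eq2 _ (homog_two x y)).symm (by simp; abel)
  l2_d_12 x y := ext_of_eq (hA.eq2 _ (homog_two x y)).symm (by simp [lin2_eq_zero hA.deg2]; abel)
  l2_d_20 x y := ext_of_eq (hA.eq2 _ (homog_two x y)).symm (by simp)
  l2_d_21 x y := ext_of_eq (hA.eq2 _ (homog_two x y)).symm (by simp [lin2_eq_zero hA.deg2])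
  d_l3_000 x y z := ext_of_eq (hA.eq3 _ (homog_three x y z)) (by simp)
  l3_d_001 x y z := ext_of_eq (hA.eq3 _ (homog_three x y z)) (by simp; abel)
  l3_d_002 x y z := ext_of_eq (hA.eq3 _ (homog_three x y z))
    (by simp [lin3_eq_zero hA.deg3])
  l3_d_010 x y z := ext_of_eq (hA.eq3 _ (homog_three x y z)) (by simp; abel)
  l3_d_011 x y z := ext_of_eq (hA.eq3 _ (homog_three x y z))
    (by simp [lin3_eq_zero hA.deg3]; abel)
  l3_d_020 x y z := ext_of_eq (hA.eq3 _ (homog_three x y z))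
    (by simp [lin3_eq_zero hA.deg3])
  l3_d_100 x y z := ext_of_eq (hA.eq3 _ (homog_three x y z)) (by simp; abel)
  l3_d_101 x y z := ext_of_eq (hA.eq3 _ (homog_three x y z))
    (by simp [lin3_eq_zero hA.deg3]; abel)
  l3_d_110 x y z := ext_of_eq (hA.eq3 _ (homog_three x y z))
    (by simp [lin3_eq_zero hA.deg3]; abel)
  l3_d_200 x y z := ext_of_eq (hA.eq3 _ (homog_three x y z))
    (by simp [lin3_eq_zero hA.deg3])
  d_l4 x y z w := ext_of_eq (hA.eq4 _ (homog_four x y z w)) (by simp)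
  l4_d_0001 x y z w := ext_of_eq (hA.eq4 _ (homog_four x y z w)).symm
    (by simp [lin4_eq_zero hA.deg4]; abel)
  l4_d_0010 x y z w := ext_of_eq (hA.eq4 _ (homog_four x y z w)).symm
    (by simp [lin4_eq_zero hA.deg4]; abel)
  l4_d_0100 x y z w := ext_of_eq (hA.eq4 _ (homog_four x y z w)).symm
    (by simp [lin4_eq_zero hA.deg4]; abel)
  l4_d_1000 x y z w := ext_of_eq (hA.eq4 _ (homog_four x y z w)).symm
    (by simp [lin4_eq_zero hA.deg4]; abel)
  d_l21_00 x y := ext_of_eq (hA.eq21 _ (homog_two x y)) (by simp)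
  l21_d_01 x y := ext_of_eq (hA.eq21 _ (homog_two x y)) (by simp; abel)
  l21_d_02 x y := ext_of_eq (hA.eq21 _ (homog_two x y)) (by simp [lin2_eq_zero hA.deg21])
  l21_d_10 x y := ext_of_eq (hA.eq21 _ (homog_two x y)) (by simp; abel)
  l21_d_11 x y := ext_of_eq (hA.eq21 _ (homog_two x y)) (by simp [lin2_eq_zero hA.deg21]; abel)
  l21_d_20 x y := ext_of_eq (hA.eq21 _ (homog_two x y)) (by simp [lin2_eq_zero hA.deg21])
  d_l211 x y := ext_of_eq (hA.eq211 _ (homog_two x y)) (by simp)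
  l211_d_01 x y := ext_of_eq (hA.eq211 _ (homog_two x y)).symm
    (by simp [lin2_eq_zero hA.deg211]; abel)
  l211_d_10 x y := ext_of_eq (hA.eq211 _ (homog_two x y)).symm
    (by simp [lin2_eq_zero hA.deg211]; abel)
  d_l31 x y z := ext_of_eq (hA.eq31 _ (homog_three x y z)) (by simp)
  l31_d_001 x y z := ext_of_eq (hA.eq31 _ (homog_three x y z)).symm
    (by simp [lin3_eq_zero hA.deg31]; abel)
  l31_d_010 x y z := ext_of_eq (hA.eq31 _ (homog_three x y z)).symm
    (by simp [lin3_eq_zero hA.deg31]; abel)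
  l31_d_100 x y z := ext_of_eq (hA.eq31 _ (homog_three x y z)).symm
    (by simp [lin3_eq_zero hA.deg31]; abel)
  d_l32 x y z := ext_of_eq (hA.eq32 _ (homog_three x y z)) (by simp)
  l32_d_001 x y z := ext_of_eq (hA.eq32 _ (homog_three x y z)).symm
    (by simp [lin3_eq_zero hA.deg32]; abel)
  l32_d_010 x y z := ext_of_eq (hA.eq32 _ (homog_three x y z)).symm
    (by simp [lin3_eq_zero hA.deg32]; abel)
  l32_d_100 x y z := ext_of_eq (hA.eq32 _ (homog_three x y z)).symm
    (by simp [lin3_eq_zero hA.deg32]; abel)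
  sym_2111 x y := ext_of_eq (hA.eq2111 _ (homog_two x y)) (by simp)
  sym_311 x y z := ext_of_eq (hA.eq311 _ (homog_three x y z)) (by simp)
  sym_312 x y z := ext_of_eq (hA.eq312 _ (homog_three x y z)) (by simp; abel)
  sym_322 x y z := ext_of_eq (hA.eq322 _ (homog_three x y z)) (by simp)
  sym_41 x y z w := ext_of_eq (hA.eq41 _ (homog_four x y z w)) (by simp)
  sym_42 x y z w := ext_of_eq (hA.eq42 _ (homog_four x y z w)) (by simp)
  sym_43 x y z w := ext_of_eq (hA.eq43 _ (homog_four x y z w)) (by simp)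
  sym_5 x y z w v := ext_of_eq (hA.eq5 _ (homog_five x y z w v)).symm (by simp)

end DeformationRetract

/-! ### The tree operations as globally multilinear maps -/

namespace LinearMap

variable {k : Type*} [CommRing k] {M M' N N' : Type*} [AddCommGroup M] [Module k M]
  [AddCommGroup M'] [Module k M'] [AddCommGroup N] [Module k N] [AddCommGroup N'] [Module k N']

/-- A trilinear map from a function that is linear in every argument. -/
def mkThree (f : M → M → M → N) (h₁ : ∀ y z, IsLinearMap k fun x => f x y z)
    (h₂ : ∀ x z, IsLinearMap k fun y => f x y z) (h₃ : ∀ x y, IsLinearMap k fun z => f x y z) :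
    M →ₗ[k] M →ₗ[k] M →ₗ[k] N where
  toFun x := LinearMap.mk₂ k (f x) (fun y y' z => (h₂ x z).map_add y y')
    (fun c y z => (h₂ x z).map_smul c y) (fun y z z' => (h₃ x y).map_add z z')
    (fun c y z => (h₃ x y).map_smul c z)
  map_add' x x' := by ext y z; exact (h₁ y z).map_add x x'
  map_smul' c x := by ext y z; exact (h₁ y z).map_smul c x

@[simp]
theorem mkThree_apply (f : M → M → M → N) (h₁ : ∀ y z, IsLinearMap k fun x => f x y z)
    (h₂ : ∀ x z, IsLinearMap k fun y => f x y z) (h₃ : ∀ x y, IsLinearMap k fun z => f x y z)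
    (x y z : M) : mkThree f h₁ h₂ h₃ x y z = f x y z :=
  rfl

/-- A quadrilinear map from a function that is linear in every argument. -/
def mkFour (f : M → M → M → M → N) (h₁ : ∀ y z w, IsLinearMap k fun x => f x y z w)
    (h₂ : ∀ x z w, IsLinearMap k fun y => f x y z w)
    (h₃ : ∀ x y w, IsLinearMap k fun z => f x y z w)
    (h₄ : ∀ x y z, IsLinearMap k fun w => f x y z w) :
    M →ₗ[k] M →ₗ[k] M →ₗ[k] M →ₗ[k] N where
  toFun x := mkThree (f x) (h₂ x) (h₃ x) (h₄ x)
  map_add' x x' := by ext y z w; exact (h₁ y z w).map_add x x'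
  map_smul' c x := by ext y z w; exact (h₁ y z w).map_smul c x

@[simp]
theorem mkFour_apply (f : M → M → M → M → N) (h₁ : ∀ y z w, IsLinearMap k fun x => f x y z w)
    (h₂ : ∀ x z w, IsLinearMap k fun y => f x y z w)
    (h₃ : ∀ x y w, IsLinearMap k fun z => f x y z w)
    (h₄ : ∀ x y z, IsLinearMap k fun w => f x y z w) (x y z w : M) :
    mkFour f h₁ h₂ h₃ h₄ x y z w = f x y z w :=
  rfl

/-- The map `F ↦ Φ ∘ F ∘ i`. -/
def sandwich (Φ : N →ₗ[k] N') (i : M' →ₗ[k] M) : (M →ₗ[k] N) →ₗ[k] (M' →ₗ[k] N') where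
  toFun F := Φ ∘ₗ F ∘ₗ i
  map_add' _ _ := by ext; simp
  map_smul' _ _ := by ext; simp

@[simp]
theorem sandwich_apply (Φ : N →ₗ[k] N') (i : M' →ₗ[k] M) (F : M →ₗ[k] N) (x : M') :
    sandwich Φ i F x = Φ (F (i x)) :=
  rfl

end LinearMap

namespace ThreeTermComplex

variable {k : Type*} [CommRing k] {L : Type*} [AddCommGroup L] [Module k L]
  (C : ThreeTermComplex k L)

/-- The map that is multiplication by `c n` on the component of degree `n`. -/
noncomputable def rescale (c : ℤ → ℤ) : L →ₗ[k] L :=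
  DirectSum.toModule k ℤ L (fun n => c n • (C.gr n).subtype) ∘ₗ
    (LinearEquiv.ofBijective (DirectSum.coeLinearMap C.gr) C.isInternal).symm.toLinearMap

theorem rescale_apply (c : ℤ → ℤ) {n : ℤ} (x : C.gr n) : C.rescale c x = c n • (x : L) := by
  have : (LinearEquiv.ofBijective (DirectSum.coeLinearMap C.gr) C.isInternal).symm x =
      DirectSum.lof k ℤ (fun n => C.gr n) n x := by
    rw [LinearEquiv.symm_apply_eq]
    exact (DirectSum.coeLinearMap_lof C.gr n x).symm
  rw [rescale, LinearMap.comp_apply, LinearEquiv.coe_coe, this, DirectSum.toModule_lof]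
  rfl

/-- The involution `x ↦ (-1)^|x| x`. -/
noncomputable def signInvolution : L →ₗ[k] L := C.rescale fun n => n.negOnePow

theorem signInvolution_apply {n : ℤ} (x : C.gr n) :
    C.signInvolution x = n.negOnePow • (x : L) :=
  C.rescale_apply _ x

/-- The projection to the component of degree `0`. -/
noncomputable def projZero : L →ₗ[k] L := C.rescale fun n => if n = 0 then 1 else 0

theorem projZero_apply (x : C.gr 0) : C.projZero x = x := by
  simp [projZero, rescale_apply]

theorem projZero_eq_zero {n : ℤ} (hn : n ≠ 0) {x : L} (hx : x ∈ C.gr n) : C.projZero x = 0 := by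
  simpa [projZero, hn] using C.rescale_apply (fun n => if n = 0 then 1 else 0) ⟨x, hx⟩

end ThreeTermComplex

namespace DeformationRetract

open Op ThreeTermComplex

variable {k : Type*} [CommRing k] {L L' : Type*} [AddCommGroup L] [Module k L]
  [AddCommGroup L'] [Module k L'] {C : ThreeTermComplex k L} {C' : ThreeTermComplex k L'}
  (R : DeformationRetract C C') (A : Lie3Maps k L)

/-- The multilinear maps on `L` that give the operations `t` on homogeneous arguments. -/
noncomputable def perturbed : Lie3Maps k L where
  l2 := A.l2
  l21 := A.l21
  l211 := A.l211
  -- The sign of moving `h ∘ λ₂` past an argument depends on a degree, so it is absorbed into the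
  -- linear map `signInvolution`. The sign `(-1)^(|x| |y|)` of the transposition may be omitted: it
  -- is nontrivial only when both degrees are odd, and then the value lies above degree `2` and
  -- vanishes.
  l3 := LinearMap.mkThree
    (fun x y z => A.l3 x y z + A.l2 (R.h (A.l2 x y)) z
      - A.l2 (C.signInvolution x) (R.h (A.l2 y z)) + A.l2 (C.signInvolution y) (R.h (A.l2 x z)))
    (fun _ _ => ⟨fun _ _ => by simp; abel, fun _ _ => by simp [smul_add, smul_sub]⟩)
    (fun _ _ => ⟨fun _ _ => by simp; abel, fun _ _ => by simp [smul_add, smul_sub]⟩)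
    (fun _ _ => ⟨fun _ _ => by simp; abel, fun _ _ => by simp [smul_add, smul_sub]⟩)
  -- The operations `l31`, `l32`, `l4` have degree `2` and live on arguments of degree `0`.
  -- Projecting every argument to degree `0` makes the formulas without signs correct in all
  -- degrees.
  l31 := .sandwich (.sandwich (.sandwich .id C.projZero) C.projZero) C.projZero <|
    LinearMap.mkThree (fun x y z => A.l31 x y z - A.l2 (R.h (A.l21 x y)) z)
    (fun _ _ => ⟨fun _ _ => by simp; abel, fun _ _ => by simp [smul_sub]⟩)
    (fun _ _ => ⟨fun _ _ => by simp; abel, fun _ _ => by simp [smul_sub]⟩)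
    (fun _ _ => ⟨fun _ _ => by simp; abel, fun _ _ => by simp [smul_sub]⟩)
  l32 := .sandwich (.sandwich (.sandwich .id C.projZero) C.projZero) C.projZero <|
    LinearMap.mkThree
    (fun x y z => A.l32 x y z + A.l21 (R.h (A.l2 x y)) z + A.l2 x (R.h (A.l21 y z))
      + A.l21 y (R.h (A.l2 x z)))
    (fun _ _ => ⟨fun _ _ => by simp; abel, fun _ _ => by simp [smul_add]⟩)
    (fun _ _ => ⟨fun _ _ => by simp; abel, fun _ _ => by simp [smul_add]⟩)
    (fun _ _ => ⟨fun _ _ => by simp; abel, fun _ _ => by simp [smul_add]⟩)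
  l4 := .sandwich (.sandwich (.sandwich (.sandwich .id C.projZero) C.projZero) C.projZero)
    C.projZero <|
    LinearMap.mkFour
    (fun x y z w => A.l4 x y z w
      - A.l2 (R.h (A.l3 x y z)) w - A.l2 x (R.h (A.l3 y z w)) + A.l2 y (R.h (A.l3 x z w))
      - A.l2 z (R.h (A.l3 x y w)) - A.l3 (R.h (A.l2 x y)) z w + A.l3 x (R.h (A.l2 y z)) w
      - A.l3 y (R.h (A.l2 x z)) w - A.l3 x y (R.h (A.l2 z w)) + A.l3 x z (R.h (A.l2 y w))
      - A.l3 y z (R.h (A.l2 x w)) - A.l2 (R.h (A.l2 (R.h (A.l2 x y)) z)) w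
      + A.l2 (R.h (A.l2 x (R.h (A.l2 y z)))) w - A.l2 (R.h (A.l2 y (R.h (A.l2 x z)))) w
      - A.l2 (R.h (A.l2 x y)) (R.h (A.l2 z w)) + A.l2 (R.h (A.l2 x z)) (R.h (A.l2 y w))
      - A.l2 (R.h (A.l2 y z)) (R.h (A.l2 x w)) - A.l2 x (R.h (A.l2 (R.h (A.l2 y z)) w))
      + A.l2 y (R.h (A.l2 (R.h (A.l2 x z)) w)) - A.l2 z (R.h (A.l2 (R.h (A.l2 x y)) w))
      + A.l2 x (R.h (A.l2 y (R.h (A.l2 z w)))) - A.l2 y (R.h (A.l2 x (R.h (A.l2 z w))))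
      + A.l2 z (R.h (A.l2 x (R.h (A.l2 y w)))) - A.l2 x (R.h (A.l2 z (R.h (A.l2 y w))))
      + A.l2 y (R.h (A.l2 z (R.h (A.l2 x w)))) - A.l2 z (R.h (A.l2 y (R.h (A.l2 x w)))))
    (fun _ _ _ => ⟨fun _ _ => by simp; abel, fun _ _ => by simp [smul_add, smul_sub]⟩)
    (fun _ _ _ => ⟨fun _ _ => by simp; abel, fun _ _ => by simp [smul_add, smul_sub]⟩)
    (fun _ _ _ => ⟨fun _ _ => by simp; abel, fun _ _ => by simp [smul_add, smul_sub]⟩)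
    (fun _ _ _ => ⟨fun _ _ => by simp; abel, fun _ _ => by simp [smul_add, smul_sub]⟩)

/-- The transferred structure maps. -/
noncomputable def transferred : Lie3Maps k L' where
  l2 := .sandwich (.sandwich R.p R.i) R.i A.l2
  l21 := .sandwich (.sandwich R.p R.i) R.i A.l21
  l211 := .sandwich (.sandwich R.p R.i) R.i A.l211
  l3 := .sandwich (.sandwich (.sandwich R.p R.i) R.i) R.i (R.perturbed A).l3
  l31 := .sandwich (.sandwich (.sandwich R.p R.i) R.i) R.i (R.perturbed A).l31
  l32 := .sandwich (.sandwich (.sandwich R.p R.i) R.i) R.i (R.perturbed A).l32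
  l4 := .sandwich (.sandwich (.sandwich (.sandwich R.p R.i) R.i) R.i) R.i (R.perturbed A).l4

/-- The components of the extension of the inclusion. -/
noncomputable def inclusion : Lie3MorMaps k L' L where
  f1 := R.i
  f2 := .sandwich (.sandwich (-R.h) R.i) R.i A.l2
  f3 := .sandwich (.sandwich (.sandwich (-R.h) R.i) R.i) R.i (R.perturbed A).l3
  f21 := .sandwich (.sandwich (-R.h) R.i) R.i A.l21

attribute [local simp] projZero_apply signInvolution_apply d_eq_zero

@[simp] theorem h2_apply (x y : ℤ × L) : R.h2 A ![x, y] = R.h (A.l2 x.2 y.2) := rfl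
@[simp] theorem h21_apply (x y : ℤ × L) : R.h21 A ![x, y] = R.h (A.l21 x.2 y.2) := rfl
@[simp] theorem h3_apply (x y z : ℤ × L) : R.h3 A ![x, y, z] = R.h (A.l3 x.2 y.2 z.2) := rfl

theorem tame_post_h {n : ℕ} {r : ℤ} {μ : Op L L n r} (hμ : C.Tame C μ) :
    C.Tame C (μ.post 1 R.h) :=
  hμ.post R.h_mem (map_zero _)

variable {A}

theorem tame_t3 (hA : A.IsWeakLie3 C) : C.Tame C (R.t3 A) := by
  have h2 : C.Tame C A.o2 := tame_lin2 hA.deg2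
  have hh2 : C.Tame C (R.h2 A) := R.tame_post_h h2
  exact (tame_lin3 hA.deg3).add ((h2.circ hh2 0).sub ((h2.circ hh2 1).sub ((h2.circ hh2 1).cyc _)))

theorem tame_t31 (hA : A.IsWeakLie3 C) : C.Tame C (R.t31 A) := by
  have h2 : C.Tame C A.o2 := tame_lin2 hA.deg2
  have hh21 : C.Tame C (R.h21 A) := R.tame_post_h (tame_lin2 hA.deg21)
  exact (tame_lin3 hA.deg31).sub (h2.circ hh21 0)

theorem tame_t32 (hA : A.IsWeakLie3 C) : C.Tame C (R.t32 A) := by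
  have h2 : C.Tame C A.o2 := tame_lin2 hA.deg2
  have h21 : C.Tame C A.o21 := tame_lin2 hA.deg21
  have hh2 : C.Tame C (R.h2 A) := R.tame_post_h h2
  have hh21 : C.Tame C (R.h21 A) := R.tame_post_h h21
  exact (tame_lin3 hA.deg32).add
    (((h21.circ hh2 0).add (h2.circ hh21 1)).add ((h21.circ hh2 1).cyc _))

theorem tame_t4 (hA : A.IsWeakLie3 C) : C.Tame C (R.t4 A) := by
  have h2 : C.Tame C A.o2 := tame_lin2 hA.deg2
  have h3 : C.Tame C A.o3 := tame_lin3 hA.deg3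
  have hh2 : C.Tame C (R.h2 A) := R.tame_post_h h2
  have hh3 : C.Tame C (R.h3 A) := R.tame_post_h h3
  have c0 := h2.circ hh2 0
  have c1 := h2.circ hh2 1
  have cc := h2.comp2 hh2 hh2
  exact ((tame_lin4 hA.deg4).sub
    (((((h2.circ hh3 0).add (((h2.circ hh3 1).sub ((h2.circ hh3 1).cyc _)).add
      ((h2.circ hh3 1).cyc _))).add (h3.circ hh2 0)).sub
      ((h3.circ hh2 1).sub ((h3.circ hh2 1).cyc _))).add
      (((h3.circ hh2 2).sub ((h3.circ hh2 2).cyc _)).add ((h3.circ hh2 2).cyc _)))).sub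
    (((((c0.circ hh2 0).sub ((c0.circ hh2 1).sub ((c0.circ hh2 1).cyc _))).add
      ((cc.sub (cc.cyc _)).add (cc.cyc _))).add
      (((c1.circ hh2 1).sub ((c1.circ hh2 1).cyc _)).add ((c1.circ hh2 1).cyc _))).sub
      ((((((c1.circ hh2 2).sub ((c1.circ hh2 2).cyc _)).add ((c1.circ hh2 2).cyc _)).sub
        ((c1.circ hh2 2).cyc _)).add ((c1.circ hh2 2).cyc _)).sub ((c1.circ hh2 2).cyc _)))

theorem hasDegree_perturbed_o3 (hA : A.IsWeakLie3 C) : C.HasDegree C (R.perturbed A).o3 := by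
  intro x hx
  have hS : ∀ j, C.signInvolution (x j).2 ∈ C.gr (x j).1 := fun j => by
    rw [C.signInvolution_apply ⟨_, hx j⟩]
    exact C.units_smul_mem _ (hx j)
  have hh : ∀ i j, R.h (A.l2 (x i).2 (x j).2) ∈ C.gr ((x i).1 + (x j).1 + 0 + 1) := fun i j =>
    R.h_mem _ _ (lin2_mem hA.deg2 rfl ⟨_, hx i⟩ ⟨_, hx j⟩)
  have ht : totalDeg x = (x 0).1 + (x 1).1 + (x 2).1 := Fin.sum_univ_three _
  refine Submodule.add_mem _ (Submodule.sub_mem _ (Submodule.add_mem _ (hA.deg3 x hx)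
    (lin2_mem hA.deg2 ?_ ⟨_, hh 0 1⟩ ⟨_, hx 2⟩)) (lin2_mem hA.deg2 ?_ ⟨_, hS 0⟩ ⟨_, hh 1 2⟩))
    (lin2_mem hA.deg2 ?_ ⟨_, hS 1⟩ ⟨_, hh 0 2⟩)
  all_goals rw [ht]; ring

/-- Both sides vanish unless the arguments have total degree at most `1`, and in those four cases
the signs of the two formulas agree. -/
theorem perturbed_o3_eq (hA : A.IsWeakLie3 C) :
    ∀ x, C.Homog x → (R.perturbed A).o3 x = R.t3 A x := by
  refine (tame_lin3 (R.hasDegree_perturbed_o3 hA)).ext_three_of_degree_one (R.tame_t3 hA)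
    ?_ ?_ ?_ ?_
  all_goals
    intro x y z
    change (R.perturbed A).l3 x y z = _
    simp [t3, perturbed]
    abel

/-- A ternary operation that only sees the components of degree `0` of its arguments has degree
`2` if it does so on arguments of degree `0`. -/
theorem hasDegree_lin3_projZero {f : L →ₗ[k] L →ₗ[k] L →ₗ[k] L}
    (hf : ∀ x y z : C.gr 0, f x y z ∈ C.gr 2) :
    C.HasDegree C (lin3 2 (.sandwich (.sandwich (.sandwich .id C.projZero) C.projZero)
      C.projZero f)) := by
  intro x hx
  by_cases h : ∀ j, (x j).1 = 0
  · have hx' : ∀ j, (x j).2 ∈ C.gr 0 := fun j => h j ▸ hx j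
    have := hf ⟨_, hx' 0⟩ ⟨_, hx' 1⟩ ⟨_, hx' 2⟩
    simpa [lin3, totalDeg, h, C.projZero_apply ⟨_, hx' 0⟩, C.projZero_apply ⟨_, hx' 1⟩,
      C.projZero_apply ⟨_, hx' 2⟩] using this
  · push Not at h
    obtain ⟨j, hj⟩ := h
    have := C.projZero_eq_zero hj (hx j)
    fin_cases j <;> simp_all [lin3]

/-- A quaternary operation that only sees the components of degree `0` of its arguments has degree
`2` if it does so on arguments of degree `0`. -/
theorem hasDegree_lin4_projZero {f : L →ₗ[k] L →ₗ[k] L →ₗ[k] L →ₗ[k] L}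
    (hf : ∀ x y z w : C.gr 0, f x y z w ∈ C.gr 2) :
    C.HasDegree C (lin4 2 (.sandwich (.sandwich (.sandwich (.sandwich .id C.projZero) C.projZero)
      C.projZero) C.projZero f)) := by
  intro x hx
  by_cases h : ∀ j, (x j).1 = 0
  · have hx' : ∀ j, (x j).2 ∈ C.gr 0 := fun j => h j ▸ hx j
    have := hf ⟨_, hx' 0⟩ ⟨_, hx' 1⟩ ⟨_, hx' 2⟩ ⟨_, hx' 3⟩
    simpa [lin4, totalDeg, h, C.projZero_apply ⟨_, hx' 0⟩, C.projZero_apply ⟨_, hx' 1⟩,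
      C.projZero_apply ⟨_, hx' 2⟩, C.projZero_apply ⟨_, hx' 3⟩] using this
  · push Not at h
    obtain ⟨j, hj⟩ := h
    have := C.projZero_eq_zero hj (hx j)
    fin_cases j <;> simp_all [lin4]

theorem perturbed_l31_apply (x y z : C.gr 0) :
    (R.perturbed A).l31 x y z = R.t31 A ![(0, x.1), (0, y.1), (0, z.1)] := by
  simp [t31, perturbed]

theorem perturbed_l32_apply (x y z : C.gr 0) :
    (R.perturbed A).l32 x y z = R.t32 A ![(0, x.1), (0, y.1), (0, z.1)] := by
  simp [t32, perturbed]
  abel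

theorem perturbed_l4_apply (x y z w : C.gr 0) :
    (R.perturbed A).l4 x y z w = R.t4 A ![(0, x.1), (0, y.1), (0, z.1), (0, w.1)] := by
  simp [t4, perturbed]
  abel

theorem hasDegree_perturbed_o31 (hA : A.IsWeakLie3 C) : C.HasDegree C (R.perturbed A).o31 :=
  hasDegree_lin3_projZero fun x y z => by
    have := (R.tame_t31 hA).mem _ (homog_three x y z)
    rw [← perturbed_l31_apply] at this
    simpa [perturbed, totalDeg, Fin.sum_univ_three] using this

theorem hasDegree_perturbed_o32 (hA : A.IsWeakLie3 C) : C.HasDegree C (R.perturbed A).o32 :=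
  hasDegree_lin3_projZero fun x y z => by
    have := (R.tame_t32 hA).mem _ (homog_three x y z)
    rw [← perturbed_l32_apply] at this
    simpa [perturbed, totalDeg, Fin.sum_univ_three] using this

theorem hasDegree_perturbed_o4 (hA : A.IsWeakLie3 C) : C.HasDegree C (R.perturbed A).o4 :=
  hasDegree_lin4_projZero fun x y z w => by
    have := (R.tame_t4 hA).mem _ (homog_four x y z w)
    rw [← perturbed_l4_apply] at this
    simpa [perturbed, totalDeg, Fin.sum_univ_four] using this

theorem perturbed_o31_eq (hA : A.IsWeakLie3 C) :
    ∀ x, C.Homog x → (R.perturbed A).o31 x = R.t31 A x :=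
  (tame_lin3 (R.hasDegree_perturbed_o31 hA)).ext_three_of_degree_two (R.tame_t31 hA)
    R.perturbed_l31_apply

theorem perturbed_o32_eq (hA : A.IsWeakLie3 C) :
    ∀ x, C.Homog x → (R.perturbed A).o32 x = R.t32 A x :=
  (tame_lin3 (R.hasDegree_perturbed_o32 hA)).ext_three_of_degree_two (R.tame_t32 hA)
    R.perturbed_l32_apply

theorem perturbed_o4_eq (hA : A.IsWeakLie3 C) :
    ∀ x, C.Homog x → (R.perturbed A).o4 x = R.t4 A x :=
  (tame_lin4 (R.hasDegree_perturbed_o4 hA)).ext_four_of_degree_two (R.tame_t4 hA)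
    R.perturbed_l4_apply

end DeformationRetract

/-! ### Transport along `i`, `p` and `h` -/

theorem map_units_smul {M N F : Type*} [AddCommGroup M] [AddCommGroup N] [FunLike F M N]
    [AddMonoidHomClass F M N] (f : F) (u : ℤˣ) (x : M) : f (u • x) = u • f x := by
  simp [Units.smul_def]

section mapArgs

variable {L L' : Type*} (f : L → L')

@[simp] theorem mapArgs_vecCons {n : ℕ} (x : ℤ × L) (v : Fin n → ℤ × L) :
    mapArgs f (Matrix.vecCons x v) = Matrix.vecCons (x.1, f x.2) (mapArgs f v) := by
  funext j
  refine Fin.cases rfl (fun j => rfl) j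

@[simp] theorem mapArgs_empty : mapArgs f (![] : Fin 0 → ℤ × L) = ![] :=
  Subsingleton.elim _ _

theorem mapArgs_update {n : ℕ} (x : Fin n → ℤ × L) (j : Fin n) (v : ℤ × L) :
    mapArgs f (Function.update x j v) = Function.update (mapArgs f x) j (v.1, f v.2) := by
  funext l
  by_cases h : l = j
  · subst h; simp [mapArgs]
  · simp [mapArgs, h]

end mapArgs

namespace ThreeTermComplex

variable {k : Type*} [CommRing k] {L L' L'' : Type*} [AddCommGroup L] [Module k L]
  [AddCommGroup L'] [Module k L'] [AddCommGroup L''] [Module k L'']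
  {C : ThreeTermComplex k L} {C' : ThreeTermComplex k L'} {C'' : ThreeTermComplex k L''}

theorem Tame.mapArgs {n : ℕ} {r : ℤ} {μ : Op L' L'' n r} (hμ : C'.Tame C'' μ) {g : L → L'}
    (hg : ∀ n x, x ∈ C.gr n → g x ∈ C'.gr n) (hg0 : g 0 = 0) :
    C.Tame C'' (r := r) fun x => μ (mapArgs g x) where
  mem x hx := hμ.mem (_root_.mapArgs g x) fun j => hg _ _ (hx j)
  zero x j hj := hμ.zero _ j (by simp [_root_.mapArgs, hj, hg0])

end ThreeTermComplex

namespace DeformationRetract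

open Op ThreeTermComplex

variable {k : Type*} [CommRing k] {L L' : Type*} [AddCommGroup L] [Module k L]
  [AddCommGroup L'] [Module k L'] {C : ThreeTermComplex k L} {C' : ThreeTermComplex k L'}
  (R : DeformationRetract C C') {A : Lie3Maps k L}

theorem homog_mapArgs_i {n : ℕ} {x : Fin n → ℤ × L'} (hx : C'.Homog x) :
    C.Homog (mapArgs R.i x) :=
  fun j => R.i_mem _ _ (hx j)

/-- Both `i` and `p` are chain maps of degree `0`, so they pass through `∂` without a sign. -/
theorem bdry_transfer {n : ℕ} {r : ℤ} (μ : Op L L n r) (x : Fin n → ℤ × L') :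
    C'.bdry C' (r := r) (fun y => R.p (μ (mapArgs R.i y))) x =
      R.p (C.bdry C μ (mapArgs R.i x)) := by
  simp only [bdry, map_sub, map_units_smul, map_sum, mapArgs_update, R.p_d, R.i_d]
  rfl

theorem perm_transfer {n : ℕ} {r : ℤ} (μ : Op L L n r) (σ : Equiv.Perm (Fin n))
    (x : Fin n → ℤ × L') :
    perm (r := r) (fun y => R.p (μ (mapArgs R.i y))) σ x = R.p (μ.perm σ (mapArgs R.i x)) := by
  simp only [perm, map_units_smul]
  rfl

/-- As `h` is odd, `∂(hμ) = [d, h] μ - h ∂μ`, and `[d, h] = 1 - ip`. This is what makes `-h t` the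
right correction term of the morphism. -/
theorem bdry_neg_homotopy {n : ℕ} {r : ℤ} (μ : Op L L n r) (x : Fin n → ℤ × L') :
    C'.bdry C (r := r + 1) (fun y => -R.h (μ (mapArgs R.i y))) x =
      R.i (R.p (μ (mapArgs R.i x))) - μ (mapArgs R.i x) + R.h (C.bdry C μ (mapArgs R.i x)) := by
  have e := R.homotopy (μ (mapArgs R.i x))
  simp only [bdry, map_sub, map_units_smul, map_sum, mapArgs_update, R.i_d, map_neg,
    Int.negOnePow_succ, smul_neg, Finset.sum_neg_distrib, Units.neg_smul, neg_neg]
  refine eq_of_sub_eq_sub e ?_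
  simp only [mapArgs]
  abel

/-- The inclusion on the component of degree `n`. -/
def iGr {n : ℤ} (x : C'.gr n) : C.gr n := ⟨R.i x, R.i_mem n x x.2⟩

@[simp] theorem coe_iGr {n : ℤ} (x : C'.gr n) : (R.iGr x : L) = R.i x := rfl

section components

variable (hA : A.IsWeakLie3 C)

@[simp] theorem coe_d1 (x : C.gr 1) :
    ((R.components hA).d1 x : L) = C.d x := rfl
@[simp] theorem coe_d2 (x : C.gr 2) :
    ((R.components hA).d2 x : L) = C.d x := rfl
@[simp] theorem coe_h0 (x : C.gr 0) :
    ((R.components hA).h0 x : L) = R.h x := rfl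
@[simp] theorem coe_h1 (x : C.gr 1) :
    ((R.components hA).h1 x : L) = R.h x := rfl
@[simp] theorem coe_l2_00 (x y : C.gr 0) :
    ((R.components hA).l2_00 x y : L) = A.l2 x y := rfl
@[simp] theorem coe_l2_01 (x : C.gr 0) (y : C.gr 1) :
    ((R.components hA).l2_01 x y : L) = A.l2 x y := rfl
@[simp] theorem coe_l2_02 (x : C.gr 0) (y : C.gr 2) :
    ((R.components hA).l2_02 x y : L) = A.l2 x y := rfl
@[simp] theorem coe_l2_10 (x : C.gr 1) (y : C.gr 0) :
    ((R.components hA).l2_10 x y : L) = A.l2 x y := rfl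
@[simp] theorem coe_l2_11 (x y : C.gr 1) :
    ((R.components hA).l2_11 x y : L) = A.l2 x y := rfl
@[simp] theorem coe_l2_20 (x : C.gr 2) (y : C.gr 0) :
    ((R.components hA).l2_20 x y : L) = A.l2 x y := rfl
@[simp] theorem coe_l21_00 (x y : C.gr 0) :
    ((R.components hA).l21_00 x y : L) = A.l21 x y := rfl
@[simp] theorem coe_l21_01 (x : C.gr 0) (y : C.gr 1) :
    ((R.components hA).l21_01 x y : L) = A.l21 x y := rfl
@[simp] theorem coe_l21_10 (x : C.gr 1) (y : C.gr 0) :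
    ((R.components hA).l21_10 x y : L) = A.l21 x y := rfl
@[simp] theorem coe_l211 (x y : C.gr 0) :
    ((R.components hA).l211 x y : L) = A.l211 x y := rfl
@[simp] theorem coe_l3_000 (x y z : C.gr 0) :
    ((R.components hA).l3_000 x y z : L) = A.l3 x y z := rfl
@[simp] theorem coe_l3_001 (x y : C.gr 0) (z : C.gr 1) :
    ((R.components hA).l3_001 x y z : L) = A.l3 x y z := rfl
@[simp] theorem coe_l3_010 (x : C.gr 0) (y : C.gr 1) (z : C.gr 0) :
    ((R.components hA).l3_010 x y z : L) = A.l3 x y z := rfl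
@[simp] theorem coe_l3_100 (x : C.gr 1) (y z : C.gr 0) :
    ((R.components hA).l3_100 x y z : L) = A.l3 x y z := rfl
@[simp] theorem coe_l31 (x y z : C.gr 0) :
    ((R.components hA).l31 x y z : L) = A.l31 x y z := rfl
@[simp] theorem coe_l32 (x y z : C.gr 0) :
    ((R.components hA).l32 x y z : L) = A.l32 x y z := rfl
@[simp] theorem coe_l4 (x y z w : C.gr 0) :
    ((R.components hA).l4 x y z w : L) = A.l4 x y z w := rfl

-- This turns the relations with `P` into relations on `L'`: an inner `ip` is read as `p` finishing
-- one transferred operation and `i` feeding the next. At the ends of the complex one half of `[d,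
-- h]` vanishes for degree reasons, here `h d` and in `coe_P2` the term `d h`.
@[simp] theorem coe_P0 (x : C.gr 0) : ((R.components hA).P0 x : L) = R.i (R.p x) := by
  have e := R.homotopy x
  rw [C.d_eq_zero, map_zero, add_zero] at e
  simp [Lie3Components.P0, ← e]

@[simp] theorem coe_P1 (x : C.gr 1) : ((R.components hA).P1 x : L) = R.i (R.p x) := by
  simp [Lie3Components.P1, sub_sub, ← R.homotopy x.1]

@[simp] theorem coe_P2 (x : C.gr 2) : ((R.components hA).P2 x : L) = R.i (R.p x) := by
  have e := R.homotopy x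
  rw [C.eq_zero_of_mem (R.h_mem 2 x x.2) (by norm_num), map_zero, zero_add] at e
  simp [Lie3Components.P2, ← e]

@[simp] theorem coe_t3_000 (x y z : C.gr 0) :
    ((R.components hA).t3_000 x y z : L) = (R.perturbed A).l3 x y z := by
  simp [Lie3Components.t3_000, perturbed, signInvolution_apply]

@[simp] theorem coe_t3_001 (x y : C.gr 0) (z : C.gr 1) :
    ((R.components hA).t3_001 x y z : L) = (R.perturbed A).l3 x y z := by
  simp [Lie3Components.t3_001, perturbed, signInvolution_apply]

@[simp] theorem coe_t3_010 (x : C.gr 0) (y : C.gr 1) (z : C.gr 0) :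
    ((R.components hA).t3_010 x y z : L) = (R.perturbed A).l3 x y z := by
  simp [Lie3Components.t3_010, perturbed, signInvolution_apply, sub_eq_add_neg]

@[simp] theorem coe_t3_100 (x : C.gr 1) (y z : C.gr 0) :
    ((R.components hA).t3_100 x y z : L) = (R.perturbed A).l3 x y z := by
  simp [Lie3Components.t3_100, perturbed, signInvolution_apply]

@[simp] theorem coe_t31 (x y z : C.gr 0) :
    ((R.components hA).t31 x y z : L) = (R.perturbed A).l31 x y z := by
  simp [Lie3Components.t31, perturbed, projZero_apply]

@[simp] theorem coe_t32 (x y z : C.gr 0) :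
    ((R.components hA).t32 x y z : L) = (R.perturbed A).l32 x y z := by
  simp [Lie3Components.t32, perturbed, projZero_apply]

@[simp] theorem coe_t4 (x y z w : C.gr 0) :
    ((R.components hA).t4 x y z w : L) = (R.perturbed A).l4 x y z w := by
  simp [Lie3Components.t4, perturbed, projZero_apply]

end components

end DeformationRetract

/-! ### The transferred structure is a weak Lie 3-algebra -/

namespace DeformationRetract

open Op ThreeTermComplex

variable {k : Type*} [CommRing k] {L L' : Type*} [AddCommGroup L] [Module k L]
  [AddCommGroup L'] [Module k L'] {C : ThreeTermComplex k L} {C' : ThreeTermComplex k L'}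
  (R : DeformationRetract C C') {A : Lie3Maps k L}

section apply

variable (A)

@[simp] theorem transferred_l2_apply (x y : L') : (R.transferred A).l2 x y =
    R.p (A.l2 (R.i x) (R.i y)) := rfl
@[simp] theorem transferred_l21_apply (x y : L') : (R.transferred A).l21 x y =
    R.p (A.l21 (R.i x) (R.i y)) := rfl
@[simp] theorem transferred_l211_apply (x y : L') : (R.transferred A).l211 x y =
    R.p (A.l211 (R.i x) (R.i y)) := rfl
@[simp] theorem transferred_l3_apply (x y z : L') : (R.transferred A).l3 x y z =
    R.p ((R.perturbed A).l3 (R.i x) (R.i y) (R.i z)) := rfl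
@[simp] theorem transferred_l31_apply (x y z : L') : (R.transferred A).l31 x y z =
    R.p ((R.perturbed A).l31 (R.i x) (R.i y) (R.i z)) := rfl
@[simp] theorem transferred_l32_apply (x y z : L') : (R.transferred A).l32 x y z =
    R.p ((R.perturbed A).l32 (R.i x) (R.i y) (R.i z)) := rfl
@[simp] theorem transferred_l4_apply (x y z w : L') : (R.transferred A).l4 x y z w =
    R.p ((R.perturbed A).l4 (R.i x) (R.i y) (R.i z) (R.i w)) := rfl

end apply

theorem hasDegree_transferred_o2 (hA : A.IsWeakLie3 C) :
    C'.HasDegree C' (R.transferred A).o2 :=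
  fun _ hx => R.p_mem _ _ (hA.deg2 _ (R.homog_mapArgs_i hx))

theorem hasDegree_transferred_o21 (hA : A.IsWeakLie3 C) :
    C'.HasDegree C' (R.transferred A).o21 :=
  fun _ hx => R.p_mem _ _ (hA.deg21 _ (R.homog_mapArgs_i hx))

theorem hasDegree_transferred_o211 (hA : A.IsWeakLie3 C) :
    C'.HasDegree C' (R.transferred A).o211 :=
  fun _ hx => R.p_mem _ _ (hA.deg211 _ (R.homog_mapArgs_i hx))

theorem hasDegree_transferred_o3 (hA : A.IsWeakLie3 C) :
    C'.HasDegree C' (R.transferred A).o3 :=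
  fun _ hx => R.p_mem _ _ (R.hasDegree_perturbed_o3 hA _ (R.homog_mapArgs_i hx))

theorem hasDegree_transferred_o31 (hA : A.IsWeakLie3 C) :
    C'.HasDegree C' (R.transferred A).o31 :=
  fun _ hx => R.p_mem _ _ (R.hasDegree_perturbed_o31 hA _ (R.homog_mapArgs_i hx))

theorem hasDegree_transferred_o32 (hA : A.IsWeakLie3 C) :
    C'.HasDegree C' (R.transferred A).o32 :=
  fun _ hx => R.p_mem _ _ (R.hasDegree_perturbed_o32 hA _ (R.homog_mapArgs_i hx))

theorem hasDegree_transferred_o4 (hA : A.IsWeakLie3 C) :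
    C'.HasDegree C' (R.transferred A).o4 :=
  fun _ hx => R.p_mem _ _ (R.hasDegree_perturbed_o4 hA _ (R.homog_mapArgs_i hx))

attribute [local simp] i_d

@[simp] theorem d_p (x : L) : C'.d (R.p x) = R.p (C.d x) := (R.p_d x).symm

/-- A degreewise relation in `L` gives one in `L'` after applying `p`; the second hypothesis only
matches terms. -/
theorem eq_of_components {n : ℤ} {u v : C.gr n} (h : u = v) {a b : L'}
    (e : a - b = R.p u - R.p v) : a = b :=
  eq_of_sub_eq_sub (congrArg (fun w : C.gr n => R.p w) h) e

/-- Removes from a boundary the term `d ∘ μ` when `μ` already takes values above degree `2`. -/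
theorem lin3_i_eq_zero {r : ℤ} {f : L →ₗ[k] L →ₗ[k] L →ₗ[k] L} (hf : C.HasDegree C (lin3 r f))
    {a b c : ℤ} (x : C'.gr a) (y : C'.gr b) (z : C'.gr c) (h : 2 < a + b + c + r) :
    f (R.i x) (R.i y) (R.i z) = 0 :=
  lin3_eq_zero hf (R.iGr x) (R.iGr y) (R.iGr z) h

theorem lin4_i_eq_zero {r : ℤ} {f : L →ₗ[k] L →ₗ[k] L →ₗ[k] L →ₗ[k] L}
    (hf : C.HasDegree C (lin4 r f)) {a b c e : ℤ} (x : C'.gr a) (y : C'.gr b) (z : C'.gr c)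
    (w : C'.gr e) (h : 2 < a + b + c + e + r) : f (R.i x) (R.i y) (R.i z) (R.i w) = 0 :=
  lin4_eq_zero hf (R.iGr x) (R.iGr y) (R.iGr z) (R.iGr w) h

theorem tame_transferred_o2 (hA : A.IsWeakLie3 C) : C'.Tame C' (R.transferred A).o2 :=
  tame_lin2 (R.hasDegree_transferred_o2 hA)

theorem tame_transferred_o21 (hA : A.IsWeakLie3 C) : C'.Tame C' (R.transferred A).o21 :=
  tame_lin2 (R.hasDegree_transferred_o21 hA)

theorem tame_transferred_o211 (hA : A.IsWeakLie3 C) : C'.Tame C' (R.transferred A).o211 :=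
  tame_lin2 (R.hasDegree_transferred_o211 hA)

theorem tame_transferred_o3 (hA : A.IsWeakLie3 C) : C'.Tame C' (R.transferred A).o3 :=
  tame_lin3 (R.hasDegree_transferred_o3 hA)

theorem tame_transferred_o31 (hA : A.IsWeakLie3 C) : C'.Tame C' (R.transferred A).o31 :=
  tame_lin3 (R.hasDegree_transferred_o31 hA)

theorem tame_transferred_o32 (hA : A.IsWeakLie3 C) : C'.Tame C' (R.transferred A).o32 :=
  tame_lin3 (R.hasDegree_transferred_o32 hA)

theorem tame_transferred_o4 (hA : A.IsWeakLie3 C) : C'.Tame C' (R.transferred A).o4 :=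
  tame_lin4 (R.hasDegree_transferred_o4 hA)

set_option maxHeartbeats 4000000 in
theorem transferred_isLeibniz3 (hA : A.IsWeakLie3 C) : (R.transferred A).IsLeibniz3 C' := by
  have h2 := R.tame_transferred_o2 hA
  have h3 := R.tame_transferred_o3 hA
  have h4 := R.tame_transferred_o4 hA
  refine ⟨h2.mem, h3.mem, h4.mem, ?_, ?_, ?_, ?_⟩
  -- This relation contains no composite of operations, so it transports along `i` and `p` without a
  -- projector.
  · intro x hx
    exact (R.bdry_transfer A.o2 x).trans
      ((congrArg R.p (hA.eq2 _ (R.homog_mapArgs_i hx))).trans (map_zero _))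
  -- The second tameness proof is nested like the right-hand side of the relation. The arity `2 + 2
  -- - 1` and the degree `1 - 1` reduce to `3` and `0` by computation.
  · refine Tame.ext_three_of_degree_zero (C := C') (C' := C')
      h3.bdry
      (((h2.circ h2 1).sub (h2.circ h2 0)).sub ((h2.circ h2 1).cyc _)) ?_ ?_ ?_ ?_ ?_ ?_ ?_ ?_ ?_ ?_
    · exact fun x y z => R.eq_of_components
        ((R.components hA).transfer_eq3_000 (R.iGr x) (R.iGr y) (R.iGr z))
        (by simp)
    · exact fun x y z => R.eq_of_components
        ((R.components hA).transfer_eq3_001 (R.iGr x) (R.iGr y) (R.iGr z))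
        (by simp)
    · exact fun x y z => R.eq_of_components
        ((R.components hA).transfer_eq3_010 (R.iGr x) (R.iGr y) (R.iGr z))
        (by simp)
    · exact fun x y z => R.eq_of_components
        ((R.components hA).transfer_eq3_100 (R.iGr x) (R.iGr y) (R.iGr z))
        (by simp)
    · exact fun x y z => R.eq_of_components
        ((R.components hA).transfer_eq3_002 (R.iGr x) (R.iGr y) (R.iGr z))
        (by simp [R.lin3_i_eq_zero (R.hasDegree_perturbed_o3 hA)])
    · exact fun x y z => R.eq_of_components
        ((R.components hA).transfer_eq3_020 (R.iGr x) (R.iGr y) (R.iGr z))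
        (by simp [R.lin3_i_eq_zero (R.hasDegree_perturbed_o3 hA)])
    · exact fun x y z => R.eq_of_components
        ((R.components hA).transfer_eq3_200 (R.iGr x) (R.iGr y) (R.iGr z))
        (by simp [R.lin3_i_eq_zero (R.hasDegree_perturbed_o3 hA)])
    · exact fun x y z => R.eq_of_components
        ((R.components hA).transfer_eq3_011 (R.iGr x) (R.iGr y) (R.iGr z))
        (by simp [R.lin3_i_eq_zero (R.hasDegree_perturbed_o3 hA)]; abel)
    · exact fun x y z => R.eq_of_components
        ((R.components hA).transfer_eq3_101 (R.iGr x) (R.iGr y) (R.iGr z))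
        (by simp [R.lin3_i_eq_zero (R.hasDegree_perturbed_o3 hA)]; abel)
    · exact fun x y z => R.eq_of_components
        ((R.components hA).transfer_eq3_110 (R.iGr x) (R.iGr y) (R.iGr z))
        (by simp [R.lin3_i_eq_zero (R.hasDegree_perturbed_o3 hA)]; abel)
  · refine Tame.ext_four_of_degree_one (C := C') (C' := C')
      h4.bdry
      ((((((((((h2.circ h3 0).add (h2.circ h3 1)).sub ((h2.circ h3 1).cyc _)).add ((h2.circ h3
        1).cyc _)).sub (h3.circ h2 0)).add (h3.circ h2 1)).sub ((h3.circ h2 1).cyc _)).sub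
        (h3.circ h2 2)).add ((h3.circ h2 2).cyc _)).sub ((h3.circ h2 2).cyc _)) ?_ ?_ ?_ ?_ ?_
    · exact fun x y z w => R.eq_of_components
        ((R.components hA).transfer_eq4_0000 (R.iGr x) (R.iGr y) (R.iGr z) (R.iGr w))
        (by simp)
    · exact fun x y z w => R.eq_of_components
        ((R.components hA).transfer_eq4_0001 (R.iGr x) (R.iGr y) (R.iGr z) (R.iGr w))
        (by simp [R.lin4_i_eq_zero (R.hasDegree_perturbed_o4 hA)])
    · exact fun x y z w => R.eq_of_components
        ((R.components hA).transfer_eq4_0010 (R.iGr x) (R.iGr y) (R.iGr z) (R.iGr w))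
        (by simp [R.lin4_i_eq_zero (R.hasDegree_perturbed_o4 hA)]; abel)
    · exact fun x y z w => R.eq_of_components
        ((R.components hA).transfer_eq4_0100 (R.iGr x) (R.iGr y) (R.iGr z) (R.iGr w))
        (by simp [R.lin4_i_eq_zero (R.hasDegree_perturbed_o4 hA)])
    · exact fun x y z w => R.eq_of_components
        ((R.components hA).transfer_eq4_1000 (R.iGr x) (R.iGr y) (R.iGr z) (R.iGr w))
        (by simp [R.lin4_i_eq_zero (R.hasDegree_perturbed_o4 hA)]; abel)
  -- The relation has the form `0 = …`, so the zero operation stands on the left and the component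
  -- relation is used reversed.
  · refine Tame.ext_five_of_degree_two (C := C') (C' := C') Tame.of_zero
      (((((((((((((((((((((((((h2.circ h4 0).sub (h2.circ h4 1)).add ((h2.circ h4 1).cyc _)).sub
        ((h2.circ h4 1).cyc _)).add ((h2.circ h4 1).cyc _)).add (h3.circ h3 0)).add (h3.circ h3
        1)).sub ((h3.circ h3 1).cyc _)).add ((h3.circ h3 1).cyc _)).add (h3.circ h3 2)).sub
        ((h3.circ h3 2).cyc _)).add ((h3.circ h3 2).cyc _)).add ((h3.circ h3 2).cyc _)).sub
        ((h3.circ h3 2).cyc _)).add ((h3.circ h3 2).perm _)).add (h4.circ h2 0)).sub (h4.circ h2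
        1)).add ((h4.circ h2 1).cyc _)).add (h4.circ h2 2)).sub ((h4.circ h2 2).cyc _)).add
        ((h4.circ h2 2).cyc _)).sub (h4.circ h2 3)).add ((h4.circ h2 3).cyc _)).sub ((h4.circ h2
        3).cyc _)).add ((h4.circ h2 3).cyc _)) ?_
    exact fun x y z w v => R.eq_of_components ((R.components hA).transfer_eq5 (R.iGr x) (R.iGr y)
      (R.iGr z) (R.iGr w) (R.iGr v)).symm (by simp)

set_option maxHeartbeats 4000000 in
theorem transferred_isWeakLie3 (hA : A.IsWeakLie3 C) : (R.transferred A).IsWeakLie3 C' := by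
  have h2 := R.tame_transferred_o2 hA
  have h3 := R.tame_transferred_o3 hA
  have h4 := R.tame_transferred_o4 hA
  have h21 := R.tame_transferred_o21 hA
  have h211 := R.tame_transferred_o211 hA
  have h31 := R.tame_transferred_o31 hA
  have h32 := R.tame_transferred_o32 hA
  refine ⟨R.transferred_isLeibniz3 hA, h21.mem, h211.mem, h31.mem, h32.mem,
    ?_, ?_, ?_, ?_, ?_, ?_, ?_, ?_, ?_, ?_, ?_⟩
  -- The relations for `∂λ_{2;1}` and `∂λ_{2;1,1}`, and below the antisymmetry of `λ_{2;1,1}`, are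
  -- linear in the operations and transport directly. The others contain composites and need the
  -- relations with `P`.
  · intro x hx
    refine (R.bdry_transfer A.o21 x).trans
      ((congrArg R.p (hA.eq21 _ (R.homog_mapArgs_i hx))).trans ?_)
    rw [map_add]
    exact congrArg _ (R.perm_transfer A.o2 _ x).symm
  · intro x hx
    refine (R.bdry_transfer A.o211 x).trans
      ((congrArg R.p (hA.eq211 _ (R.homog_mapArgs_i hx))).trans ?_)
    rw [map_sub]
    exact congrArg _ (R.perm_transfer A.o21 _ x).symm
  · refine Tame.ext_three_of_degree_one (C := C') (C' := C')
      h31.bdry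
      ((h3.add (h3.cyc _)).add (h2.circ h21 0)) ?_ ?_ ?_ ?_
    · exact fun x y z => R.eq_of_components
        ((R.components hA).transfer_eq31_000 (R.iGr x) (R.iGr y) (R.iGr z))
        (by simp)
    · exact fun x y z => R.eq_of_components
        ((R.components hA).transfer_eq31_001 (R.iGr x) (R.iGr y) (R.iGr z))
        (by simp [R.lin3_i_eq_zero (R.hasDegree_perturbed_o31 hA)])
    · exact fun x y z => R.eq_of_components
        ((R.components hA).transfer_eq31_010 (R.iGr x) (R.iGr y) (R.iGr z))
        (by simp [R.lin3_i_eq_zero (R.hasDegree_perturbed_o31 hA)])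
    · exact fun x y z => R.eq_of_components
        ((R.components hA).transfer_eq31_100 (R.iGr x) (R.iGr y) (R.iGr z))
        (by simp [R.lin3_i_eq_zero (R.hasDegree_perturbed_o31 hA)])
  · refine Tame.ext_three_of_degree_one (C := C') (C' := C')
      h32.bdry
      ((((h3.add (h3.cyc _)).sub (h2.circ h21 1)).add (h21.circ h2 0)).add ((h21.circ h2 1).cyc
        _)) ?_ ?_ ?_ ?_
    · exact fun x y z => R.eq_of_components
        ((R.components hA).transfer_eq32_000 (R.iGr x) (R.iGr y) (R.iGr z))
        (by simp)
    · exact fun x y z => R.eq_of_components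
        ((R.components hA).transfer_eq32_001 (R.iGr x) (R.iGr y) (R.iGr z))
        (by simp [R.lin3_i_eq_zero (R.hasDegree_perturbed_o32 hA)])
    · exact fun x y z => R.eq_of_components
        ((R.components hA).transfer_eq32_010 (R.iGr x) (R.iGr y) (R.iGr z))
        (by simp [R.lin3_i_eq_zero (R.hasDegree_perturbed_o32 hA)])
    · exact fun x y z => R.eq_of_components
        ((R.components hA).transfer_eq32_100 (R.iGr x) (R.iGr y) (R.iGr z))
        (by simp [R.lin3_i_eq_zero (R.hasDegree_perturbed_o32 hA)])
  · intro x hx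
    have e := congrArg R.p (hA.eq2111 _ (R.homog_mapArgs_i hx))
    rw [map_add, map_zero] at e
    exact (congrArg _ (R.perm_transfer A.o211 _ x)).trans e
  · refine Tame.ext_three_of_degree_two (C := C') (C' := C')
      (h31.sub (h31.cyc _))
      (h2.circ h211 0) ?_
    · exact fun x y z => R.eq_of_components
        ((R.components hA).transfer_eq311 (R.iGr x) (R.iGr y) (R.iGr z))
        (by simp)
  · refine Tame.ext_three_of_degree_two (C := C') (C' := C')
      (((((h31.sub (h32.cyc _)).add (h31.cyc _)).sub h32).add (h31.cyc _)).sub (h32.cyc _))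
      ((((h21.circ h21 1).add (h21.circ h21 0)).add ((h21.circ h21 1).cyc _)).add ((h211.circ h2
        1).cyc _)) ?_
    · exact fun x y z => R.eq_of_components
        ((R.components hA).transfer_eq312 (R.iGr x) (R.iGr y) (R.iGr z))
        (by simp; abel)
  · refine Tame.ext_three_of_degree_two (C := C') (C' := C')
      (h32.sub (h32.cyc _))
      ((((h2.circ h211 1).neg).add (h211.circ h2 0)).add ((h211.circ h2 1).cyc _)) ?_
    · exact fun x y z => R.eq_of_components
        ((R.components hA).transfer_eq322 (R.iGr x) (R.iGr y) (R.iGr z))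
        (by simp)
  · refine Tame.ext_four_of_degree_two (C := C') (C' := C')
      (h4.add (h4.cyc _))
      ((((h2.circ h31 0).sub (h31.circ h2 2)).add ((h2.circ h31 1).cyc _)).add (h3.circ h21 0)) ?_
    · exact fun x y z w => R.eq_of_components
        ((R.components hA).transfer_eq41 (R.iGr x) (R.iGr y) (R.iGr z) (R.iGr w))
        (by simp)
  · refine Tame.ext_four_of_degree_two (C := C') (C' := C')
      (h4.add (h4.cyc _))
      ((((((h2.circ h32 0).sub (h3.circ h21 1)).add (h2.circ h31 1)).sub (h31.circ h2 0)).sub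
        ((h31.circ h2 1).cyc _)).sub ((h31.circ h2 2).cyc _)) ?_
    · exact fun x y z w => R.eq_of_components
        ((R.components hA).transfer_eq42 (R.iGr x) (R.iGr y) (R.iGr z) (R.iGr w))
        (by simp)
  · refine Tame.ext_four_of_degree_two (C := C') (C' := C')
      (h4.add (h4.cyc _))
      ((((((((((h21.circ h3 0).sub (h32.circ h2 0)).add (h32.circ h2 1)).sub ((h32.circ h2
        1).cyc _)).add (h3.circ h21 2)).add ((h32.circ h2 2).cyc _)).sub ((h32.circ h2 2).cyc
        _)).add (h2.circ h32 1)).sub ((h2.circ h32 1).cyc _)).add ((h21.circ h3 1).cyc _)) ?_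
    · exact fun x y z w => R.eq_of_components
        ((R.components hA).transfer_eq43 (R.iGr x) (R.iGr y) (R.iGr z) (R.iGr w))
        (by simp)

end DeformationRetract

/-! ### The inclusion extends to a weak morphism -/

namespace ThreeTermComplex

variable {k : Type*} [CommRing k] {L L' L'' : Type*} [AddCommGroup L] [Module k L]
  [AddCommGroup L'] [Module k L'] [AddCommGroup L''] [Module k L'']
  {C : ThreeTermComplex k L} {C' : ThreeTermComplex k L'} {C'' : ThreeTermComplex k L''}

theorem Tame.map {n : ℕ} {r : ℤ} {μ : Op L L' n r} (hμ : C.Tame C' μ) {g : L' → L''}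
    (hg : ∀ n x, x ∈ C'.gr n → g x ∈ C''.gr n) (hg0 : g 0 = 0) :
    C.Tame C'' (r := r) fun x => g (μ x) where
  mem x hx := hg _ _ (hμ.mem x hx)
  zero x j hj := (congrArg g (hμ.zero x j hj)).trans hg0

theorem eq_of_coe {n : ℤ} {u v : C.gr n} (h : u = v) {a b : L} (e : a - b = u - v) : a = b :=
  eq_of_sub_eq_sub (congrArg Subtype.val h) e

end ThreeTermComplex

namespace DeformationRetract

open Op ThreeTermComplex

variable {k : Type*} [CommRing k] {L L' : Type*} [AddCommGroup L] [Module k L]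
  [AddCommGroup L'] [Module k L'] {C : ThreeTermComplex k L} {C' : ThreeTermComplex k L'}
  (R : DeformationRetract C C') {A : Lie3Maps k L}

section apply

variable (A)

@[simp] theorem inclusion_f1 : (R.inclusion A).f1 = R.i := rfl
@[simp] theorem inclusion_o1_apply (x : ℤ × L') : (R.inclusion A).o1 ![x] = R.i x.2 := rfl
@[simp] theorem inclusion_o2_apply (x y : ℤ × L') : (R.inclusion A).o2 ![x, y] =
    -R.h (A.l2 (R.i x.2) (R.i y.2)) := rfl
@[simp] theorem inclusion_o21_apply (x y : ℤ × L') : (R.inclusion A).o21 ![x, y] =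
    -R.h (A.l21 (R.i x.2) (R.i y.2)) := rfl
@[simp] theorem inclusion_o3_apply (x y z : ℤ × L') : (R.inclusion A).o3 ![x, y, z] =
    -R.h ((R.perturbed A).l3 (R.i x.2) (R.i y.2) (R.i z.2)) := rfl

end apply

theorem neg_h_mem {n : ℤ} {x : L} (hx : x ∈ C.gr n) {m : ℤ} (hm : n + 1 = m) :
    -R.h x ∈ C.gr m :=
  hm ▸ neg_mem (R.h_mem n x hx)

theorem tame_inclusion_o1 : C'.Tame C (R.inclusion A).o1 :=
  tame_lin1 fun x hx => by
    simpa [lin1, totalDeg] using R.i_mem _ _ (hx 0)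

theorem tame_inclusion_o2 (hA : A.IsWeakLie3 C) : C'.Tame C (R.inclusion A).o2 :=
  tame_lin2 fun _ hx => R.neg_h_mem (hA.deg2 _ (R.homog_mapArgs_i hx)) (add_assoc _ _ _)

theorem tame_inclusion_o21 (hA : A.IsWeakLie3 C) : C'.Tame C (R.inclusion A).o21 :=
  tame_lin2 fun _ hx => R.neg_h_mem (hA.deg21 _ (R.homog_mapArgs_i hx)) (add_assoc _ _ _)

theorem tame_inclusion_o3 (hA : A.IsWeakLie3 C) : C'.Tame C (R.inclusion A).o3 :=
  tame_lin3 fun _ hx => R.neg_h_mem (R.hasDegree_perturbed_o3 hA _ (R.homog_mapArgs_i hx))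
    (add_assoc _ _ _)

/-- The bound is `1` instead of `2` because `h` raises the degree once more. -/
theorem h_lin3_i_eq_zero {r : ℤ} {f : L →ₗ[k] L →ₗ[k] L →ₗ[k] L} (hf : C.HasDegree C (lin3 r f))
    {a b c : ℤ} (x : C'.gr a) (y : C'.gr b) (z : C'.gr c) (h : 1 < a + b + c + r) :
    R.h (f (R.i x) (R.i y) (R.i z)) = 0 :=
  C.eq_zero_of_mem (R.h_mem _ _ (lin3_mem hf rfl (R.iGr x) (R.iGr y) (R.iGr z)))
    (.inr (by omega))

theorem perm_neg_homotopy {n : ℕ} {r s : ℤ} (μ : Op L L n r) (σ : Equiv.Perm (Fin n))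
    (x : Fin n → ℤ × L') :
    perm (r := s) (fun y => -R.h (μ (mapArgs R.i y))) σ x = -R.h (μ.perm σ (mapArgs R.i x)) := by
  simp only [perm, map_units_smul, smul_neg]
  rfl

attribute [local simp] i_d

set_option maxHeartbeats 4000000 in
theorem inclusion_isLeibniz3Mor (hA : A.IsWeakLie3 C) :
    (R.inclusion A).IsLeibniz3Mor C' C (R.transferred A) A := by
  have h2 := R.tame_transferred_o2 hA
  have h3 := R.tame_transferred_o3 hA
  have h4 := R.tame_transferred_o4 hA
  have a2 : C.Tame C A.o2 := tame_lin2 hA.deg2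
  have a3 : C.Tame C A.o3 := tame_lin3 hA.deg3
  have a4 : C.Tame C A.o4 := tame_lin4 hA.deg4
  have f1 : C'.Tame C (R.inclusion A).o1 := R.tame_inclusion_o1
  have f2 := R.tame_inclusion_o2 hA
  have f3 := R.tame_inclusion_o3 hA
  refine ⟨f1.mem, f2.mem, f3.mem, ?_, ?_, ?_, ?_⟩
  · intro x hx
    simp [bdry, Lie3MorMaps.o1, lin1]
  · intro x hx
    -- Since `∂λ₂ = 0`, only `ip λ₂(i, i) - λ₂(i, i)` remains, and its first term is `i λ₂'`.
    refine (R.bdry_neg_homotopy A.o2 x).trans ?_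
    rw [hA.eq2 _ (R.homog_mapArgs_i hx), map_zero, add_zero]
    rfl
  · refine Tame.ext_three_of_degree_one (C := C') (C' := C) f3.bdry
      ((((((((h3.map R.i_mem (map_zero _)).sub (f2.circ h2 1)).add (f2.circ h2 0)).add ((f2.circ
        h2 1).cyc _)).sub (a3.mapArgs R.i_mem (map_zero _))).sub (a2.comp2 f1 f2)).add (a2.comp2
        f2 f1)).add ((a2.comp2 f1 f2).cyc _)) ?_ ?_ ?_ ?_
    · exact fun x y z => eq_of_coe
        ((R.components hA).inclusion_eq3_000 (R.iGr x) (R.iGr y) (R.iGr z))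
        (by simp; abel)
    · exact fun x y z => eq_of_coe
        ((R.components hA).inclusion_eq3_001 (R.iGr x) (R.iGr y) (R.iGr z))
        (by simp [R.h_lin3_i_eq_zero (R.hasDegree_perturbed_o3 hA)]; abel)
    · exact fun x y z => eq_of_coe
        ((R.components hA).inclusion_eq3_010 (R.iGr x) (R.iGr y) (R.iGr z))
        (by simp [R.h_lin3_i_eq_zero (R.hasDegree_perturbed_o3 hA)]; abel)
    · exact fun x y z => eq_of_coe
        ((R.components hA).inclusion_eq3_100 (R.iGr x) (R.iGr y) (R.iGr z))
        (by simp [R.h_lin3_i_eq_zero (R.hasDegree_perturbed_o3 hA)]; abel)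
  · refine Tame.ext_four_of_degree_two (C := C') (C' := C)
      ((h4.map R.i_mem (map_zero _)).sub (a4.mapArgs R.i_mem (map_zero _)))
      (((((((((((((((((((((((f2.circ h3 0).add (f2.circ h3 1)).sub ((f2.circ h3 1).cyc _)).add
        ((f2.circ h3 1).cyc _)).sub (f3.circ h2 0)).add (f3.circ h2 1)).sub ((f3.circ h2 1).cyc
        _)).sub (f3.circ h2 2)).add ((f3.circ h2 2).cyc _)).sub ((f3.circ h2 2).cyc _)).add
        (a2.comp2 f3 f1)).add (a2.comp2 f1 f3)).sub ((a2.comp2 f1 f3).cyc _)).add ((a2.comp2 f1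
        f3).cyc _)).sub (a2.comp2 f2 f2)).add ((a2.comp2 f2 f2).cyc _)).sub ((a2.comp2 f2 f2).cyc
        _)).add (a3.comp3 f2 f1 f1)).sub (a3.comp3 f1 f2 f1)).add ((a3.comp3 f1 f2 f1).cyc _)).add
        (a3.comp3 f1 f1 f2)).sub ((a3.comp3 f1 f1 f2).cyc _)).add ((a3.comp3 f1 f1 f2).cyc _)) ?_
    · exact fun x y z w => eq_of_coe
        ((R.components hA).inclusion_eq4 (R.iGr x) (R.iGr y) (R.iGr z) (R.iGr w))
        (by simp; abel)

set_option maxHeartbeats 4000000 in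
theorem inclusion_isWeakLie3Mor (hA : A.IsWeakLie3 C) :
    (R.inclusion A).IsWeakLie3Mor C' C (R.transferred A) A := by
  have h2 := R.tame_transferred_o2 hA
  have h21 := R.tame_transferred_o21 hA
  have h211 := R.tame_transferred_o211 hA
  have h31 := R.tame_transferred_o31 hA
  have h32 := R.tame_transferred_o32 hA
  have a2 : C.Tame C A.o2 := tame_lin2 hA.deg2
  have a21 : C.Tame C A.o21 := tame_lin2 hA.deg21
  have a211 : C.Tame C A.o211 := tame_lin2 hA.deg211
  have a31 : C.Tame C A.o31 := tame_lin3 hA.deg31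
  have a32 : C.Tame C A.o32 := tame_lin3 hA.deg32
  have f1 : C'.Tame C (R.inclusion A).o1 := R.tame_inclusion_o1
  have f2 := R.tame_inclusion_o2 hA
  have f3 := R.tame_inclusion_o3 hA
  have f21 := R.tame_inclusion_o21 hA
  refine ⟨R.inclusion_isLeibniz3Mor hA, f21.mem, ?_, ?_, ?_, ?_⟩
  · intro x hx
    refine (R.bdry_neg_homotopy A.o21 x).trans ?_
    rw [hA.eq21 _ (R.homog_mapArgs_i hx), map_add]
    -- The symmetric group action depends on the degrees of the arguments but not on that of the
    -- operation, so `-h` commutes with it although `-h λ₂` has degree `1`.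
    have e := R.perm_neg_homotopy (s := 1) A.o2 [0, 1].formPerm x
    refine Eq.trans ?_ (congrArg (fun u => -(R.inclusion A).o2 x - u +
      R.i ((R.transferred A).o21 x) - A.o21 (mapArgs R.i x)) e.symm)
    have e2 : (R.inclusion A).o2 x = -R.h (A.o2 (mapArgs R.i x)) := rfl
    have e21 : (R.transferred A).o21 x = R.p (A.o21 (mapArgs R.i x)) := rfl
    simp only [e2, e21, cyc]
    abel
  · refine Tame.ext_two_of_degree_two (C := C') (C' := C)
      ((h211.map R.i_mem (map_zero _)).sub (a211.mapArgs R.i_mem (map_zero _)))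
      (f21.sub (f21.cyc _)) ?_
    · exact fun x y => eq_of_coe
        ((R.components hA).inclusion_eq211 (R.iGr x) (R.iGr y))
        (by simp)
  · refine Tame.ext_three_of_degree_two (C := C') (C' := C)
      ((h31.map R.i_mem (map_zero _)).sub (a31.mapArgs R.i_mem (map_zero _)))
      (((f3.add (f3.cyc _)).add (f2.circ h21 0)).add (a2.comp2 f21 f1)) ?_
    · exact fun x y z => eq_of_coe
        ((R.components hA).inclusion_eq31 (R.iGr x) (R.iGr y) (R.iGr z))
        (by simp; abel)
  · refine Tame.ext_three_of_degree_two (C := C') (C' := C)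
      ((h32.map R.i_mem (map_zero _)).sub (a32.mapArgs R.i_mem (map_zero _)))
      (((((((f3.add (f3.cyc _)).sub (f2.circ h21 1)).add (f21.circ h2 0)).add ((f21.circ h2
        1).cyc _)).sub (a2.comp2 f1 f21)).sub (a21.comp2 f2 f1)).sub ((a21.comp2 f1 f2).cyc _)) ?_
    · exact fun x y z => eq_of_coe
        ((R.components hA).inclusion_eq32 (R.iGr x) (R.iGr y) (R.iGr z))
        (by simp; abel)

/-! ### Comparison with the prescribed formulas and conclusion -/

theorem transferred_o3 (x : Fin 3 → ℤ × L') : (R.transferred A).o3 x =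
    R.p ((R.perturbed A).o3 (mapArgs R.i x)) := rfl

theorem transferred_o4 (x : Fin 4 → ℤ × L') : (R.transferred A).o4 x =
    R.p ((R.perturbed A).o4 (mapArgs R.i x)) := rfl

theorem transferred_o31 (x : Fin 3 → ℤ × L') : (R.transferred A).o31 x =
    R.p ((R.perturbed A).o31 (mapArgs R.i x)) := rfl

theorem transferred_o32 (x : Fin 3 → ℤ × L') : (R.transferred A).o32 x =
    R.p ((R.perturbed A).o32 (mapArgs R.i x)) := rfl

theorem isTransferred_transferred (hA : A.IsWeakLie3 C) : R.IsTransferred A (R.transferred A) where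
  l2 _ _ := rfl
  l3 x hx := by rw [transferred_o3, R.perturbed_o3_eq hA _ (R.homog_mapArgs_i hx)]
  l4 x hx := by rw [transferred_o4, R.perturbed_o4_eq hA _ (R.homog_mapArgs_i hx)]
  l21 _ _ := rfl
  l211 _ _ := rfl
  l31 x hx := by rw [transferred_o31, R.perturbed_o31_eq hA _ (R.homog_mapArgs_i hx)]
  l32 x hx := by rw [transferred_o32, R.perturbed_o32_eq hA _ (R.homog_mapArgs_i hx)]

theorem isExtendedInclusion_inclusion (hA : A.IsWeakLie3 C) :
    R.IsExtendedInclusion A (R.inclusion A) where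
  f1 := rfl
  f2 _ _ := rfl
  f3 _ hx := congrArg (fun u => -R.h u) (R.perturbed_o3_eq hA _ (R.homog_mapArgs_i hx))
  f21 _ _ := rfl

end DeformationRetract

/-- Homotopy transfer for weak Lie `3`-algebras: a deformation retract `(L', d')` of the complex
underlying a weak Lie `3`-algebra `(L, d, λ)` carries the transferred weak Lie `3`-algebra
structure, and the inclusion `i` extends to a weak morphism `(L', d', λ') → (L, d, λ)`. -/
theorem mainTheorem1 {k : Type*} [CommRing k] {L L' : Type*} [AddCommGroup L] [Module k L]
    [AddCommGroup L'] [Module k L'] (C : ThreeTermComplex k L) (C' : ThreeTermComplex k L')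
    (A : WeakLie3Algebra C) (R : DeformationRetract C C') :
    ∃ (A' : WeakLie3Algebra C') (f : WeakLie3Mor A' A),
      R.IsTransferred A.toLie3Maps A'.toLie3Maps ∧
      f.f1 = R.i ∧ R.IsExtendedInclusion A.toLie3Maps f.toLie3MorMaps :=
  ⟨⟨R.transferred A.toLie3Maps, R.transferred_isWeakLie3 A.isWeakLie3⟩,
    ⟨R.inclusion A.toLie3Maps, R.inclusion_isWeakLie3Mor A.isWeakLie3⟩,
    R.isTransferred_transferred A.isWeakLie3, rfl, R.isExtendedInclusion_inclusion A.isWeakLie3⟩
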